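/- Notation. Faces of $\mathbb Z^2$ are unit squares. A set $Z$ of edges of $\mathbb Z^2$ is a *zipper with endpoint* the face $f$ if $f$ is the only face that has an odd number of edges in $Z$ (for example the edges crossed by a dual path from $f$ to infinity). Its Laplacian is $(\Delta_Z g)(v)=\sum_{w\sim v}\big(g(v)-s_{vw}\,g(w)\big)$ with $s_{vw}=-1$ if $vw\in Z$ and $s_{vw}=1$ otherwise, and $G^{Z}(u,v)$ is the limit of the inverses of the restrictions of $\Delta_Z$ (with Dirichlet boundary conditions) to finite vertex sets exhausting $\mathbb Z^2$. Let $G_Z$ be the Green's function $G^Z$ for the zipper with endpoint the face centered at $(-\frac12,-\frac12)$ that consists of the edges $\{(-m,-m),(-m+1,-m)\}$ and $\{(-m,-m),(-m,-m-1)\}$, $m\ge1$. Let $G_D$ be the Green's function (defined by the same limit, for the ordinary Laplacian) of $\mathbb Z^2$ with Dirichlet boundary $D=\{(k,k):k\le-1\}$, and for $y\ge 0$, $x+y$ even, let $G_H(x,y)=2G_D\big((0,0),(\frac{x-y}2,\frac{x+y}2)\big)$. Let $\Sigma$ be the double cover of the graph $\mathbb Z^2$ branched over the vertex $0$ (one vertex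 of degree $8$ over $0$), $\Xi$ the double cover of $(\mathbb Z+\frac12)^2$ branched over the face centered at $0$, and $v\mapsto v^\sigma$ the exchange of sheets. On each of them $G(v,w)=\lim_{n}[G_n(v,w)-G_n(v,v)]$, where $G_n$ is the Green's function on the preimage of $[-n,n]^2$ with Dirichlet boundary conditions, and $G^A(v,w)=G(v,w)-G(v^\sigma,w)$. **Corollary.** 1. For every zipper $Z$ the limit defining $G^Z$ exists, and for every $u$ the function $G^Z(u,\cdot)$ is the unique bounded function $g$ with $\Delta_Z g=\delta_u$. Likewise the limit defining $G_D$ exists, and for $u\notin D$ the function $G_D(u,\cdot)$ is the unique bounded function that vanishes on $D$ and has Laplacian $\delta_u$ off $D$. 2. $G_Z$ can be computed by an algorithm: there are computable integer-valued functions $a,b,d$ of $(u,v)\in\mathbb Z^2\times\mathbb Z^2$ with $d>0$ and $G_Z(u,v)=\big(a(u,v)+b(u,v)\sqrt2\big)/d(u,v)$ for all $u,v$. It is described by 3 and 4. 3. $G_Z(0,\cdot)$ is given by $G_H$: $G_Z\big(0,(i,j)\big)=\frac12G_H(i+j,|j-i|)$ for all $i,j\in\mathbb Z$. The function $G_H$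 satisfies the following relations, from which all its values can be computed: $G_H(2k,0)=4^{-k}\binom{2k}{k}$ and $G_H(0,2k)+G_H(0,2k+2)=\sqrt2\,G_H(2k,0)$ for $k\ge0$; $G_H(-2k,0)=0$ and $G_H(0,2k)=G_H(-1,2k-1)$ for $k\ge1$; $4G_H(x,y)=\sum_{\pm,\pm}G_H(x\pm1,y\pm1)$ for $y\ge1$, $x+y$ even; and, for even $x\ge0$, $2G_H(x,0)-G_H(x+1,1)-G_H(x-1,1)$ equals $1$ if $x=0$ and $0$ otherwise. 4. For general $u$, $G_Z(u,v)$ is obtained recursively by moving the endpoint of the zipper with a rank-two correction. Let $Z$ be a zipper with endpoint $f$, and let $pq\notin Z$ be an edge common to $f$ and another face $f'$. Then $Z'=Z\cup\{pq\}$ is a zipper with endpoint $f'$, and for all $u,v$ $$G^{Z'}(u,v)=G^Z(u,v)+a\,G^Z(p,v)+b\,G^Z(q,v),\qquad a=2G^Z(u,p)-2\sqrt2\,G^Z(u,q),\quad b=2G^Z(u,q)-2\sqrt2\,G^Z(u,p).$$ Moreover, if $Z$, $Z'$ are any zippers with endpoints $f$, $f'$, and $\varphi$ is an automorphism of the lattice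 $\mathbb Z^2$ that maps $f$ to $f'$ (for example the identity, if $f=f'$), then there is $\varepsilon:\mathbb Z^2\to\{\pm1\}$ such that for all edges $uv$ one has $\varepsilon(u)=\varepsilon(v)$ if and only if $uv\in Z\Leftrightarrow\varphi(u)\varphi(v)\in Z'$, and $G^{Z'}(\varphi(u),\varphi(v))=\varepsilon(u)\varepsilon(v)\,G^Z(u,v)$ for all $u,v$. 5. The limits defining $G_\Sigma$ and $G_\Xi$ exist, and all values of $G^A_\Sigma$ and $G^A_\Xi$ are in $\mathbb Q[\sqrt2]$. All values of $G_D$ are in $\mathbb Q\oplus\frac1{\sqrt2}\mathbb Q\oplus\frac1\pi\mathbb Q$, that is, of the form $a+b/\sqrt2+c/\pi$ with $a,b,c\in\mathbb Q$. -/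

import Mathlib

open Filter Topology

namespace ZipperGreen

noncomputable section

open scoped Classical

/-! ### Laplacians and Green functions on graphs -/

/-- The Laplacian of the graph `G` with edge signs `s` (parallel transports `±1`):
`(Δ f)(v) = ∑_{w ∼ v} (f v - s v w * f w)`. With `s = 1` it is the usual graph Laplacian. -/
def laplacian {V : Type*} (G : SimpleGraph V) (s : V → V → ℝ) (f : V → ℝ) (v : V) : ℝ :=
  ∑ᶠ w ∈ G.neighborSet v, (f v - s v w * f w)

/-- The Dirichlet Green function with finite set `U` of interior vertices: the inverse matrix of the
Laplacian acting on functions that vanish off `U` and restricted to `U`; it is extended by `0`. -/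
def dirichletGreen {V : Type*} (G : SimpleGraph V) (s : V → V → ℝ) (U : Finset V) (u v : V) : ℝ :=
  if h : u ∈ U ∧ v ∈ U then
    (Matrix.of fun x y : U => laplacian G s (Pi.single y.1 1) x.1)⁻¹ ⟨u, h.1⟩ ⟨v, h.2⟩
  else 0

/-- The Green function on an infinite graph with Dirichlet boundary `B`: the limit of the finite
Dirichlet Green functions, as the finite set `U` exhausts the graph. -/
def greenFunction {V : Type*} (G : SimpleGraph V) (s : V → V → ℝ) (B : Set V) (u v : V) : ℝ :=
  limUnder (atTop : Filter (Finset V)) fun U => dirichletGreen G s (U.filter (· ∉ B)) u v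

/-- The limit defining `greenFunction` exists. -/
def GreenConverges {V : Type*} (G : SimpleGraph V) (s : V → V → ℝ) (B : Set V) (u v : V) : Prop :=
  Tendsto (fun U : Finset V => dirichletGreen G s (U.filter (· ∉ B)) u v) atTop
    (𝓝 (greenFunction G s B u v))

/-- `g` is a bounded solution of `Δ g = δ_u` off `B` that vanishes on `B`, that is, the row at `u` of
a bounded inverse of the Laplacian with Dirichlet boundary `B`. -/
def IsInverseRow {V : Type*} (G : SimpleGraph V) (s : V → V → ℝ) (B : Set V) (u : V)
    (g : V → ℝ) : Prop :=
  (∀ v ∈ B, g v = 0) ∧ (∀ v ∉ B, laplacian G s g v = if v = u then 1 else 0) ∧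
    ∃ C : ℝ, ∀ v, |g v| ≤ C

/-- For recurrent graphs: `lim_n (G_n(v,w) - G_n(v,v))` along an exhaustion `U n`. -/
def potentialGreen {V : Type*} (G : SimpleGraph V) (U : ℕ → Finset V) (v w : V) : ℝ :=
  limUnder atTop fun n => dirichletGreen G 1 (U n) v w - dirichletGreen G 1 (U n) v v

/-- The limit defining `potentialGreen` exists. -/
def PotentialConverges {V : Type*} (G : SimpleGraph V) (U : ℕ → Finset V) (v w : V) : Prop :=
  Tendsto (fun n => dirichletGreen G 1 (U n) v w - dirichletGreen G 1 (U n) v v) atTop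
    (𝓝 (potentialGreen G U v w))

/-! ### The square lattice and zippers -/

/-- The square lattice. -/
def lattice : SimpleGraph (ℤ × ℤ) where
  Adj u v := |u.1 - v.1| + |u.2 - v.2| = 1
  symm := ⟨fun u v h => by rwa [abs_sub_comm v.1, abs_sub_comm v.2]⟩
  loopless := ⟨fun u h => by simp at h⟩

/-- The corners of the unit face centered at `f + (1/2, 1/2)`; faces are indexed by `f`. -/
def faceCorners (f : ℤ × ℤ) : Set (ℤ × ℤ) :=
  {f, f + (1, 0), f + (1, 1), f + (0, 1)}

/-- The four edges of the face `f`. -/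
def faceEdges (f : ℤ × ℤ) : Set (Sym2 (ℤ × ℤ)) :=
  {s(f, f + (1, 0)), s(f + (1, 0), f + (1, 1)), s(f + (1, 1), f + (0, 1)), s(f + (0, 1), f)}

/-- A set of edges `Z` is a zipper with endpoint in the face `f` if `f` is the only face with an odd
number of edges in `Z`. The edges crossed by a dual path from `f` to infinity are of this kind. -/
def IsZipper (f : ℤ × ℤ) (Z : Set (Sym2 (ℤ × ℤ))) : Prop :=
  Z ⊆ lattice.edgeSet ∧ ∀ g : ℤ × ℤ, Odd (faceEdges g ∩ Z).ncard ↔ g = f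

/-- The edge signs of a zipper: `-1` on its edges and `1` on all others. -/
def zipperSign (Z : Set (Sym2 (ℤ × ℤ))) (u v : ℤ × ℤ) : ℝ :=
  if s(u, v) ∈ Z then -1 else 1

/-- The Green function of the square lattice with zipper `Z`. -/
def greenZipper (Z : Set (Sym2 (ℤ × ℤ))) : ℤ × ℤ → ℤ × ℤ → ℝ :=
  greenFunction lattice (zipperSign Z) ∅

/-- The zipper that starts in the face centered at `(-1/2, -1/2)` and runs just below the negative
diagonal: the edges from `(-m, -m)` to `(-m + 1, -m)` and to `(-m, -m - 1)`, for `m ≥ 1`. -/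
def diagonalZipper : Set (Sym2 (ℤ × ℤ)) :=
  {e | ∃ m : ℤ, 1 ≤ m ∧ (e = s((-m, -m), (-m + 1, -m)) ∨ e = s((-m, -m), (-m, -m - 1)))}

/-- The zipper Green function `G_Z`. -/
def GZ : ℤ × ℤ → ℤ × ℤ → ℝ := greenZipper diagonalZipper

/-- The slit `D`. -/
def slit : Set (ℤ × ℤ) := {v | ∃ k : ℤ, k ≤ -1 ∧ v = (k, k)}

/-- The Green function `G_D` of the square lattice with Dirichlet boundary `D`. -/
def GD : ℤ × ℤ → ℤ × ℤ → ℝ := greenFunction lattice 1 slit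

/-- The function `G_H(x, y) = 2 G_D(0, ((x - y)/2, (x + y)/2))`, for `y ≥ 0` and `x + y` even
(other arguments are never used). -/
def GH (x y : ℤ) : ℝ := 2 * GD 0 ((x - y) / 2, (x + y) / 2)

/-! ### The branched double covers -/

/-- Vertices of the double cover `Σ` of `ℤ²` branched over the origin: a point with a sheet
(`false` is the principal branch), and a single vertex over the origin. -/
abbrev SigmaVertex : Type := {x : (ℤ × ℤ) × Bool // x.1 = 0 → x.2 = false}

/-- The graph `Σ`. An edge changes the sheet exactly if it crosses the branch cut just below the
negative diagonal; the vertex over the origin is adjacent to both lifts of its four neighbors. -/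
def sigmaGraph : SimpleGraph SigmaVertex where
  Adj x y := lattice.Adj x.1.1 y.1.1 ∧
    (x.1.1 = 0 ∨ y.1.1 = 0 ∨ (x.1.2 = y.1.2 ↔ s(x.1.1, y.1.1) ∉ diagonalZipper))
  symm := ⟨fun x y h => ⟨h.1.symm, by
    rcases h.2 with h | h | h
    · exact Or.inr (Or.inl h)
    · exact Or.inl h
    · refine Or.inr (Or.inr ?_)
      rw [Sym2.eq_swap, eq_comm]
      exact h⟩⟩
  loopless := ⟨fun x h => lattice.loopless.irrefl _ h.1⟩

/-- The exchange of sheets of `Σ`. -/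
def sigmaSwap (x : SigmaVertex) : SigmaVertex :=
  ⟨(x.1.1, if x.1.1 = 0 then false else !x.1.2), fun h => if_pos h⟩

/-- The preimage in `Σ` of `ℤ² ∩ [-n, n]²`. -/
def sigmaBox (n : ℕ) : Finset SigmaVertex :=
  ((Finset.Icc (-(n : ℤ)) n ×ˢ Finset.Icc (-(n : ℤ)) n) ×ˢ Finset.univ).subtype _

/-- The Green function `G_Σ`. -/
def GSigma : SigmaVertex → SigmaVertex → ℝ := potentialGreen sigmaGraph sigmaBox

/-- The antisymmetric Green function on `Σ`. -/
def GSigmaA (v w : SigmaVertex) : ℝ := GSigma v w - GSigma (sigmaSwap v) w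

/-- Vertices of the double cover `Ξ` of `(ℤ + 1/2)²` branched over the face centered at the origin:
`((i, j), b)` lies over `(i + 1/2, j + 1/2)`, on the principal branch if `b` is `false`. -/
abbrev XiVertex : Type := (ℤ × ℤ) × Bool

/-- The graph `Ξ`. The branch cut consists of the edges from `(-k, -k)` to `(-k + 1, -k)` and to
`(-k, -k - 1)` with `k = 1/2, 3/2, …`; in the coordinates `(i, j)` this is the diagonal zipper. -/
def xiGraph : SimpleGraph XiVertex where
  Adj x y := lattice.Adj x.1 y.1 ∧ (x.2 = y.2 ↔ s(x.1, y.1) ∉ diagonalZipper)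
  symm := ⟨fun x y h => ⟨h.1.symm, by
    rw [Sym2.eq_swap, eq_comm]
    exact h.2⟩⟩
  loopless := ⟨fun x h => lattice.loopless.irrefl _ h.1⟩

/-- The exchange of sheets of `Ξ`. -/
def xiSwap (x : XiVertex) : XiVertex := (x.1, !x.2)

/-- The preimage in `Ξ` of `(ℤ + 1/2)² ∩ [-n, n]²`. -/
def xiBox (n : ℕ) : Finset XiVertex :=
  (Finset.Icc (-(n : ℤ)) (n - 1) ×ˢ Finset.Icc (-(n : ℤ)) (n - 1)) ×ˢ Finset.univ

/-- The Green function `G_Ξ`. -/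
def GXi : XiVertex → XiVertex → ℝ := potentialGreen xiGraph xiBox

/-- The antisymmetric Green function on `Ξ`. -/
def GXiA (v w : XiVertex) : ℝ := GXi v w - GXi (xiSwap v) w

end

end ZipperGreen

open ZipperGreen

namespace ZipperGreen

open scoped Classical

/-! ### The Laplacian of a locally finite graph -/

section General

variable {V : Type*} {G : SimpleGraph V} {s : V → V → ℝ}

/-! The signed Laplacian belongs to a quadratic form, the sum over edges of the squared covariant
differences. If evaluation at one vertex is bounded by the square root of this energy, it is so
bounded at every vertex (`Nondeg`). Finite Dirichlet problems are then uniquely solvable, the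
diagonal values of the finite Green functions increase to a finite limit, and Pythagoras in the
energy norm makes all values converge (`greenConverges`). A nonempty Dirichlet boundary gives
`Nondeg` trivially; a zipper gives it because transport around its end face is -1. As the square
lattice is recurrent, logarithmic cutoffs show that bounded harmonic functions vanish
(`eq_zero_of_harmonic`). Identities between infinite Green functions are proved by this uniqueness:
a bounded function with the right Laplacian is exhibited.

Explicit values come from discrete exponentials. After a rotation by 45 degrees, `rot s ^ x * s ^ y`
is harmonic and, for `|s| < 1`, decays in `y`. Folding the slit plane along the diagonal gives a
half-plane with Dirichlet conditions on the negative axis and Neumann conditions on the positive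
one. The real part of an integral of exponentials solves this problem (`isInverseRow_halfGreen`): a
recursion in `x` makes the integral vanish at odd positive boundary points, and since conjugation
corresponds to `x ↦ -x - 1`, this yields both boundary conditions.

Reflection in the diagonal preserves the diagonal zipper up to the gauge sign -1 on the slit. Hence
`GZ u + GZ u.swap` vanishes on the slit, where all zipper edges end, and it equals the corresponding
sum for `GD` (`GZ_add_swap`). For `u = 0` this gives `GZ 0 = GD 0`, in particular the values 1/2 and
(√2 - 1)/2 at corners of the end face. These are what is needed to invert the rank-two perturbation
that moves the endpoint (`greenZipper_move`). A flat sign connection is trivial, so zippers with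
matching end faces are gauge equivalent. Moving the endpoint by one unit and translating back is
therefore a recursion for `GZ` (`GZ_shift`), which together with the reflection reduces the first
argument to 0 and computes `GZ` in ℚ[√2] (`rep_GZ`).

The antisymmetric part `GD v - GD v.swap` is, by images, a difference of potential kernels, whose
values are rational combinations of 1 and 1/π (`GD_sub_swap`). On a double cover the Green function
is half the sum of an even part, which gives the potential kernel, and an odd part, which is a
zipper Green function (with an additional zero at the branch vertex of `Σ`). Only the odd part
survives in the antisymmetrization. -/

lemma laplacian_add {v : V} (h : (G.neighborSet v).Finite) (f g : V → ℝ) :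
    laplacian G s (fun w => f w + g w) v = laplacian G s f v + laplacian G s g v := by
  unfold laplacian
  rw [← finsum_mem_add_distrib h]
  exact finsum_mem_congr rfl fun w _ => by ring

lemma laplacian_const_mul {v : V} (h : (G.neighborSet v).Finite) (c : ℝ) (f : V → ℝ) :
    laplacian G s (fun w => c * f w) v = c * laplacian G s f v := by
  unfold laplacian
  rw [← smul_eq_mul, smul_finsum_mem h]
  exact finsum_mem_congr rfl fun w _ => by simp only [smul_eq_mul]; ring

lemma laplacian_sum {ι : Type*} {v : V} (h : (G.neighborSet v).Finite) (t : Finset ι)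
    (f : ι → V → ℝ) :
    laplacian G s (fun w => ∑ i ∈ t, f i w) v = ∑ i ∈ t, laplacian G s (f i) v := by
  induction t using Finset.induction_on with
  | empty => simp [laplacian]
  | insert i t hi ih =>
    simp only [Finset.sum_insert hi]
    rw [laplacian_add h, ih]

lemma laplacian_eq_sum_single {v : V} (h : (G.neighborSet v).Finite) (U : Finset V) {f : V → ℝ}
    (hf : ∀ w ∉ U, f w = 0) :
    laplacian G s f v = ∑ y ∈ U, f y * laplacian G s (Pi.single y 1) v := by
  have : f = fun w => ∑ y ∈ U, f y * (Pi.single y 1 : V → ℝ) w := by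
    funext w
    by_cases hw : w ∈ U
    · rw [Finset.sum_eq_single w] <;> simp +contextual [hw]
    · rw [hf w hw, Finset.sum_eq_zero]
      intro y hy
      have : w ≠ y := fun e => hw (e ▸ hy)
      simp [this]
  conv_lhs => rw [this]
  rw [laplacian_sum h]
  exact Finset.sum_congr rfl fun y _ => laplacian_const_mul h _ _

/-- A family of functions supported on `U` with `Δ (g u) = δ_u` on `U` is the Dirichlet Green
function. -/
theorem dirichletGreen_eq_of_rows (hG : ∀ v, (G.neighborSet v).Finite) (U : Finset V)
    (g : V → V → ℝ) (h0 : ∀ u ∈ U, ∀ v ∉ U, g u v = 0)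
    (h1 : ∀ u ∈ U, ∀ v ∈ U, laplacian G s (g u) v = if v = u then 1 else 0)
    {u v : V} (hu : u ∈ U) (hv : v ∈ U) : dirichletGreen G s U u v = g v u := by
  unfold dirichletGreen
  rw [dif_pos ⟨hu, hv⟩]
  -- The functions `g y` are placed as columns of a right inverse; hence the transposed arguments in
  -- the conclusion.
  have : (Matrix.of fun x y : U => laplacian G s (Pi.single y.1 1) x.1) *
      (Matrix.of fun x y : U => g y.1 x.1) = 1 := by
    ext x y
    rw [Matrix.mul_apply]
    have := laplacian_eq_sum_single (s := s) (hG x.1) U (h0 y.1 y.2)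
    rw [h1 y.1 y.2 x.1 x.2, ← Finset.sum_coe_sort] at this
    simp only [Matrix.of_apply, Matrix.one_apply]
    rw [Finset.sum_congr rfl fun j _ => mul_comm _ _, ← this]
    by_cases h : x = y
    · simp [h]
    · rw [if_neg h, if_neg fun h' => h (Subtype.ext h')]
  rw [Matrix.inv_eq_right_inv this]
  rfl

lemma dirichletGreen_of_notMem {U : Finset V} {u v : V} (h : ¬ (u ∈ U ∧ v ∈ U)) :
    dirichletGreen G s U u v = 0 := dif_neg h

end General

/-! ### Energy on the square lattice -/

lemma neighborSet_lattice (v : ℤ × ℤ) :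
    lattice.neighborSet v = {v + (1, 0), v + (-1, 0), v + (0, 1), v + (0, -1)} := by
  ext w
  obtain ⟨a, b⟩ := v
  obtain ⟨c, d⟩ := w
  simp only [SimpleGraph.mem_neighborSet, lattice, Set.mem_insert_iff, Set.mem_singleton_iff,
    Prod.mk_add_mk, Prod.mk.injEq]
  constructor
  · intro h
    rcases abs_cases (a - c) with ⟨h1, _⟩ | ⟨h1, _⟩ <;>
      rcases abs_cases (b - d) with ⟨h2, _⟩ | ⟨h2, _⟩ <;> omega
  · rintro (⟨rfl, rfl⟩ | ⟨rfl, rfl⟩ | ⟨rfl, rfl⟩ | ⟨rfl, rfl⟩) <;> simp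

lemma neighborSet_lattice_finite (v : ℤ × ℤ) : (lattice.neighborSet v).Finite := by
  rw [neighborSet_lattice]; exact Set.toFinite _

lemma laplacian_lattice (s : ℤ × ℤ → ℤ × ℤ → ℝ) (f : ℤ × ℤ → ℝ) (v : ℤ × ℤ) :
    laplacian lattice s f v = (f v - s v (v + (1, 0)) * f (v + (1, 0))) +
      (f v - s v (v + (-1, 0)) * f (v + (-1, 0))) + (f v - s v (v + (0, 1)) * f (v + (0, 1))) +
      (f v - s v (v + (0, -1)) * f (v + (0, -1))) := by
  unfold laplacian
  rw [neighborSet_lattice]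
  rw [finsum_mem_insert _ _ (Set.toFinite _), finsum_mem_insert _ _ (Set.toFinite _),
    finsum_mem_insert _ _ (Set.toFinite _), finsum_mem_singleton]
  · ring
  all_goals simp [Prod.ext_iff]

/-- Symmetric edge signs. -/
structure IsSign (s : ℤ × ℤ → ℤ × ℤ → ℝ) : Prop where
  symm : ∀ u v, s u v = s v u
  sq : ∀ u v, s u v * s u v = 1

lemma IsSign.abs {s : ℤ × ℤ → ℤ × ℤ → ℝ} (hs : IsSign s) (u v : ℤ × ℤ) : |s u v| = 1 := by
  rcases mul_self_eq_one_iff.mp (hs.sq u v) with h | h <;> simp [h]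

lemma isSign_one : IsSign 1 := ⟨fun _ _ => rfl, fun _ _ => by simp⟩

lemma isSign_zipperSign (Z : Set (Sym2 (ℤ × ℤ))) : IsSign (zipperSign Z) :=
  ⟨fun u v => by simp [zipperSign, Sym2.eq_swap], fun u v => by
    unfold zipperSign; split_ifs <;> simp⟩

variable {s : ℤ × ℤ → ℤ × ℤ → ℝ}

/-- The covariant difference of `f` along the edge from `v` to `v + d`. -/
def grad (s : ℤ × ℤ → ℤ × ℤ → ℝ) (f : ℤ × ℤ → ℝ) (d v : ℤ × ℤ) : ℝ :=
  f v - s v (v + d) * f (v + d)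

/-- The Dirichlet form. -/
noncomputable def form (s : ℤ × ℤ → ℤ × ℤ → ℝ) (f g : ℤ × ℤ → ℝ) : ℝ :=
  ∑ᶠ v, (grad s f (1, 0) v * grad s g (1, 0) v + grad s f (0, 1) v * grad s g (0, 1) v)

lemma finite_support_shift {f : ℤ × ℤ → ℝ} (hf : f.support.Finite) (d : ℤ × ℤ) :
    (Function.support fun v => f (v + d)).Finite :=
  hf.preimage ((add_left_injective d).injOn)

lemma finite_support_grad {f : ℤ × ℤ → ℝ} (hf : f.support.Finite) (d : ℤ × ℤ) :
    (grad s f d).support.Finite := by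
  refine (hf.union (finite_support_shift hf d)).subset fun v hv => ?_
  by_contra h
  simp only [Set.mem_union, Function.mem_support, not_or, not_not] at h
  exact hv (by simp [grad, h.1, h.2])

lemma finite_support_mul_left {f : ℤ × ℤ → ℝ} (hf : f.support.Finite) (g : ℤ × ℤ → ℝ) :
    (Function.support fun v => f v * g v).Finite :=
  hf.subset fun _ hv => left_ne_zero_of_mul hv

lemma finite_support_mul_right {f : ℤ × ℤ → ℝ} (hf : f.support.Finite) (g : ℤ × ℤ → ℝ) :
    (Function.support fun v => g v * f v).Finite :=
  hf.subset fun _ hv => right_ne_zero_of_mul hv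

lemma finite_support_add {f g : ℤ × ℤ → ℝ} (hf : f.support.Finite) (hg : g.support.Finite) :
    (Function.support fun v => f v + g v).Finite :=
  (hf.union hg).subset (Function.support_add f g)

lemma finsum_shift (f : ℤ × ℤ → ℝ) (d : ℤ × ℤ) : ∑ᶠ v, f (v + d) = ∑ᶠ v, f v :=
  finsum_comp_equiv (Equiv.addRight d)

/-- Summation by parts. -/
theorem form_eq_finsum (hs : IsSign s) (g : ℤ × ℤ → ℝ) {φ : ℤ × ℤ → ℝ}
    (hφ : φ.support.Finite) : form s g φ = ∑ᶠ v, φ v * laplacian lattice s g v := by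
  -- The product on an edge splits into one term at each end. The term at the far end uses that the
  -- sign squares to 1.
  have key : ∀ d v, grad s g d v * grad s φ d v = φ v * grad s g d v +
      (fun w => φ w * grad s g (-d) w) (v + d) := by
    intro d v
    have h1 := hs.sq v (v + d)
    simp only [grad, add_neg_cancel_right]
    rw [hs.symm (v + d) v]
    linear_combination φ (v + d) * g (v + d) * h1
  have hsum : ∀ d, ∑ᶠ v, grad s g d v * grad s φ d v =
      ∑ᶠ v, φ v * (grad s g d v + grad s g (-d) v) := by
    intro d
    simp_rw [key d]
    rw [finsum_add_distrib (finite_support_mul_left hφ _)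
      (finite_support_shift (f := fun w => φ w * grad s g (-d) w) (finite_support_mul_left hφ _) d),
      finsum_shift (fun w => φ w * grad s g (-d) w) d,
      ← finsum_add_distrib (finite_support_mul_left hφ _) (finite_support_mul_left hφ _)]
    simp_rw [mul_add]
  unfold form
  rw [finsum_add_distrib (finite_support_mul_right (finite_support_grad hφ _) _)
    (finite_support_mul_right (finite_support_grad hφ _) _), hsum, hsum,
    ← finsum_add_distrib (finite_support_mul_left hφ _) (finite_support_mul_left hφ _)]
  refine finsum_congr fun v => ?_
  rw [laplacian_lattice]
  simp only [grad, Prod.neg_mk, neg_zero]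
  ring

lemma form_comm (f g : ℤ × ℤ → ℝ) : form s f g = form s g f :=
  finsum_congr fun _ => by ring

lemma finite_support_form {f : ℤ × ℤ → ℝ} (hf : f.support.Finite) (g : ℤ × ℤ → ℝ) :
    (Function.support fun v => grad s f (1, 0) v * grad s g (1, 0) v +
      grad s f (0, 1) v * grad s g (0, 1) v).Finite :=
  finite_support_add (finite_support_mul_left (finite_support_grad hf _) _)
    (finite_support_mul_left (finite_support_grad hf _) _)

lemma form_self_nonneg (f : ℤ × ℤ → ℝ) : 0 ≤ form s f f :=
  finsum_nonneg fun _ => add_nonneg (mul_self_nonneg _) (mul_self_nonneg _)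

lemma sq_grad_le {f : ℤ × ℤ → ℝ} (hf : f.support.Finite) (v : ℤ × ℤ) :
    grad s f (1, 0) v * grad s f (1, 0) v + grad s f (0, 1) v * grad s f (0, 1) v ≤ form s f f :=
  single_le_finsum v (finite_support_form hf f)
    fun _ => add_nonneg (mul_self_nonneg _) (mul_self_nonneg _)

lemma abs_grad_right_le {f : ℤ × ℤ → ℝ} (hf : f.support.Finite) (v : ℤ × ℤ) :
    |grad s f (1, 0) v| ≤ √(form s f f) :=
  Real.abs_le_sqrt (by nlinarith [sq_grad_le (s := s) hf v, mul_self_nonneg (grad s f (0, 1) v)])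

lemma abs_grad_up_le {f : ℤ × ℤ → ℝ} (hf : f.support.Finite) (v : ℤ × ℤ) :
    |grad s f (0, 1) v| ≤ √(form s f f) :=
  Real.abs_le_sqrt (by nlinarith [sq_grad_le (s := s) hf v, mul_self_nonneg (grad s f (1, 0) v)])

/-- Point evaluation at `u` is bounded in energy on finitely supported functions that vanish
on `B`. -/
def EvalBounded (s : ℤ × ℤ → ℤ × ℤ → ℝ) (B : Set (ℤ × ℤ)) (u : ℤ × ℤ) : Prop :=
  ∃ C : ℝ, 0 ≤ C ∧ ∀ f : ℤ × ℤ → ℝ, f.support.Finite → (∀ v ∈ B, f v = 0) →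
    |f u| ≤ C * √(form s f f)

/-- Point evaluations are bounded in energy. -/
def Nondeg (s : ℤ × ℤ → ℤ × ℤ → ℝ) (B : Set (ℤ × ℤ)) : Prop := ∀ u, EvalBounded s B u

/-- Passing to a neighbor costs one covariant difference, at most the square root of the energy; the
edge sign disappears under the absolute value. The constant grows by 1. -/
lemma evalBounded_step (hs : IsSign s) {B : Set (ℤ × ℤ)} {u w : ℤ × ℤ}
    (h : ∀ f : ℤ × ℤ → ℝ, f.support.Finite → |f u - s u w * f w| ≤ √(form s f f)) :
    EvalBounded s B u ↔ EvalBounded s B w := by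
  have key : ∀ f : ℤ × ℤ → ℝ, f.support.Finite → |(|f u| - |f w|)| ≤ √(form s f f) := by
    intro f hf
    have : |f w| = |s u w * f w| := by rw [abs_mul, hs.abs, one_mul]
    rw [this]
    exact (abs_abs_sub_abs_le_abs_sub _ _).trans (h f hf)
  constructor
  · rintro ⟨C, hC, hb⟩
    refine ⟨C + 1, by linarith, fun f hf h0 => ?_⟩
    have := abs_le.mp (key f hf)
    linarith [hb f hf h0]
  · rintro ⟨C, hC, hb⟩
    refine ⟨C + 1, by linarith, fun f hf h0 => ?_⟩
    have := abs_le.mp (key f hf)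
    linarith [hb f hf h0]

lemma evalBounded_step_right (hs : IsSign s) {B : Set (ℤ × ℤ)} (u : ℤ × ℤ) :
    EvalBounded s B u ↔ EvalBounded s B (u + (1, 0)) :=
  evalBounded_step hs fun _ hf => abs_grad_right_le hf u

lemma evalBounded_step_up (hs : IsSign s) {B : Set (ℤ × ℤ)} (u : ℤ × ℤ) :
    EvalBounded s B u ↔ EvalBounded s B (u + (0, 1)) :=
  evalBounded_step hs fun _ hf => abs_grad_up_le hf u

lemma int_iff_of_step {P : ℤ → Prop} (h : ∀ i, P i ↔ P (i + 1)) (i j : ℤ) : P i ↔ P j := by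
  have : ∀ i, P i ↔ P 0 := fun i => by
    induction i using Int.induction_on with
    | zero => rfl
    | succ n ih => rw [← h, ih]
    | pred n ih => rw [h, sub_add_cancel, ih]
  rw [this i, this j]

lemma lattice_iff_of_step {P : ℤ × ℤ → Prop} (h1 : ∀ v, P v ↔ P (v + (1, 0)))
    (h2 : ∀ v, P v ↔ P (v + (0, 1))) (u v : ℤ × ℤ) : P u ↔ P v :=
  (int_iff_of_step (P := fun i => P (i, u.2)) (fun i => by simpa using h1 (i, u.2)) u.1 v.1).trans
    (int_iff_of_step (P := fun j => P (v.1, j)) (fun j => by simpa using h2 (v.1, j)) u.2 v.2)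

lemma nondeg_of_evalBounded (hs : IsSign s) {B : Set (ℤ × ℤ)} {u : ℤ × ℤ}
    (h : EvalBounded s B u) : Nondeg s B := fun v =>
  (lattice_iff_of_step (evalBounded_step_right hs) (evalBounded_step_up hs) u v).mp h

lemma nondeg_of_mem (hs : IsSign s) {B : Set (ℤ × ℤ)} {u : ℤ × ℤ} (h : u ∈ B) : Nondeg s B :=
  nondeg_of_evalBounded (u := u) hs ⟨0, le_rfl, fun f _ h0 => by simp [h0 _ h]⟩

/-! ### Finite Green functions on the square lattice -/

section Finite

variable {B : Set (ℤ × ℤ)} {U : Finset (ℤ × ℤ)}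

lemma finite_support_of_notMem {f : ℤ × ℤ → ℝ} (hf : ∀ v ∉ U, f v = 0) : f.support.Finite :=
  U.finite_toSet.subset fun v hv => by
    by_contra h
    exact hv (hf v h)

lemma finsum_mul_delta {f : ℤ × ℤ → ℝ} {g : ℤ × ℤ → ℝ} (hf : ∀ v ∉ U, f v = 0) {u : ℤ × ℤ}
    (hg : ∀ v ∈ U, g v = if v = u then 1 else 0) : ∑ᶠ v, f v * g v = f u := by
  rw [finsum_eq_single _ u]
  · by_cases hu : u ∈ U
    · simp [hg u hu]
    · simp [hf u hu]
  · intro v hv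
    by_cases hu : v ∈ U
    · simp [hg v hu, hv]
    · simp [hf v hu]

/-- A function in the kernel of the finite Laplacian has energy zero, so it vanishes by `Nondeg`; an
injective endomorphism of a finite-dimensional space is surjective. -/
lemma exists_row (hs : IsSign s) (hn : Nondeg s B) (hU : ∀ v ∈ U, v ∉ B) (u : ℤ × ℤ) :
    ∃ g : ℤ × ℤ → ℝ, (∀ v ∉ U, g v = 0) ∧
      ∀ v ∈ U, laplacian lattice s g v = if v = u then 1 else 0 := by
  let ext : (U → ℝ) → ℤ × ℤ → ℝ := fun f v => if h : v ∈ U then f ⟨v, h⟩ else 0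
  have ext_out : ∀ f, ∀ v ∉ U, ext f v = 0 := fun f v hv => dif_neg hv
  have ext_add : ∀ f g, ext (f + g) = fun v => ext f v + ext g v := by
    intro f g; funext v; simp only [ext]; split_ifs <;> simp
  have ext_smul : ∀ (c : ℝ) f, ext (c • f) = fun v => c * ext f v := by
    intro f g; funext v; simp only [ext]; split_ifs <;> simp
  let L : (U → ℝ) →ₗ[ℝ] (U → ℝ) :=
    { toFun := fun f x => laplacian lattice s (ext f) x.1
      map_add' := fun f g => by
        funext x
        rw [ext_add, laplacian_add (neighborSet_lattice_finite _)]; rfl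
      map_smul' := fun c f => by
        funext x
        rw [ext_smul, laplacian_const_mul (neighborSet_lattice_finite _)]; rfl }
  have hinj : Function.Injective L := by
    rw [injective_iff_map_eq_zero]
    intro f hf
    have hfin := finite_support_of_notMem (ext_out f)
    have h0 : form s (ext f) (ext f) = 0 := by
      rw [form_eq_finsum hs _ hfin, finsum_eq_zero_of_forall_eq_zero]
      intro v
      by_cases hv : v ∈ U
      · have : laplacian lattice s (ext f) v = 0 := congrFun hf ⟨v, hv⟩
        simp [this]
      · simp [ext_out f v hv]
    funext x
    obtain ⟨C, _, hC⟩ := hn x.1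
    have := hC (ext f) hfin fun v hv => ext_out f v fun h => hU v h hv
    rw [h0, Real.sqrt_zero, mul_zero] at this
    have := abs_nonpos_iff.mp this
    simpa [ext] using this
  obtain ⟨f, hf⟩ := (LinearMap.injective_iff_surjective.mp hinj) fun x => if x.1 = u then 1 else 0
  exact ⟨ext f, ext_out f, fun v hv => congrFun hf ⟨v, hv⟩⟩

/-- Both sides are the energy pairing of the two rows, by summation by parts in either order. -/
lemma row_symm (hs : IsSign s) {u v : ℤ × ℤ} {f g : ℤ × ℤ → ℝ} (hf : ∀ v ∉ U, f v = 0)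
    (hf1 : ∀ w ∈ U, laplacian lattice s f w = if w = u then 1 else 0) (hg : ∀ v ∉ U, g v = 0)
    (hg1 : ∀ w ∈ U, laplacian lattice s g w = if w = v then 1 else 0) : f v = g u := by
  have h1 := form_eq_finsum hs f (finite_support_of_notMem hg)
  have h2 := form_eq_finsum hs g (finite_support_of_notMem hf)
  rw [finsum_mul_delta hg hf1] at h1
  rw [finsum_mul_delta hf hg1] at h2
  rw [← h1, ← h2, form_comm]

/-- Rows of the Dirichlet Green function. -/
theorem dirichletGreen_row (hs : IsSign s) (hn : Nondeg s B) (hU : ∀ v ∈ U, v ∉ B) {u : ℤ × ℤ}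
    (hu : u ∈ U) : (∀ v ∉ U, dirichletGreen lattice s U u v = 0) ∧
      ∀ v ∈ U, laplacian lattice s (dirichletGreen lattice s U u) v = if v = u then 1 else 0 := by
  choose g g0 g1 using exists_row hs hn hU
  have : dirichletGreen lattice s U u = g u := by
    funext v
    by_cases hv : v ∈ U
    · rw [dirichletGreen_eq_of_rows neighborSet_lattice_finite U g (fun u _ => g0 u)
        (fun u _ v hv => by rw [g1 u v hv]; congr) hu hv]
      exact row_symm hs (g0 v) (g1 v) (g0 u) (g1 u)
    · rw [dirichletGreen_of_notMem fun h => hv h.2, g0 u v hv]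
  rw [this]
  exact ⟨g0 u, g1 u⟩

lemma dirichletGreen_comm (hs : IsSign s) (hn : Nondeg s B) (hU : ∀ v ∈ U, v ∉ B)
    (u v : ℤ × ℤ) : dirichletGreen lattice s U u v = dirichletGreen lattice s U v u := by
  by_cases h : u ∈ U ∧ v ∈ U
  · have h1 := dirichletGreen_row hs hn hU h.1
    have h2 := dirichletGreen_row hs hn hU h.2
    exact row_symm hs h1.1 h1.2 h2.1 h2.2
  · rw [dirichletGreen_of_notMem h, dirichletGreen_of_notMem (by tauto)]

/-- The maximum principle: a function that is harmonic on a finite set is bounded by its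
values off the set. -/
theorem abs_le_of_harmonicOn (hs : IsSign s) {g : ℤ × ℤ → ℝ} {M : ℝ}
    (hg : ∀ v ∈ U, laplacian lattice s g v = 0) (hM : ∀ v ∉ U, |g v| ≤ M) (v : ℤ × ℤ) :
    |g v| ≤ M := by
  by_contra! hv
  have hvU : v ∈ U := by
    by_contra h
    exact absurd (hM v h) (not_le.mpr hv)
  obtain ⟨w, hw, hmax⟩ := U.exists_max_image (fun w => |g w|) ⟨v, hvU⟩
  have hwM : M < |g w| := hv.trans_le (hmax v hvU)
  -- Among the points of maximal modulus the one furthest to the right is chosen. Its right neighbor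
  -- is then strictly smaller, which contradicts the mean value property.
  obtain ⟨x, hx, hxmax⟩ := (U.filter fun x => |g x| = |g w|).exists_max_image (fun x => x.1)
    ⟨w, by simp [hw]⟩
  simp only [Finset.mem_filter] at hx hxmax
  have hle : ∀ y, |g y| ≤ |g w| := fun y => by
    by_cases hy : y ∈ U
    · exact hmax y hy
    · exact (hM y hy).trans hwM.le
  have hlt : |g (x + (1, 0))| < |g w| := by
    refine lt_of_le_of_ne (hle _) fun h => ?_
    by_cases hy : x + (1, 0) ∈ U
    · have := hxmax _ ⟨hy, h⟩
      simp at this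
    · exact absurd (hM _ hy) (not_le.mpr (h ▸ hwM))
  have h0 := hg x hx.1
  rw [laplacian_lattice] at h0
  have habs : ∀ y, |s x y * g y| = |g y| := fun y => by rw [abs_mul, hs.abs, one_mul]
  have e1 := habs (x + (1, 0))
  have e2 := habs (x + (-1, 0))
  have e3 := habs (x + (0, 1))
  have e4 := habs (x + (0, -1))
  have l2 := hle (x + (-1, 0))
  have l3 := hle (x + (0, 1))
  have l4 := hle (x + (0, -1))
  rw [← e1] at hlt
  rw [← e2] at l2
  rw [← e3] at l3
  rw [← e4] at l4
  have hx2 := hx.2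
  have a1 := abs_lt.mp hlt
  have a2 := abs_le.mp l2
  have a3 := abs_le.mp l3
  have a4 := abs_le.mp l4
  rcases abs_cases (g x) with ⟨h, _⟩ | ⟨h, _⟩ <;> rw [h] at hx2 <;> linarith

/-- The row is harmonic on `U` without its pole, so the maximum principle bounds it by the value at
the pole. -/
lemma abs_dirichletGreen_le (hs : IsSign s) (hn : Nondeg s B) (hU : ∀ v ∈ U, v ∉ B)
    (u v : ℤ × ℤ) : |dirichletGreen lattice s U u v| ≤ |dirichletGreen lattice s U u u| := by
  by_cases hu : u ∈ U
  · obtain ⟨h0, h1⟩ := dirichletGreen_row hs hn hU hu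
    refine abs_le_of_harmonicOn (U := U.erase u) hs (fun w hw => ?_) (fun w hw => ?_) v
    · rw [h1 w (Finset.mem_of_mem_erase hw), if_neg (Finset.ne_of_mem_erase hw)]
    · by_cases hwu : w = u
      · rw [hwu]
      · rw [h0 w fun h => hw (Finset.mem_erase.mpr ⟨hwu, h⟩), abs_zero]
        exact abs_nonneg _
  · rw [dirichletGreen_of_notMem fun h => hu h.1, abs_zero]
    exact abs_nonneg _

lemma form_dirichletGreen (hs : IsSign s) (hn : Nondeg s B) (hU : ∀ v ∈ U, v ∉ B) {u : ℤ × ℤ}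
    (hu : u ∈ U) : form s (dirichletGreen lattice s U u) (dirichletGreen lattice s U u) =
      dirichletGreen lattice s U u u := by
  obtain ⟨h0, h1⟩ := dirichletGreen_row hs hn hU hu
  rw [form_eq_finsum hs _ (finite_support_of_notMem h0), finsum_mul_delta h0 h1]

lemma dirichletGreen_self_nonneg (hs : IsSign s) (hn : Nondeg s B) (hU : ∀ v ∈ U, v ∉ B)
    (u : ℤ × ℤ) : 0 ≤ dirichletGreen lattice s U u u := by
  by_cases hu : u ∈ U
  · rw [← form_dirichletGreen hs hn hU hu]
    exact form_self_nonneg _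
  · rw [dirichletGreen_of_notMem fun h => hu h.1]

/-- The diagonal value `q` is both the value of the row at `u` and its energy. Thus `q ≤ C * √q`,
and `q ≤ C ^ 2` independently of `U`. -/
lemma dirichletGreen_self_bounded (hs : IsSign s) (hn : Nondeg s B) (u : ℤ × ℤ) :
    ∃ C, ∀ U : Finset (ℤ × ℤ), (∀ v ∈ U, v ∉ B) → dirichletGreen lattice s U u u ≤ C := by
  obtain ⟨C, hC, h⟩ := hn u
  refine ⟨C ^ 2, fun U hU => ?_⟩
  by_cases hu : u ∈ U
  · obtain ⟨h0, h1⟩ := dirichletGreen_row hs hn hU hu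
    have := h _ (finite_support_of_notMem h0) fun v hv => h0 v fun h => hU v h hv
    rw [form_dirichletGreen hs hn hU hu] at this
    have hp := dirichletGreen_self_nonneg hs hn hU u
    set q := dirichletGreen lattice s U u u
    rw [abs_of_nonneg hp] at this
    have hq := Real.mul_self_sqrt hp
    have h2 := Real.sqrt_nonneg q
    have : √q * √q ≤ C * √q := by rw [hq]; exact this
    rcases h2.eq_or_lt with h3 | h3
    · nlinarith [sq_nonneg C]
    · have := le_of_mul_le_mul_right this h3
      nlinarith
  · rw [dirichletGreen_of_notMem fun h => hu h.1]
    positivity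

lemma finite_support_sub {f g : ℤ × ℤ → ℝ} (hf : f.support.Finite) (hg : g.support.Finite) :
    (Function.support fun v => f v - g v).Finite :=
  (hf.union hg).subset (Function.support_sub f g)

lemma laplacian_sub (f g : ℤ × ℤ → ℝ) (v : ℤ × ℤ) :
    laplacian lattice s (fun w => f w - g w) v = laplacian lattice s f v -
      laplacian lattice s g v := by
  simp only [laplacian_lattice]; ring

/-- Pythagoras: the increment is harmonic on `U`, where the smaller row is supported, so the two are
orthogonal in energy. Pairing the increment with the larger row gives its value at `u`. -/
lemma form_sub_dirichletGreen (hs : IsSign s) (hn : Nondeg s B) {U U' : Finset (ℤ × ℤ)}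
    (hUU : U ⊆ U') (hU : ∀ v ∈ U', v ∉ B) {u : ℤ × ℤ} (hu : u ∈ U) :
    form s (fun v => dirichletGreen lattice s U' u v - dirichletGreen lattice s U u v)
      (fun v => dirichletGreen lattice s U' u v - dirichletGreen lattice s U u v) =
      dirichletGreen lattice s U' u u - dirichletGreen lattice s U u u := by
  obtain ⟨h0, h1⟩ := dirichletGreen_row hs hn (fun v hv => hU v (hUU hv)) hu
  obtain ⟨h0', h1'⟩ := dirichletGreen_row hs hn hU (hUU hu)
  set g := dirichletGreen lattice s U u
  set g' := dirichletGreen lattice s U' u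
  have f0 := finite_support_of_notMem h0
  have f0' := finite_support_of_notMem h0'
  have e1 : form s g (fun v => g' v - g v) = 0 := by
    rw [form_comm, form_eq_finsum hs _ f0, finsum_eq_zero_of_forall_eq_zero]
    intro v
    by_cases hv : v ∈ U
    · rw [laplacian_sub, h1 v hv, h1' v (hUU hv), sub_self, mul_zero]
    · rw [h0 v hv, zero_mul]
  have e2 : form s g' (fun v => g' v - g v) = g' u - g u := by
    rw [form_eq_finsum hs _ (finite_support_sub f0' f0)]
    refine finsum_mul_delta (U := U') (f := fun v => g' v - g v) (fun v hv => ?_) h1'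
    rw [h0' v hv, h0 v fun h => hv (hUU h), sub_zero]
  rw [← e2, ← sub_zero (form s g' _), ← e1]
  unfold form
  rw [← finsum_sub_distrib]
  · refine finsum_congr fun v => ?_
    simp only [grad]; ring
  · exact finite_support_form f0' _
  · exact finite_support_form f0 _

end Finite

/-! ### Existence of the Green function -/

section Limit

variable {B : Set (ℤ × ℤ)}

lemma dirichletGreen_mono (hs : IsSign s) (hn : Nondeg s B) {U U' : Finset (ℤ × ℤ)}
    (hUU : U ⊆ U') (hU : ∀ v ∈ U', v ∉ B) (u : ℤ × ℤ) :
    dirichletGreen lattice s U u u ≤ dirichletGreen lattice s U' u u := by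
  by_cases hu : u ∈ U
  · rw [← sub_nonneg, ← form_sub_dirichletGreen hs hn hUU hU hu]
    exact form_self_nonneg _
  · rw [dirichletGreen_of_notMem fun h => hu h.1]
    exact dirichletGreen_self_nonneg hs hn hU u

/-- The diagonal values at `u` are monotone and bounded, hence Cauchy. Their increments are the
energies of the increments of the whole row, and these control the value at `v` by `Nondeg`. -/
theorem greenConverges (hs : IsSign s) (hn : Nondeg s B) (u v : ℤ × ℤ) :
    GreenConverges lattice s B u v := by
  have hB : ∀ U : Finset (ℤ × ℤ), ∀ v ∈ U.filter (· ∉ B), v ∉ B := fun U v hv =>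
    (Finset.mem_filter.mp hv).2
  have hsub : ∀ {U U' : Finset (ℤ × ℤ)}, U ⊆ U' → U.filter (· ∉ B) ⊆ U'.filter (· ∉ B) :=
    fun h => Finset.filter_subset_filter _ h
  unfold GreenConverges greenFunction
  refine tendsto_nhds_limUnder (cauchySeq_tendsto_of_complete ?_)
  by_cases hu : u ∈ B
  · have : (fun U : Finset (ℤ × ℤ) => dirichletGreen lattice s (U.filter (· ∉ B)) u v) =
        fun _ => 0 := funext fun U => dirichletGreen_of_notMem fun h => hB U u h.1 hu
    rw [this]
    exact cauchySeq_const 0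
  obtain ⟨C, hC⟩ := dirichletGreen_self_bounded hs hn u
  obtain ⟨D, hD0, hD⟩ := hn v
  set q : Finset (ℤ × ℤ) → ℝ := fun U => dirichletGreen lattice s (U.filter (· ∉ B)) u u with hq
  have hmono : Monotone q := fun U U' h => dirichletGreen_mono hs hn (hsub h) (hB U') u
  have hbdd : BddAbove (Set.range q) := ⟨C, by rintro _ ⟨U, rfl⟩; exact hC _ (hB U)⟩
  have hlim := tendsto_atTop_ciSup hmono hbdd
  set L := ⨆ U, q U
  rw [Metric.cauchySeq_iff']
  intro ε hε
  have hδ : 0 < (ε / (D + 1)) ^ 2 := by positivity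
  obtain ⟨U₀, hU₀, huU₀⟩ := ((hlim.eventually (lt_mem_nhds (sub_lt_self L hδ))).and
    (eventually_ge_atTop {u})).exists
  refine ⟨U₀, fun U hU => ?_⟩
  have hu₀ : u ∈ U₀.filter (· ∉ B) := by
    simp [hu, huU₀ (Finset.mem_singleton_self u)]
  have hE := form_sub_dirichletGreen hs hn (hsub hU) (hB U) hu₀
  have h0 := (dirichletGreen_row hs hn (hB U₀) hu₀).1
  have h0' := (dirichletGreen_row hs hn (hB U) (hsub hU hu₀)).1
  have := hD (fun v => dirichletGreen lattice s (U.filter (· ∉ B)) u v -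
    dirichletGreen lattice s (U₀.filter (· ∉ B)) u v)
    (finite_support_sub (finite_support_of_notMem h0') (finite_support_of_notMem h0))
    (fun w hw => by
      rw [h0 w fun h => hB _ _ h hw, h0' w fun h => hB _ _ h hw, sub_zero])
  rw [hE] at this
  have hqL : q U ≤ L := le_ciSup hbdd U
  have hlt : q U - q U₀ < (ε / (D + 1)) ^ 2 := by linarith
  rw [Real.dist_eq]
  calc _ ≤ D * √(q U - q U₀) := this
    _ ≤ D * (ε / (D + 1)) := by
      gcongr
      exact Real.sqrt_le_iff.mpr ⟨by positivity, hlt.le⟩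
    _ < (D + 1) * (ε / (D + 1)) := by
      apply mul_lt_mul_of_pos_right (by linarith) (by positivity)
    _ = ε := by field_simp

lemma greenFunction_comm (hs : IsSign s) (hn : Nondeg s B) (u v : ℤ × ℤ) :
    greenFunction lattice s B u v = greenFunction lattice s B v u := by
  refine tendsto_nhds_unique (greenConverges hs hn u v) ?_
  refine (greenConverges hs hn v u).congr fun U => ?_
  exact dirichletGreen_comm hs hn (fun v hv => (Finset.mem_filter.mp hv).2) v u

lemma tendsto_laplacian {ι : Type*} {l : Filter ι} {f : ι → ℤ × ℤ → ℝ} {g : ℤ × ℤ → ℝ}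
    (h : ∀ v, Tendsto (fun i => f i v) l (𝓝 (g v))) (v : ℤ × ℤ) :
    Tendsto (fun i => laplacian lattice s (f i) v) l (𝓝 (laplacian lattice s g v)) := by
  simp only [laplacian_lattice]
  exact ((((h _).sub ((h _).const_mul _)).add ((h _).sub ((h _).const_mul _))).add
    ((h _).sub ((h _).const_mul _))).add ((h _).sub ((h _).const_mul _))

/-- The Green function is a bounded inverse of the Laplacian. -/
theorem isInverseRow_greenFunction (hs : IsSign s) (hn : Nondeg s B) {u : ℤ × ℤ} (hu : u ∉ B) :
    IsInverseRow lattice s B u (greenFunction lattice s B u) := by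
  have hB : ∀ U : Finset (ℤ × ℤ), ∀ v ∈ U.filter (· ∉ B), v ∉ B := fun U v hv =>
    (Finset.mem_filter.mp hv).2
  refine ⟨fun v hv => ?_, fun v hv => ?_, ?_⟩
  · refine tendsto_nhds_unique (greenConverges hs hn u v) ?_
    refine tendsto_const_nhds.congr fun U => ?_
    exact (dirichletGreen_of_notMem fun h => hB U v h.2 hv).symm
  · refine tendsto_nhds_unique (tendsto_laplacian (greenConverges hs hn u) v) ?_
    refine tendsto_const_nhds.congr' ?_
    filter_upwards [eventually_ge_atTop {u, v}] with U hU
    have h1 : u ∈ U.filter (· ∉ B) := by simp [hu, hU (by simp : u ∈ ({u, v} : Finset (ℤ × ℤ)))]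
    have h2 : v ∈ U.filter (· ∉ B) := by simp [hv, hU (by simp : v ∈ ({u, v} : Finset (ℤ × ℤ)))]
    exact (((dirichletGreen_row hs hn (hB U) h1).2 v h2).trans (by congr)).symm
  · obtain ⟨C, hC⟩ := dirichletGreen_self_bounded hs hn u
    refine ⟨C, fun v => le_of_tendsto (greenConverges hs hn u v).abs (Eventually.of_forall
      fun U => ?_)⟩
    refine (abs_dirichletGreen_le hs hn (hB U) u v).trans ?_
    rw [abs_of_nonneg (dirichletGreen_self_nonneg hs hn (hB U) u)]
    exact hC _ (hB U)

lemma greenFunction_of_mem (hs : IsSign s) (hn : Nondeg s B) {u : ℤ × ℤ} (hu : u ∈ B)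
    (v : ℤ × ℤ) : greenFunction lattice s B u v = 0 := by
  refine tendsto_nhds_unique (greenConverges hs hn u v) ?_
  refine tendsto_const_nhds.congr fun U => ?_
  refine (dirichletGreen_of_notMem fun h => ?_).symm
  have := (Finset.mem_filter.mp h.1).2
  exact this hu

end Limit

/-! ### Uniqueness of the bounded inverse -/

section Cutoff

/-- The sup norm on the lattice. -/
noncomputable def supNorm (v : ℤ × ℤ) : ℕ := max v.1.natAbs v.2.natAbs

/-- Partial sums of the harmonic series. -/
noncomputable def harm (n : ℕ) : ℝ := ∑ i ∈ Finset.range n, 1 / ((i : ℝ) + 1)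

/-- Logarithmic cutoff functions. -/
noncomputable def cutoff (N : ℕ) (v : ℤ × ℤ) : ℝ := max 0 (1 - harm (supNorm v) / harm N)

lemma harm_succ (n : ℕ) : harm (n + 1) = harm n + 1 / ((n : ℝ) + 1) := Finset.sum_range_succ _ _

lemma harm_mono : Monotone harm := monotone_nat_of_le_succ fun n => by
  rw [harm_succ]
  have : 0 ≤ 1 / ((n : ℝ) + 1) := by positivity
  linarith

lemma harm_pos {n : ℕ} (hn : 1 ≤ n) : 0 < harm n :=
  lt_of_lt_of_le (by norm_num [harm]) (harm_mono hn)

/-- The factor 2 is needed for a step down, where the difference is `1 / m` instead of `1 / (m +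
1)`. -/
lemma abs_harm_sub_le {m n : ℕ} (h1 : n ≤ m + 1) (h2 : m ≤ n + 1) :
    |harm m - harm n| ≤ 2 / ((m : ℝ) + 1) := by
  rcases lt_trichotomy m n with h | h | h
  · obtain rfl : n = m + 1 := by omega
    rw [harm_succ, abs_le]
    have : 0 ≤ 1 / ((m : ℝ) + 1) := by positivity
    have : 2 / ((m : ℝ) + 1) = 2 * (1 / ((m : ℝ) + 1)) := by ring
    constructor <;> linarith
  · rw [h, sub_self, abs_zero]; positivity
  · obtain rfl : m = n + 1 := by omega
    rw [harm_succ, add_sub_cancel_left, abs_of_nonneg (by positivity)]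
    rw [div_le_div_iff₀ (by positivity) (by positivity)]
    push_cast
    have : (0 : ℝ) ≤ n := n.cast_nonneg
    linarith

/-- The box of radius `n`. -/
noncomputable def box (n : ℕ) : Finset (ℤ × ℤ) := Finset.Icc (-(n : ℤ)) n ×ˢ Finset.Icc (-(n : ℤ)) n

lemma mem_box {n : ℕ} {v : ℤ × ℤ} : v ∈ box n ↔ supNorm v ≤ n := by
  simp only [box, Finset.mem_product, Finset.mem_Icc, supNorm]
  omega

lemma card_box (n : ℕ) : (box n).card = (2 * n + 1) ^ 2 := by
  simp only [box, Finset.card_product, Int.card_Icc]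
  rw [show ((n : ℤ) + 1 - -n).toNat = 2 * n + 1 by omega, sq]

/-- The shell of sup norm `n + 1` has `8 * (n + 1)` points, each contributing at most `1 / (n + 1) ^
2`; so the sum grows no faster than the harmonic series. -/
lemma sum_box_le (n : ℕ) : ∑ v ∈ box n, 1 / ((supNorm v : ℝ) + 1) ^ 2 ≤ 1 + 8 * harm n := by
  induction n with
  | zero => simp [box, supNorm, harm]
  | succ n ih =>
    have hsub : box n ⊆ box (n + 1) := fun v hv => mem_box.mpr ((mem_box.mp hv).trans n.le_succ)
    rw [← Finset.sum_sdiff hsub, harm_succ]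
    have : ∑ v ∈ box (n + 1) \ box n, 1 / ((supNorm v : ℝ) + 1) ^ 2 ≤ 8 * (1 / ((n : ℝ) + 1)) := by
      have h1 : ∀ v ∈ box (n + 1) \ box n, 1 / ((supNorm v : ℝ) + 1) ^ 2 ≤
          1 / ((n : ℝ) + 1) ^ 2 := by
        intro v hv
        rw [Finset.mem_sdiff, mem_box, mem_box] at hv
        have : (n : ℝ) ≤ supNorm v := by exact_mod_cast (by omega : n ≤ supNorm v)
        gcongr
      refine (Finset.sum_le_card_nsmul _ _ _ h1).trans_eq ?_
      have h2 : (box (n + 1) \ box n).card = 8 * (n + 1) := by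
        rw [Finset.card_sdiff_of_subset hsub, card_box, card_box]
        have : (2 * (n + 1) + 1) ^ 2 = 8 * (n + 1) + (2 * n + 1) ^ 2 := by ring
        omega
      rw [h2, nsmul_eq_mul]
      push_cast
      field_simp
    linarith

lemma cutoff_eq_zero {N : ℕ} (hN : 1 ≤ N) {v : ℤ × ℤ} (hv : N ≤ supNorm v) : cutoff N v = 0 := by
  have := (one_le_div (harm_pos hN)).mpr (harm_mono hv)
  exact max_eq_left (by linarith)

lemma abs_grad_cutoff_le {N : ℕ} (hN : 1 ≤ N) (d v : ℤ × ℤ) (hd : supNorm d ≤ 1) :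
    |grad 1 (cutoff N) d v| ≤ 2 / (((supNorm v : ℝ) + 1) * harm N) := by
  have h := abs_harm_sub_le (m := supNorm v) (n := supNorm (v + d))
    (by simp only [supNorm, Prod.fst_add, Prod.snd_add] at *; omega)
    (by simp only [supNorm, Prod.fst_add, Prod.snd_add] at *; omega)
  have hp := harm_pos hN
  have e : grad 1 (cutoff N) d v = cutoff N v - cutoff N (v + d) := by simp [grad]
  rw [e]
  unfold cutoff
  refine (abs_max_sub_max_le_max _ _ _ _).trans ?_
  rw [sub_self, abs_zero, max_eq_right (abs_nonneg _), sub_sub_sub_cancel_left, ← sub_div, abs_div,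
    abs_of_pos hp, abs_sub_comm, ← div_div]
  gcongr

/-- The two squared differences at a vertex contribute at most `8 / harm N ^ 2` times the weight of
`sum_box_le`. The weights sum to the order of `harm N`, so the energy is of order `1 / harm N`. -/
lemma form_cutoff_le {N : ℕ} (hN : 1 ≤ N) :
    form 1 (cutoff N) (cutoff N) ≤ 8 * (1 + 8 * harm N) / harm N ^ 2 := by
  have hp := harm_pos hN
  have hout : ∀ v ∉ box N, cutoff N v = 0 := fun v hv =>
    cutoff_eq_zero hN (by rw [mem_box] at hv; omega)
  unfold form
  have hg : ∀ d v : ℤ × ℤ, supNorm d ≤ 1 → v ∉ box N → grad 1 (cutoff N) d v = 0 := by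
    intro d v hd hv
    rw [mem_box] at hv
    simp only [grad]
    rw [cutoff_eq_zero hN (v := v) (by omega), cutoff_eq_zero hN (v := v + d), mul_zero, sub_zero]
    simp only [supNorm, Prod.fst_add, Prod.snd_add] at *; omega
  have e1 : supNorm (1, 0) ≤ 1 := by simp [supNorm]
  have e2 : supNorm (0, 1) ≤ 1 := by simp [supNorm]
  rw [finsum_eq_sum_of_support_subset (s := box N)]
  · have : ∀ v ∈ box N, grad 1 (cutoff N) (1, 0) v * grad 1 (cutoff N) (1, 0) v +
        grad 1 (cutoff N) (0, 1) v * grad 1 (cutoff N) (0, 1) v ≤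
        8 / harm N ^ 2 * (1 / ((supNorm v : ℝ) + 1) ^ 2) := by
      intro v _
      have b1 := abs_grad_cutoff_le hN (1, 0) v e1
      have b2 := abs_grad_cutoff_le hN (0, 1) v e2
      have c1 := mul_self_le_mul_self (abs_nonneg _) b1
      have c2 := mul_self_le_mul_self (abs_nonneg _) b2
      rw [abs_mul_abs_self] at c1 c2
      have : 8 / harm N ^ 2 * (1 / ((supNorm v : ℝ) + 1) ^ 2) =
          2 * (2 / (((supNorm v : ℝ) + 1) * harm N) * (2 / (((supNorm v : ℝ) + 1) * harm N))) := by
        field_simp; norm_num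
      linarith
    refine (Finset.sum_le_sum this).trans ?_
    rw [← Finset.mul_sum, mul_comm 8 (1 + 8 * harm N), mul_div_assoc, mul_comm]
    gcongr
    exact sum_box_le N
  · intro v hv
    by_contra h
    refine hv ?_
    simp only [hg _ _ e1 h, hg _ _ e2 h, mul_zero, add_zero]

lemma tendsto_harm : Tendsto harm atTop atTop := Real.tendsto_sum_range_one_div_nat_succ_atTop

/-- The square lattice is recurrent. -/
theorem exists_cutoff (u : ℤ × ℤ) {ε : ℝ} (hε : 0 < ε) : ∃ η : ℤ × ℤ → ℝ, η.support.Finite ∧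
    1 / 2 ≤ η u ∧ form 1 η η ≤ ε := by
  -- For `harm N ≥ 1` the energy bound is at most `(8 + 64) / harm N`, whence 72. The condition
  -- involving `supNorm u` makes the cutoff at least 1/2 at `u`.
  have h := tendsto_harm.eventually_ge_atTop (max 1 (max (2 * harm (supNorm u)) (72 / ε)))
  obtain ⟨N, hN, hN1⟩ := (h.and (eventually_ge_atTop 1)).exists
  rw [max_le_iff, max_le_iff] at hN
  obtain ⟨h1, h2, h3⟩ := hN
  have hp := harm_pos hN1
  refine ⟨cutoff N, ?_, ?_, (form_cutoff_le hN1).trans ?_⟩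
  · refine (box N).finite_toSet.subset fun v hv => ?_
    by_contra h
    refine hv (cutoff_eq_zero hN1 ?_)
    rw [Finset.mem_coe, mem_box] at h
    omega
  · refine le_max_of_le_right ?_
    have : harm (supNorm u) / harm N ≤ 1 / 2 := by
      rw [div_le_div_iff₀ hp (by norm_num)]; linarith
    linarith
  · rw [div_le_iff₀ (by positivity)]
    rw [div_le_iff₀ hε] at h3
    nlinarith

end Cutoff

/-! ### Vanishing of bounded harmonic functions -/

section Uniqueness

variable {B : Set (ℤ × ℤ)}

/-- A Caccioppoli inequality. On each edge the squared difference of `η * g` equals the product of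
the differences of `g` and `η * η * g`, plus the squared difference of `η` times `s * g * g`. The
first term sums to zero because `g` is harmonic off `B` and vanishes on `B`. -/
lemma form_mul_le (hs : IsSign s) {g η : ℤ × ℤ → ℝ} {C : ℝ}
    (h0 : ∀ v ∈ B, g v = 0) (h1 : ∀ v ∉ B, laplacian lattice s g v = 0) (hC : ∀ v, |g v| ≤ C)
    (hη : η.support.Finite) :
    form s (fun v => η v * g v) (fun v => η v * g v) ≤ C ^ 2 * form 1 η η := by
  have hf := finite_support_mul_left hη g
  have hf2 : (Function.support fun v => η v * η v * g v).Finite :=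
    finite_support_mul_left (f := fun v => η v * η v) (finite_support_mul_left hη _) g
  have e0 : form s g (fun v => η v * η v * g v) = 0 := by
    rw [form_eq_finsum hs _ hf2, finsum_eq_zero_of_forall_eq_zero]
    intro v
    by_cases hv : v ∈ B
    · simp [h0 v hv]
    · simp [h1 v hv]
  have hprod : ∀ v w, |s v w * g v * g w| ≤ C ^ 2 := by
    intro v w
    rw [abs_mul, abs_mul, hs.abs, one_mul, sq]
    exact mul_le_mul (hC v) (hC w) (abs_nonneg _) ((abs_nonneg _).trans (hC v))
  have key : ∀ d v, grad s (fun v => η v * g v) d v * grad s (fun v => η v * g v) d v ≤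
      grad s g d v * grad s (fun v => η v * η v * g v) d v +
        C ^ 2 * (grad 1 η d v * grad 1 η d v) := by
    intro d v
    have : grad s (fun v => η v * g v) d v * grad s (fun v => η v * g v) d v =
        grad s g d v * grad s (fun v => η v * η v * g v) d v +
        s v (v + d) * g v * g (v + d) * (grad 1 η d v * grad 1 η d v) := by
      simp only [grad, Pi.one_apply]
      ring
    rw [this]
    gcongr
    · exact mul_self_nonneg _
    · exact (le_abs_self _).trans (hprod _ _)
  calc form s (fun v => η v * g v) (fun v => η v * g v)
      ≤ ∑ᶠ v, ((grad s g (1, 0) v * grad s (fun v => η v * η v * g v) (1, 0) v +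
        grad s g (0, 1) v * grad s (fun v => η v * η v * g v) (0, 1) v) +
        C ^ 2 * (grad 1 η (1, 0) v * grad 1 η (1, 0) v +
          grad 1 η (0, 1) v * grad 1 η (0, 1) v)) := by
        refine finsum_le_finsum' (finite_support_form hf _) ?_ fun v => ?_
        · refine finite_support_add ?_ (finite_support_mul_right (finite_support_form hη _) _)
          have := finite_support_form (s := s) hf2 g
          simpa only [Function.HasFiniteSupport, mul_comm] using this
        · linarith [key (1, 0) v, key (0, 1) v]
    _ = form s g (fun v => η v * η v * g v) + C ^ 2 * form 1 η η := by
        rw [finsum_add_distrib, ← smul_eq_mul (C ^ 2), form, form, smul_finsum]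
        · simp only [smul_eq_mul]
        · have := finite_support_form (s := s) hf2 g
          simpa only [Function.HasFiniteSupport, mul_comm] using this
        · exact finite_support_mul_right (finite_support_form hη _) _
    _ = C ^ 2 * form 1 η η := by rw [e0, zero_add]

/-- Bounded harmonic functions that vanish on the boundary are zero. -/
theorem eq_zero_of_harmonic (hs : IsSign s) (hn : Nondeg s B) {g : ℤ × ℤ → ℝ}
    (h0 : ∀ v ∈ B, g v = 0) (h1 : ∀ v ∉ B, laplacian lattice s g v = 0)
    (hC : ∃ C : ℝ, ∀ v, |g v| ≤ C) (u : ℤ × ℤ) : g u = 0 := by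
  obtain ⟨C, hC⟩ := hC
  obtain ⟨D, hD0, hD⟩ := hn u
  have hC0 : 0 ≤ C := (abs_nonneg _).trans (hC 0)
  by_contra hgu
  have hpos : 0 < |g u| := abs_pos.mpr hgu
  -- Chosen so that `D * C * (δ / 2) < |g u| / 2`: the cutoff keeps at least half of `g u`, while
  -- its energy allows less.
  set δ := |g u| / (2 * (D * C + 1)) with hδ
  have hδ0 : 0 < δ := by positivity
  obtain ⟨η, hη, hηu, hE⟩ := exists_cutoff u (ε := (δ / 2) ^ 2) (by positivity)
  have h2 := hD _ (finite_support_mul_left hη g) fun v hv => by simp [h0 v hv]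
  have h3 := form_mul_le hs h0 h1 hC hη
  have h4 : √(form s (fun v => η v * g v) (fun v => η v * g v)) ≤ C * (δ / 2) := by
    refine Real.sqrt_le_iff.mpr ⟨by positivity, h3.trans ?_⟩
    rw [mul_pow]; gcongr
  rw [abs_mul, abs_of_nonneg (by linarith : 0 ≤ η u)] at h2
  have h5 : 1 / 2 * |g u| ≤ D * (C * (δ / 2)) :=
    (mul_le_mul_of_nonneg_right hηu hpos.le).trans (h2.trans (by gcongr))
  have h6 : δ * (2 * (D * C + 1)) = |g u| := by rw [hδ]; field_simp
  have : 0 ≤ D * C := by positivity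
  nlinarith

/-- The Green function is the unique bounded inverse of the Laplacian. -/
theorem IsInverseRow.eq (hs : IsSign s) (hn : Nondeg s B) {u : ℤ × ℤ} {f g : ℤ × ℤ → ℝ}
    (hf : IsInverseRow lattice s B u f) (hg : IsInverseRow lattice s B u g) : f = g := by
  funext v
  obtain ⟨C, hC⟩ := hf.2.2
  obtain ⟨D, hD⟩ := hg.2.2
  have := eq_zero_of_harmonic hs hn (B := B) (g := fun v => f v - g v)
    (fun v hv => by rw [hf.1 v hv, hg.1 v hv, sub_zero])
    (fun v hv => by rw [laplacian_sub, hf.2.1 v hv, hg.2.1 v hv, sub_self])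
    ⟨C + D, fun v => (abs_sub _ _).trans (add_le_add (hC v) (hD v))⟩ v
  linarith

lemma IsInverseRow.eq_greenFunction (hs : IsSign s) (hn : Nondeg s B) {u : ℤ × ℤ} (hu : u ∉ B)
    {g : ℤ × ℤ → ℝ} (hg : IsInverseRow lattice s B u g) : g = greenFunction lattice s B u :=
  hg.eq hs hn (isInverseRow_greenFunction hs hn hu)

end Uniqueness

/-! ### Faces and holonomy -/

/-- The horizontal edge to the right of `v`. -/
def hEdge (v : ℤ × ℤ) : Sym2 (ℤ × ℤ) := s(v, v + (1, 0))

/-- The vertical edge above `v`. -/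
def vEdge (v : ℤ × ℤ) : Sym2 (ℤ × ℤ) := s(v, v + (0, 1))

lemma hEdge_inj {v w : ℤ × ℤ} : hEdge v = hEdge w ↔ v = w := by
  obtain ⟨a, b⟩ := v; obtain ⟨c, d⟩ := w
  simp only [hEdge, Sym2.eq_iff, Prod.mk_add_mk, Prod.mk.injEq]; omega

lemma vEdge_inj {v w : ℤ × ℤ} : vEdge v = vEdge w ↔ v = w := by
  obtain ⟨a, b⟩ := v; obtain ⟨c, d⟩ := w
  simp only [vEdge, Sym2.eq_iff, Prod.mk_add_mk, Prod.mk.injEq]; omega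

lemma hEdge_ne_vEdge (v w : ℤ × ℤ) : hEdge v ≠ vEdge w := by
  obtain ⟨a, b⟩ := v; obtain ⟨c, d⟩ := w
  simp only [hEdge, vEdge, ne_eq, Sym2.eq_iff, Prod.mk_add_mk, Prod.mk.injEq]; omega

lemma faceEdges_eq (f : ℤ × ℤ) :
    faceEdges f = {hEdge f, vEdge (f + (1, 0)), hEdge (f + (0, 1)), vEdge f} := by
  obtain ⟨a, b⟩ := f
  simp only [faceEdges, hEdge, vEdge, Prod.mk_add_mk, add_zero]
  rw [Sym2.eq_swap (a := (a, b + 1)) (b := (a, b)),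
    Sym2.eq_swap (a := (a + 1, b + 1)) (b := (a, b + 1))]

lemma hEdge_mem_faceEdges {v g : ℤ × ℤ} : hEdge v ∈ faceEdges g ↔ v = g ∨ v = g + (0, 1) := by
  simp [faceEdges_eq, hEdge_inj, hEdge_ne_vEdge]

lemma vEdge_mem_faceEdges {v g : ℤ × ℤ} : vEdge v ∈ faceEdges g ↔ v = g + (1, 0) ∨ v = g := by
  simp [faceEdges_eq, vEdge_inj, (hEdge_ne_vEdge _ _).symm]

lemma exists_edge_of_mem_faceEdges {e : Sym2 (ℤ × ℤ)} {g : ℤ × ℤ} (h : e ∈ faceEdges g) :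
    (∃ v, e = hEdge v) ∨ ∃ v, e = vEdge v := by
  rw [faceEdges_eq] at h
  rcases h with h | h | h | h
  exacts [Or.inl ⟨_, h⟩, Or.inr ⟨_, h⟩, Or.inl ⟨_, h⟩, Or.inr ⟨_, h⟩]

/-- An edge lies in two faces only. -/
lemma eq_or_eq_of_mem_faceEdges {e : Sym2 (ℤ × ℤ)} {f f' g : ℤ × ℤ} (hf : e ∈ faceEdges f)
    (hf' : e ∈ faceEdges f') (hne : f ≠ f') : e ∈ faceEdges g ↔ g = f ∨ g = f' := by
  constructor
  · intro hg
    obtain ⟨a, b⟩ := f; obtain ⟨c, d⟩ := f'; obtain ⟨x, y⟩ := g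
    rcases exists_edge_of_mem_faceEdges hf with ⟨⟨i, j⟩, rfl⟩ | ⟨⟨i, j⟩, rfl⟩
    · simp only [hEdge_mem_faceEdges, Prod.mk_add_mk, Prod.mk.injEq, ne_eq] at *; omega
    · simp only [vEdge_mem_faceEdges, Prod.mk_add_mk, Prod.mk.injEq, ne_eq] at *; omega
  · rintro (rfl | rfl) <;> assumption

lemma adj_right (v : ℤ × ℤ) : lattice.Adj v (v + (1, 0)) := by
  change |v.1 - (v + (1, 0)).1| + |v.2 - (v + (1, 0)).2| = 1
  simp

lemma adj_up (v : ℤ × ℤ) : lattice.Adj v (v + (0, 1)) := by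
  change |v.1 - (v + (0, 1)).1| + |v.2 - (v + (0, 1)).2| = 1
  simp

lemma faceEdges_subset (f : ℤ × ℤ) : faceEdges f ⊆ lattice.edgeSet := fun e he => by
  rcases exists_edge_of_mem_faceEdges he with ⟨v, rfl⟩ | ⟨v, rfl⟩
  · exact adj_right v
  · exact adj_up v

/-- An edge of the lattice points right or up from one of its ends. -/
lemma adj_cases {P : ℤ × ℤ → ℤ × ℤ → Prop} (hsymm : ∀ u v, P u v → P v u)
    (hr : ∀ v, P v (v + (1, 0))) (hu : ∀ v, P v (v + (0, 1))) {u v : ℤ × ℤ}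
    (h : lattice.Adj u v) : P u v := by
  have : v ∈ lattice.neighborSet u := h
  rw [neighborSet_lattice] at this
  rcases this with rfl | rfl | rfl | rfl
  · exact hr u
  · have := hr (u + (-1, 0))
    rw [add_assoc, show ((-1 : ℤ), (0 : ℤ)) + (1, 0) = 0 from rfl, add_zero] at this
    exact hsymm _ _ this
  · exact hu u
  · have := hu (u + (0, -1))
    rw [add_assoc, show ((0 : ℤ), (-1 : ℤ)) + (0, 1) = 0 from rfl, add_zero] at this
    exact hsymm _ _ this

/-- The sign of an edge. -/
noncomputable def edgeSign (Z : Set (Sym2 (ℤ × ℤ))) (e : Sym2 (ℤ × ℤ)) : ℤˣ :=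
  if e ∈ Z then -1 else 1

lemma zipperSign_eq (Z : Set (Sym2 (ℤ × ℤ))) (u v : ℤ × ℤ) :
    zipperSign Z u v = ((edgeSign Z s(u, v) : ℤ) : ℝ) := by
  unfold zipperSign edgeSign; split_ifs <;> simp

lemma edgeSign_eq_iff {Z Z' : Set (Sym2 (ℤ × ℤ))} {e e' : Sym2 (ℤ × ℤ)} :
    edgeSign Z e = edgeSign Z' e' ↔ (e ∈ Z ↔ e' ∈ Z') := by
  unfold edgeSign
  by_cases h : e ∈ Z <;> by_cases h' : e' ∈ Z' <;> simp [h, h']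

/-- The product of a function along a quadrilateral. -/
def cycleProd (σ : Sym2 (ℤ × ℤ) → ℤˣ) (a b c d : ℤ × ℤ) : ℤˣ :=
  σ s(a, b) * σ s(b, c) * σ s(c, d) * σ s(d, a)

/-- The holonomy around a face. -/
def holonomy (σ : Sym2 (ℤ × ℤ) → ℤˣ) (g : ℤ × ℤ) : ℤˣ :=
  cycleProd σ g (g + (1, 0)) (g + (1, 1)) (g + (0, 1))

lemma holonomy_eq (σ : Sym2 (ℤ × ℤ) → ℤˣ) (g : ℤ × ℤ) : holonomy σ g =
    σ (hEdge g) * σ (vEdge (g + (1, 0))) * σ (hEdge (g + (0, 1))) * σ (vEdge g) := by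
  obtain ⟨a, b⟩ := g
  simp only [holonomy, cycleProd, hEdge, vEdge, Prod.mk_add_mk, add_zero]
  rw [Sym2.eq_swap (a := (a, b + 1)) (b := (a, b)),
    Sym2.eq_swap (a := (a + 1, b + 1)) (b := (a, b + 1))]

lemma neg_one_pow_ncard_insert {Z S : Set (Sym2 (ℤ × ℤ))} {e : Sym2 (ℤ × ℤ)} (he : e ∉ S)
    (hS : S.Finite) : (-1 : ℤˣ) ^ (insert e S ∩ Z).ncard =
      edgeSign Z e * (-1) ^ (S ∩ Z).ncard := by
  unfold edgeSign
  split_ifs with h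
  · rw [Set.insert_inter_of_mem h, Set.ncard_insert_of_notMem (fun h => he h.1)
      (hS.inter_of_left Z), pow_succ']
  · rw [Set.insert_inter_of_notMem h, one_mul]

lemma odd_ncard_iff (Z : Set (Sym2 (ℤ × ℤ))) (g : ℤ × ℤ) :
    Odd (faceEdges g ∩ Z).ncard ↔ holonomy (edgeSign Z) g = -1 := by
  have : (-1 : ℤˣ) ^ (faceEdges g ∩ Z).ncard = holonomy (edgeSign Z) g := by
    have h0 : (-1 : ℤˣ) ^ ((∅ : Set (Sym2 (ℤ × ℤ))) ∩ Z).ncard = 1 := by simp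
    rw [faceEdges_eq, holonomy_eq, neg_one_pow_ncard_insert _ (Set.toFinite _),
      neg_one_pow_ncard_insert _ (Set.toFinite _), neg_one_pow_ncard_insert _ (Set.toFinite _),
      ← insert_empty_eq, neg_one_pow_ncard_insert _ (Set.toFinite _), h0, mul_one, mul_assoc,
      mul_assoc]
    all_goals simp [hEdge_inj, vEdge_inj, hEdge_ne_vEdge, (hEdge_ne_vEdge _ _).symm]
  rw [← this]
  constructor
  · intro h; exact h.neg_one_pow
  · intro h
    by_contra h'
    rw [Nat.not_odd_iff_even] at h'
    rw [h'.neg_one_pow] at h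
    exact absurd h (by decide)

lemma isZipper_iff {f : ℤ × ℤ} {Z : Set (Sym2 (ℤ × ℤ))} : IsZipper f Z ↔
    Z ⊆ lattice.edgeSet ∧ ∀ g, holonomy (edgeSign Z) g = -1 ↔ g = f := by
  simp only [IsZipper, odd_ncard_iff]

lemma cycleProd_rotate (σ : Sym2 (ℤ × ℤ) → ℤˣ) (a b c d : ℤ × ℤ) :
    cycleProd σ a b c d = cycleProd σ b c d a := by
  simp only [cycleProd]
  ac_rfl

lemma cycleProd_reverse (σ : Sym2 (ℤ × ℤ) → ℤˣ) (a b c d : ℤ × ℤ) :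
    cycleProd σ a b c d = cycleProd σ a d c b := by
  simp only [cycleProd]
  rw [Sym2.eq_swap (a := a) (b := d), Sym2.eq_swap (a := d) (b := c),
    Sym2.eq_swap (a := c) (b := b), Sym2.eq_swap (a := b) (b := a)]
  ac_rfl

lemma mem_faceCorners {f v : ℤ × ℤ} : v ∈ faceCorners f ↔
    (v.1 = f.1 ∨ v.1 = f.1 + 1) ∧ (v.2 = f.2 ∨ v.2 = f.2 + 1) := by
  obtain ⟨a, b⟩ := f; obtain ⟨c, d⟩ := v
  simp only [faceCorners, Set.mem_insert_iff, Set.mem_singleton_iff, Prod.mk_add_mk,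
    Prod.mk.injEq]
  omega

lemma faceCorners_injective : Function.Injective faceCorners := by
  intro f g h
  have h1 : f ∈ faceCorners g := h ▸ mem_faceCorners.mpr (by simp)
  have h2 : g ∈ faceCorners f := h ▸ mem_faceCorners.mpr (by simp)
  rw [mem_faceCorners] at h1 h2
  ext <;> omega

/-- Quadrilaterals in the lattice are faces. -/
lemma exists_face_of_cycle {a b c d : ℤ × ℤ} (hab : lattice.Adj a b) (hbc : lattice.Adj b c)
    (hcd : lattice.Adj c d) (hda : lattice.Adj d a) (hac : a ≠ c) (hbd : b ≠ d) :
    ∃ g, ({a, b, c, d} : Set (ℤ × ℤ)) = faceCorners g ∧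
      ∀ σ, cycleProd σ a b c d = holonomy σ g := by
  have h1 : b ∈ lattice.neighborSet a := hab
  have h2 : d ∈ lattice.neighborSet a := hda.symm
  have h3 : c ∈ lattice.neighborSet b := hbc
  have h4 : c ∈ lattice.neighborSet d := hcd.symm
  rw [neighborSet_lattice] at h1 h2 h3 h4
  obtain ⟨i, j⟩ := a
  obtain ⟨k, l⟩ := c
  simp only [Set.mem_insert_iff, Set.mem_singleton_iff, Prod.mk_add_mk, add_zero] at h1 h2
  suffices h : ∃ g, (∀ x, x ∈ ({(i, j), b, (k, l), d} : Set (ℤ × ℤ)) ↔ x ∈ faceCorners g) ∧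
      ∀ σ, cycleProd σ (i, j) b (k, l) d = holonomy σ g by
    obtain ⟨g, h, h'⟩ := h
    exact ⟨g, Set.ext h, h'⟩
  simp only [mem_faceCorners, holonomy]
  -- Of the sixteen pairs of directions out of `a`, the eight perpendicular ones survive. Equal
  -- directions contradict `b ≠ d` and opposite ones force `c = a`. Rotation and reversal bring each
  -- survivor to the orientation used in `holonomy`.
  rcases h1 with rfl | rfl | rfl | rfl <;> rcases h2 with rfl | rfl | rfl | rfl <;>
    simp only [Set.mem_insert_iff, Set.mem_singleton_iff, Prod.mk_add_mk, Prod.mk.injEq, ne_eq,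
      Prod.forall, not_true_eq_false] at hac hbd h3 h4 ⊢ <;> try omega
  · obtain ⟨rfl, rfl⟩ : k = i + 1 ∧ l = j + 1 := by omega
    refine ⟨(i, j), by intros; dsimp only; omega, fun σ => ?_⟩
    simp
  · obtain ⟨rfl, rfl⟩ : k = i + 1 ∧ l = j - 1 := by omega
    refine ⟨(i, j - 1), by intros; dsimp only; omega, fun σ => ?_⟩
    rw [cycleProd_reverse, cycleProd_rotate]
    simp [sub_eq_add_neg]
  · obtain ⟨rfl, rfl⟩ : k = i - 1 ∧ l = j + 1 := by omega
    refine ⟨(i - 1, j), by intros; dsimp only; omega, fun σ => ?_⟩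
    rw [cycleProd_reverse, cycleProd_rotate, cycleProd_rotate, cycleProd_rotate]
    simp [sub_eq_add_neg]
  · obtain ⟨rfl, rfl⟩ : k = i - 1 ∧ l = j - 1 := by omega
    refine ⟨(i - 1, j - 1), by intros; dsimp only; omega, fun σ => ?_⟩
    rw [cycleProd_rotate, cycleProd_rotate]
    simp [sub_eq_add_neg]
  · obtain ⟨rfl, rfl⟩ : k = i + 1 ∧ l = j + 1 := by omega
    refine ⟨(i, j), by intros; dsimp only; omega, fun σ => ?_⟩
    rw [cycleProd_reverse]
    simp
  · obtain ⟨rfl, rfl⟩ : k = i - 1 ∧ l = j + 1 := by omega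
    refine ⟨(i - 1, j), by intros; dsimp only; omega, fun σ => ?_⟩
    rw [cycleProd_rotate, cycleProd_rotate, cycleProd_rotate]
    simp [sub_eq_add_neg]
  · obtain ⟨rfl, rfl⟩ : k = i + 1 ∧ l = j - 1 := by omega
    refine ⟨(i, j - 1), by intros; dsimp only; omega, fun σ => ?_⟩
    rw [cycleProd_rotate]
    simp [sub_eq_add_neg]
  · obtain ⟨rfl, rfl⟩ : k = i - 1 ∧ l = j - 1 := by omega
    refine ⟨(i - 1, j - 1), by intros; dsimp only; omega, fun σ => ?_⟩
    rw [cycleProd_rotate, cycleProd_rotate, cycleProd_reverse]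
    simp [sub_eq_add_neg]

/-! ### Gauge transformations -/

/-- One of the two products is always empty. Since units of ℤ are their own inverses, the product
also serves on the negative side. -/
lemma exists_int_gauge (h : ℤ → ℤˣ) (c : ℤˣ) : ∃ ε : ℤ → ℤˣ, ε 0 = c ∧
    ∀ i, ε (i + 1) = ε i * h i := by
  refine ⟨fun i => c * ((∏ k ∈ Finset.Ico 0 i, h k) * ∏ k ∈ Finset.Ico i 0, h k), by simp,
    fun i => ?_⟩
  dsimp only
  rcases le_or_gt 0 i with hi | hi
  · have e1 : Finset.Ico 0 (i + 1) = insert i (Finset.Ico 0 i) := by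
      ext k; simp only [Finset.mem_Ico, Finset.mem_insert]; omega
    rw [e1, Finset.prod_insert (by simp), Finset.Ico_eq_empty_of_le (by omega : 0 ≤ i + 1),
      Finset.Ico_eq_empty_of_le hi]
    simp [mul_comm, mul_left_comm]
  · have e1 : Finset.Ico i 0 = insert i (Finset.Ico (i + 1) 0) := by
      ext k; simp only [Finset.mem_Ico, Finset.mem_insert]; omega
    have e2 : Finset.Ico 0 (i + 1) = ∅ := Finset.Ico_eq_empty_of_le (by omega)
    rw [e1, e2, Finset.prod_insert (by simp), Finset.Ico_eq_empty_of_le hi.le]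
    have := Int.units_mul_self (h i)
    simp only [Finset.prod_empty, one_mul]
    rw [mul_comm (h i), ← mul_assoc c, mul_assoc (c * _), this, mul_one]

/-- A flat connection on the lattice is trivial. -/
lemma exists_gauge (σ : Sym2 (ℤ × ℤ) → ℤˣ) (hflat : ∀ g, holonomy σ g = 1) :
    ∃ ε : ℤ × ℤ → ℤˣ, ∀ u v, lattice.Adj u v → ε u * ε v = σ s(u, v) := by
  -- The connection is integrated up the column 0 and then along every row. The relation for
  -- vertical edges holds in the column 0 by construction, and flatness of the faces carries it to
  -- the other columns.
  obtain ⟨β, _, hβ⟩ := exists_int_gauge (fun j => σ (vEdge (0, j))) 1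
  choose ε hε0 hε using fun j => exists_int_gauge (fun i => σ (hEdge (i, j))) (β j)
  have key : ∀ i j, ε (j + 1) i * ε j i = σ (vEdge (i, j)) := by
    intro i j
    have step : ∀ i, ε (j + 1) i * ε j i = σ (vEdge (i, j)) ↔
        ε (j + 1) (i + 1) * ε j (i + 1) = σ (vEdge (i + 1, j)) := by
      intro i
      have hf := hflat (i, j)
      rw [holonomy_eq] at hf
      simp only [Prod.mk_add_mk, add_zero] at hf
      rw [hε, hε]
      generalize σ (vEdge (i, j)) = a at *
      generalize σ (vEdge (i + 1, j)) = b at *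
      generalize σ (hEdge (i, j)) = c at *
      generalize σ (hEdge (i, j + 1)) = d at *
      generalize ε (j + 1) i = x at *
      generalize ε j i = y at *
      revert a b c d x y
      decide
    rw [int_iff_of_step (P := fun i => ε (j + 1) i * ε j i = σ (vEdge (i, j))) step i 0, hε0, hε0,
      hβ, mul_right_comm, Int.units_mul_self, one_mul]
  refine ⟨fun v => ε v.2 v.1, fun u v h => ?_⟩
  refine adj_cases (P := fun u v => ε u.2 u.1 * ε v.2 v.1 = σ s(u, v)) ?_ ?_ ?_ h
  · intro u v h
    rw [mul_comm, h, Sym2.eq_swap]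
  · rintro ⟨i, j⟩
    change ε j i * ε (j + 0) (i + 1) = σ (hEdge (i, j))
    rw [add_zero, hε, ← mul_assoc, Int.units_mul_self, one_mul]
  · rintro ⟨i, j⟩
    change ε j i * ε (j + 1) (i + 0) = σ (vEdge (i, j))
    rw [add_zero, mul_comm, key]

/-- Automorphisms of the lattice that match the endpoints of two zippers match the zippers up to
a gauge transformation. -/
theorem exists_gauge_of_zipper {f f' : ℤ × ℤ} {Z Z' : Set (Sym2 (ℤ × ℤ))}
    {φ : lattice ≃g lattice} (hZ : IsZipper f Z) (hZ' : IsZipper f' Z')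
    (hφ : φ '' faceCorners f = faceCorners f') : ∃ ε : ℤ × ℤ → ℤˣ, ∀ u v, lattice.Adj u v →
      ε u * ε v = edgeSign Z s(u, v) * edgeSign Z' s(φ u, φ v) := by
  rw [isZipper_iff] at hZ hZ'
  -- The product of one connection with the pullback of the other is flat: an automorphism maps
  -- faces to faces, and by `hφ` it matches the only faces of holonomy -1.
  have hflat : ∀ g, holonomy (fun e => edgeSign Z e * edgeSign Z' (Sym2.map φ e)) g = 1 := by
    intro g
    have e : holonomy (fun e => edgeSign Z e * edgeSign Z' (Sym2.map φ e)) g =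
        holonomy (edgeSign Z) g * cycleProd (edgeSign Z') (φ g) (φ (g + (1, 0))) (φ (g + (1, 1)))
          (φ (g + (0, 1))) := by
      simp only [holonomy, cycleProd, Sym2.map_mk]
      ac_rfl
    have hinj := φ.injective
    have adj1 : lattice.Adj g (g + (1, 0)) := adj_right g
    have adj2 : lattice.Adj (g + (1, 0)) (g + (1, 1)) := by
      have := adj_up (g + (1, 0))
      rwa [add_assoc] at this
    have adj3 : lattice.Adj (g + (0, 1)) (g + (1, 1)) := by
      have := adj_right (g + (0, 1))
      rwa [add_assoc] at this
    have adj4 : lattice.Adj g (g + (0, 1)) := adj_up g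
    obtain ⟨g', h1, h2⟩ := exists_face_of_cycle (φ.map_adj_iff.mpr adj1) (φ.map_adj_iff.mpr adj2)
      (φ.map_adj_iff.mpr adj3.symm) (φ.map_adj_iff.mpr adj4.symm)
      (hinj.ne (by simp [Prod.ext_iff])) (hinj.ne (by simp [Prod.ext_iff]))
    rw [e, h2]
    have h3 : φ '' faceCorners g = faceCorners g' := by
      rw [← h1, faceCorners]; simp [Set.image_insert_eq]
    have h4 : g' = f' ↔ g = f := by
      rw [← faceCorners_injective.eq_iff, ← h3, ← hφ, (Set.image_injective.mpr hinj).eq_iff,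
        faceCorners_injective.eq_iff]
    have h5 := (hZ.2 g).trans (h4.symm.trans (hZ'.2 g').symm)
    rcases Int.units_eq_one_or (holonomy (edgeSign Z) g) with h | h <;>
      rcases Int.units_eq_one_or (holonomy (edgeSign Z') g') with h' | h' <;>
      rw [h, h'] at h5 ⊢ <;> first | rfl | exact absurd h5 (by decide)
  obtain ⟨ε, hε⟩ := exists_gauge _ hflat
  exact ⟨ε, fun u v h => hε u v h⟩

lemma laplacian_map {s s' : ℤ × ℤ → ℤ × ℤ → ℝ} (φ : lattice ≃g lattice) (ε : ℤ × ℤ → ℝ)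
    {v : ℤ × ℤ} (hε : ∀ w, ε w * ε w = 1)
    (hs : ∀ w, lattice.Adj v w → s' (φ v) (φ w) = ε v * ε w * s v w) (g : ℤ × ℤ → ℝ) :
    laplacian lattice s' (fun w => ε (φ.symm w) * g (φ.symm w)) (φ v) =
      ε v * laplacian lattice s g v := by
  have hbij : Set.BijOn φ (lattice.neighborSet v) (lattice.neighborSet (φ v)) := by
    refine ⟨fun w hw => φ.map_adj_iff.mpr hw, φ.injective.injOn, fun w hw => ?_⟩
    refine ⟨φ.symm w, ?_, φ.apply_symm_apply w⟩
    rw [SimpleGraph.mem_neighborSet, ← φ.map_adj_iff]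
    simpa using hw
  unfold laplacian
  rw [← smul_eq_mul, smul_finsum_mem (neighborSet_lattice_finite v)]
  refine (finsum_mem_eq_of_bijOn φ hbij fun w hw => ?_).symm
  simp only [RelIso.symm_apply_apply, smul_eq_mul]
  rw [hs w hw]
  linear_combination (ε v * s v w * g w) * hε w

/-- Gauge transformations and lattice symmetries act on Green functions. -/
theorem greenFunction_map {s s' : ℤ × ℤ → ℤ × ℤ → ℝ} {B B' : Set (ℤ × ℤ)} (hs : IsSign s)
    (hs' : IsSign s') (hn : Nondeg s B) (hn' : Nondeg s' B') (φ : lattice ≃g lattice)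
    (ε : ℤ × ℤ → ℝ) (hε : ∀ w, ε w * ε w = 1) (hB : ∀ v, φ v ∈ B' ↔ v ∈ B)
    (h : ∀ v w, lattice.Adj v w → s' (φ v) (φ w) = ε v * ε w * s v w) (u v : ℤ × ℤ) :
    greenFunction lattice s' B' (φ u) (φ v) = ε u * ε v * greenFunction lattice s B u v := by
  by_cases hu : u ∈ B
  · rw [greenFunction_of_mem hs hn hu, greenFunction_of_mem hs' hn' ((hB u).mpr hu), mul_zero]
  obtain ⟨h0, h1, C, hC⟩ := isInverseRow_greenFunction hs hn hu
  have hr : IsInverseRow lattice s' B' (φ u) (fun w => ε u * (ε (φ.symm w) *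
      greenFunction lattice s B u (φ.symm w))) := by
    refine ⟨fun w hw => ?_, fun w hw => ?_, C, fun w => ?_⟩
    · obtain ⟨w, rfl⟩ := φ.surjective w
      simp [h0 w ((hB w).mp hw)]
    · obtain ⟨w, rfl⟩ := φ.surjective w
      rw [laplacian_const_mul (neighborSet_lattice_finite _),
        laplacian_map φ ε hε (h w), h1 w fun h => hw ((hB w).mpr h)]
      by_cases hw : w = u
      · rw [if_pos hw, if_pos (by rw [hw]), hw, mul_one, hε]
      · rw [if_neg hw, if_neg fun h => hw (φ.injective h), mul_zero, mul_zero]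
    · have habs : ∀ w, |ε w| = 1 := fun w => by
        rcases mul_self_eq_one_iff.mp (hε w) with h | h <;> simp [h]
      rw [abs_mul, abs_mul, habs, habs, one_mul, one_mul]
      exact hC _
  have := hr.eq_greenFunction hs' hn' fun h => hu ((hB u).mp h)
  rw [← this]
  simp [mul_assoc]

/-! ### The Green function of a zipper -/

/-- Transport around the end face is -1, so the value at a corner differs from its negative by four
edge differences: twice its modulus is at most four times the root of the energy. Hence the constant
2. No boundary is needed. -/
lemma nondeg_zipper {f : ℤ × ℤ} {Z : Set (Sym2 (ℤ × ℤ))} (hZ : IsZipper f Z) (B : Set (ℤ × ℤ)) :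
    Nondeg (zipperSign Z) B := by
  have hs := isSign_zipperSign Z
  refine nondeg_of_evalBounded hs (u := f) ⟨2, by norm_num, fun g hg _ => ?_⟩
  have hol := ((isZipper_iff.mp hZ).2 f).mpr rfl
  have a1 := abs_le.mp (abs_grad_right_le (s := zipperSign Z) hg f)
  have a2 := abs_le.mp (abs_grad_up_le (s := zipperSign Z) hg (f + (1, 0)))
  have a3 := abs_le.mp (abs_grad_right_le (s := zipperSign Z) hg (f + (0, 1)))
  have a4 := abs_le.mp (abs_grad_up_le (s := zipperSign Z) hg f)
  rw [holonomy_eq] at hol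
  unfold hEdge vEdge at hol
  simp only [grad, zipperSign_eq] at a1 a2 a3 a4
  rw [add_assoc f] at a2 a3 hol
  rw [add_assoc f] at hol
  simp only [Prod.mk_add_mk, add_zero, zero_add] at a2 a3 hol
  set E := √(form (zipperSign Z) g g)
  rw [abs_le]
  revert hol a1 a2 a3 a4
  generalize edgeSign Z s(f, f + (1, 0)) = s1
  generalize edgeSign Z s(f + (1, 0), f + (1, 1)) = s2
  generalize edgeSign Z s(f + (0, 1), f + (1, 1)) = s3
  generalize edgeSign Z s(f, f + (0, 1)) = s4
  intro hol a1 a2 a3 a4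
  rcases Int.units_eq_one_or s1 with rfl | rfl <;> rcases Int.units_eq_one_or s2 with rfl | rfl <;>
    rcases Int.units_eq_one_or s3 with rfl | rfl <;>
    rcases Int.units_eq_one_or s4 with rfl | rfl <;>
    first
    | exact absurd hol (by decide)
    | (simp only [Units.val_one, Int.cast_one, one_mul, Units.val_neg, Int.cast_neg, neg_mul]
        at a1 a2 a3 a4
       constructor <;> linarith [a1.1, a1.2, a2.1, a2.2, a3.1, a3.2, a4.1, a4.2])

theorem greenZipper_map {f f' : ℤ × ℤ} {Z Z' : Set (Sym2 (ℤ × ℤ))} (hZ : IsZipper f Z)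
    (hZ' : IsZipper f' Z') (φ : lattice ≃g lattice) (ε : ℤ × ℤ → ℤˣ)
    (h : ∀ v w, lattice.Adj v w → ε v * ε w = edgeSign Z s(v, w) * edgeSign Z' s(φ v, φ w))
    (u v : ℤ × ℤ) :
    greenZipper Z' (φ u) (φ v) = ((ε u * ε v : ℤˣ) : ℤ) * greenZipper Z u v := by
  have := greenFunction_map (isSign_zipperSign Z) (isSign_zipperSign Z') (nondeg_zipper hZ ∅)
    (nondeg_zipper hZ' ∅) φ (fun w => ((ε w : ℤ) : ℝ)) (fun w => ?_) (by simp) (fun v w hvw => ?_)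
    u v
  · rw [greenZipper, greenZipper, this]; push_cast; rfl
  · rcases Int.units_eq_one_or (ε w) with h | h <;> simp [h]
  · have h' : ε v * ε w * edgeSign Z s(v, w) = edgeSign Z' s(φ v, φ w) := by
      rw [h v w hvw, mul_right_comm, Int.units_mul_self, one_mul]
    rw [zipperSign_eq, zipperSign_eq, ← h']
    push_cast; rfl

lemma greenZipper_comm {f : ℤ × ℤ} {Z : Set (Sym2 (ℤ × ℤ))} (hZ : IsZipper f Z) (u v : ℤ × ℤ) :
    greenZipper Z u v = greenZipper Z v u :=
  greenFunction_comm (isSign_zipperSign Z) (nondeg_zipper hZ ∅) u v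

lemma isInverseRow_greenZipper {f : ℤ × ℤ} {Z : Set (Sym2 (ℤ × ℤ))} (hZ : IsZipper f Z)
    (u : ℤ × ℤ) : IsInverseRow lattice (zipperSign Z) ∅ u (greenZipper Z u) :=
  isInverseRow_greenFunction (isSign_zipperSign Z) (nondeg_zipper hZ ∅) (by simp)

/-- Deforming or moving a zipper. -/
theorem exists_sign_greenZipper {f f' : ℤ × ℤ} {Z Z' : Set (Sym2 (ℤ × ℤ))}
    {φ : lattice ≃g lattice} (hZ : IsZipper f Z) (hZ' : IsZipper f' Z')
    (hφ : φ '' faceCorners f = faceCorners f') : ∃ ε : ℤ × ℤ → ℤˣ,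
      (∀ u v, lattice.Adj u v → (ε u = ε v ↔ (s(φ u, φ v) ∈ Z' ↔ s(u, v) ∈ Z))) ∧
      ∀ u v, greenZipper Z' (φ u) (φ v) = ((ε u * ε v : ℤˣ) : ℤ) * greenZipper Z u v := by
  obtain ⟨ε, hε⟩ := exists_gauge_of_zipper hZ hZ' hφ
  refine ⟨ε, fun u v huv => ?_, fun u v => greenZipper_map hZ hZ' φ ε hε u v⟩
  have := hε u v huv
  rw [iff_comm (a := _ ∈ Z'), ← edgeSign_eq_iff (Z := Z) (Z' := Z')]
  generalize edgeSign Z s(u, v) = a at *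
  generalize edgeSign Z' s(φ u, φ v) = b at *
  generalize ε u = c at *
  generalize ε v = d at *
  revert a b c d
  decide

/-! ### Moving the endpoint of a zipper -/

/-- The new edge lies in `f` and `f'` and in no other face, so exactly these two parities change. -/
lemma isZipper_insert {f f' : ℤ × ℤ} {Z : Set (Sym2 (ℤ × ℤ))} {e : Sym2 (ℤ × ℤ)}
    (hZ : IsZipper f Z) (hne : f ≠ f') (hf : e ∈ faceEdges f) (hf' : e ∈ faceEdges f')
    (he : e ∉ Z) : IsZipper f' (insert e Z) := by
  refine ⟨Set.insert_subset (faceEdges_subset f hf) hZ.1, fun g => ?_⟩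
  have hfin : (faceEdges g).Finite := by rw [faceEdges_eq]; exact Set.toFinite _
  have hg := eq_or_eq_of_mem_faceEdges (g := g) hf hf' hne
  by_cases h : e ∈ faceEdges g
  · rw [Set.inter_insert_of_mem h, Set.ncard_insert_of_notMem (fun h => he h.2)
      (hfin.inter_of_left Z), Nat.odd_add_one, hZ.2 g]
    rcases hg.mp h with rfl | rfl
    · simp [hne]
    · simp [hne.symm]
  · rw [Set.inter_insert_of_notMem h, hZ.2 g]
    have : g ≠ f ∧ g ≠ f' := ⟨fun e => h (hg.mpr (Or.inl e)), fun e => h (hg.mpr (Or.inr e))⟩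
    simp [this]

/-- Flipping the sign of one edge perturbs the Laplacian by a symmetric operator of rank two, which
exchanges the values at the ends of the edge. -/
lemma laplacian_insert {Z : Set (Sym2 (ℤ × ℤ))} {p q : ℤ × ℤ} (hpq : lattice.Adj p q)
    (he : s(p, q) ∉ Z) (g : ℤ × ℤ → ℝ) (v : ℤ × ℤ) :
    laplacian lattice (zipperSign (insert s(p, q) Z)) g v =
      laplacian lattice (zipperSign Z) g v + 2 * (if v = p then g q else 0) +
        2 * (if v = q then g p else 0) := by
  have hne : p ≠ q := hpq.ne
  have key : ∑ᶠ w ∈ lattice.neighborSet v, (if s(v, w) = s(p, q) then 2 * g w else 0) =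
      2 * (if v = p then g q else 0) + 2 * (if v = q then g p else 0) := by
    rw [finsum_mem_def]
    have hind : ∀ w, (lattice.neighborSet v).indicator
        (fun w => if s(v, w) = s(p, q) then 2 * g w else 0) w =
        (if s(v, w) = s(p, q) then 2 * g w else 0) := by
      intro w
      by_cases hw : w ∈ lattice.neighborSet v
      · rw [Set.indicator_of_mem hw]
      · rw [Set.indicator_of_notMem hw, if_neg]
        intro h
        refine hw ?_
        rw [SimpleGraph.mem_neighborSet, ← SimpleGraph.mem_edgeSet, h]
        exact hpq
    simp_rw [hind]
    by_cases hp : v = p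
    · rw [finsum_eq_single _ q]
      · simp [hp, hne]
      · intro w hw; simp [hp, hw, hne]
    · by_cases hq : v = q
      · rw [finsum_eq_single _ p]
        · simp [hq, hne.symm, Sym2.eq_swap]
        · intro w hw; simp [hq, hw, hne.symm]
      · simp [hp, hq]
  rw [add_assoc, ← key]
  unfold laplacian
  rw [← finsum_mem_add_distrib (neighborSet_lattice_finite v)]
  refine finsum_mem_congr rfl fun w _ => ?_
  simp only [zipperSign, Set.mem_insert_iff]
  by_cases h : s(v, w) = s(p, q)
  · simp [h, he]; ring
  · simp [h]

/-- The rank-two correction. -/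
theorem greenZipper_insert {f f' : ℤ × ℤ} {Z : Set (Sym2 (ℤ × ℤ))} {p q : ℤ × ℤ}
    (hZ : IsZipper f Z) (hZ' : IsZipper f' (insert s(p, q) Z)) (hpq : lattice.Adj p q)
    (he : s(p, q) ∉ Z) (hpp : greenZipper Z p p = 1 / 2) (hqq : greenZipper Z q q = 1 / 2)
    (hpq' : greenZipper Z p q = (√2 - 1) / 2) (u v : ℤ × ℤ) :
    greenZipper (insert s(p, q) Z) u v = greenZipper Z u v +
        (2 * greenZipper Z u p - 2 * √2 * greenZipper Z u q) * greenZipper Z p v +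
        (2 * greenZipper Z u q - 2 * √2 * greenZipper Z u p) * greenZipper Z q v := by
  -- With the given corner values, the errors at `p` and `q` cancel if `√2 a + b = -2 G(u, q)` and
  -- `a + √2 b = -2 G(u, p)`. These are the solutions.
  set a := 2 * greenZipper Z u p - 2 * √2 * greenZipper Z u q with ha
  set b := 2 * greenZipper Z u q - 2 * √2 * greenZipper Z u p with hb
  obtain ⟨-, hu, Cu, hCu⟩ := isInverseRow_greenZipper hZ u
  obtain ⟨-, hp, Cp, hCp⟩ := isInverseRow_greenZipper hZ p
  obtain ⟨-, hq, Cq, hCq⟩ := isInverseRow_greenZipper hZ q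
  have hne : p ≠ q := hpq.ne
  have h2 : √2 * √2 = 2 := Real.mul_self_sqrt (by norm_num)
  have hr : IsInverseRow lattice (zipperSign (insert s(p, q) Z)) ∅ u fun v =>
      greenZipper Z u v + a * greenZipper Z p v + b * greenZipper Z q v := by
    refine ⟨by simp, fun v _ => ?_, Cu + |a| * Cp + |b| * Cq, fun v => ?_⟩
    · have hqp : greenZipper Z q p = (√2 - 1) / 2 := by rw [greenZipper_comm hZ, hpq']
      rw [laplacian_insert hpq he, laplacian_add (neighborSet_lattice_finite _),
        laplacian_add (neighborSet_lattice_finite _),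
        laplacian_const_mul (neighborSet_lattice_finite _),
        laplacian_const_mul (neighborSet_lattice_finite _), hu v (by simp), hp v (by simp),
        hq v (by simp), hpp, hqq, hpq', hqp, add_assoc, add_assoc, add_assoc]
      refine add_eq_left.mpr ?_
      by_cases h1 : v = p
      · have : v ≠ q := h1 ▸ hne
        simp only [if_pos h1, if_neg this]
        rw [ha, hb]
        linear_combination (-2 * greenZipper Z u q) * h2
      · simp only [if_neg h1]
        by_cases h3 : v = q
        · simp only [if_pos h3]
          rw [ha, hb]
          linear_combination (-2 * greenZipper Z u p) * h2
        · simp [if_neg h3]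
    · refine (abs_add_three _ _ _).trans ?_
      rw [abs_mul, abs_mul]
      gcongr
      exacts [hCu v, hCp v, hCq v]
  exact (congrFun (hr.eq_greenFunction (isSign_zipperSign _) (nondeg_zipper hZ' ∅) (by simp))
    v).symm

/-! ### Discrete exponentials in rotated coordinates -/

open Complex in
/-- The eigenvalue of a horizontal step, as a function of the eigenvalue `s` of a vertical step. -/
noncomputable def rot (s : ℝ) : ℂ := (s - I) / (1 - s * I)

section Rot

open Complex

lemma one_sub_mul_I_ne (s : ℝ) : (1 - s * I : ℂ) ≠ 0 := fun h => by
  have := congrArg re h; simp at this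

lemma sub_I_ne (s : ℝ) : (s - I : ℂ) ≠ 0 := fun h => by
  have := congrArg im h; simp at this

lemma one_add_sq_ne (s : ℝ) : (1 + s ^ 2 : ℂ) ≠ 0 := by
  have : (1 + s ^ 2 : ℝ) ≠ 0 := by positivity
  exact_mod_cast this

lemma rot_ne (s : ℝ) : rot s ≠ 0 := div_ne_zero (sub_I_ne s) (one_sub_mul_I_ne s)

/-- For diagonal neighbors, harmonicity of `w ^ x * s ^ y` means `(w + 1/w) * (s + 1/s) = 4`. This
is that dispersion relation, cleared of the denominator in `s`. -/
lemma rot_add_inv (s : ℝ) : (rot s + (rot s)⁻¹) * (1 + s ^ 2) = 4 * s := by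
  have h1 := one_sub_mul_I_ne s
  have h2 := sub_I_ne s
  have : (s - I) * (1 - s * I) = -I * (1 + s ^ 2) := by ring_nf; simp
  rw [rot, inv_div, div_add_div _ _ h1 h2, mul_comm (1 - s * I : ℂ) (s - I), this,
    div_mul_eq_mul_div, div_eq_iff (mul_ne_zero (by simp) (one_add_sq_ne s))]
  have hI := I_sq
  linear_combination (1 + s ^ 2) * (1 + s ^ 2) * hI

lemma rot_sub_inv (s : ℝ) : I * (rot s - (rot s)⁻¹) * (1 + s ^ 2) = 2 * (1 - s ^ 2) := by
  have h1 := one_sub_mul_I_ne s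
  have h2 := sub_I_ne s
  have : (s - I) * (1 - s * I) = -I * (1 + s ^ 2) := by ring_nf; simp
  rw [rot, inv_div, div_sub_div _ _ h1 h2, mul_comm (1 - s * I : ℂ) (s - I), this,
    mul_div_assoc', div_mul_eq_mul_div, div_eq_iff (mul_ne_zero (by simp) (one_add_sq_ne s))]
  have hI := I_sq
  linear_combination (1 + s ^ 2) * I * (1 - s ^ 2) * hI

lemma norm_rot (s : ℝ) : ‖rot s‖ = 1 := by
  have h1 := one_sub_mul_I_ne s
  have : ‖(s - I : ℂ)‖ = ‖(1 - s * I : ℂ)‖ := by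
    have : (s - I : ℂ) = -I * (starRingEnd ℂ) (1 - s * I) := by
      simp; ring_nf; simp
    rw [this, norm_mul, RCLike.norm_conj]; simp
  rw [rot, norm_div, this, div_self (norm_ne_zero_iff.mpr h1)]

lemma conj_rot (s : ℝ) : (starRingEnd ℂ) (rot s) = (rot s)⁻¹ := by
  rw [Complex.inv_def, normSq_eq_norm_sq, norm_rot]; simp

lemma rot_mul_one_sub (s : ℝ) : rot s * (1 - s * I) = s - I :=
  div_mul_cancel₀ _ (one_sub_mul_I_ne s)

lemma continuous_rot : Continuous rot :=
  Continuous.div (by fun_prop) (by fun_prop) one_sub_mul_I_ne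

lemma one_le_norm_one_sub (s : ℝ) : 1 ≤ ‖(1 - s * I : ℂ)‖ := by
  have := abs_re_le_norm (1 - s * I : ℂ)
  simpa using this

/-- The integrand of the half-plane Green function. -/
noncomputable def kern (x : ℤ) (y : ℕ) (s : ℝ) : ℂ := rot s ^ x * s ^ y / (1 - s * I)

lemma continuous_kern (x : ℤ) (y : ℕ) : Continuous (kern x y) :=
  Continuous.div ((continuous_rot.zpow₀ x fun s => Or.inl (rot_ne s)).mul (by fun_prop))
    (by fun_prop) one_sub_mul_I_ne

lemma norm_kern_le (x : ℤ) (y : ℕ) (s : ℝ) : ‖kern x y s‖ ≤ |s| ^ y := by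
  rw [kern, norm_div, norm_mul, norm_zpow, norm_rot, one_zpow, one_mul, norm_pow, norm_real,
    Real.norm_eq_abs]
  exact div_le_self (by positivity) (one_le_norm_one_sub s)

lemma zpow_step (s : ℝ) (x : ℤ) :
    (rot s ^ (x + 1) + rot s ^ (x - 1)) * (1 + s ^ 2) = 4 * s * rot s ^ x := by
  rw [zpow_add_one₀ (rot_ne s), zpow_sub_one₀ (rot_ne s), ← mul_add, mul_assoc, rot_add_inv]
  ring

lemma kern_harmonic (x : ℤ) (y : ℕ) (s : ℝ) : 4 * kern x (y + 1) s =
    kern (x + 1) (y + 2) s + kern (x - 1) (y + 2) s + kern (x + 1) y s + kern (x - 1) y s := by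
  simp only [kern, ← add_div, mul_div_assoc']
  congr 1
  linear_combination (-(s : ℂ) ^ y) * zpow_step s x

/-- A discrete Cauchy-Riemann equation on the boundary: the normal flux is a tangential difference
times `I`. Neumann conditions can thus be read from values on the axis. -/
lemma kern_flux (x : ℤ) (s : ℝ) : 2 * kern x 0 s - kern (x + 1) 1 s - kern (x - 1) 1 s =
    I * (kern (x + 1) 0 s - kern (x - 1) 0 s) := by
  simp only [kern, ← sub_div, mul_div_assoc']
  congr 1
  have h := one_add_sq_ne s
  have h1 := rot_add_inv s
  have h2 := rot_sub_inv s
  rw [zpow_add_one₀ (rot_ne s), zpow_sub_one₀ (rot_ne s)]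
  apply mul_right_cancel₀ h
  linear_combination (-rot s ^ x * s) * h1 - rot s ^ x * h2

/-- Conjugation inverts `rot s`, and the denominator of `kern` shifts the exponent by one. So `x ↦
-x - 1` interchanges real and imaginary parts of the integrals, which links the Dirichlet half-axis
to the Neumann half-axis. -/
lemma kern_conj (x : ℤ) (y : ℕ) (s : ℝ) :
    (starRingEnd ℂ) (kern x y s) = -I * kern (-x - 1) y s := by
  have h1 := one_sub_mul_I_ne s
  have h2 : (1 + s * I : ℂ) ≠ 0 := by
    have := one_sub_mul_I_ne (-s); push_cast at this; simpa using this
  simp only [kern, map_div₀, map_mul, map_zpow₀, conj_rot, map_pow, conj_ofReal, map_sub, map_one,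
    conj_I]
  rw [zpow_sub_one₀ (rot_ne s), zpow_neg, inv_zpow, mul_neg, sub_neg_eq_add, mul_div_assoc',
    div_eq_div_iff h2 h1]
  have h3 := rot_mul_one_sub s
  have h4 := rot_ne s
  have h5 : rot s ^ x ≠ 0 := zpow_ne_zero _ h4
  field_simp
  linear_combination (s : ℂ) ^ y * h3 + s * s ^ y * I_sq

lemma hasDerivAt_rot (s : ℝ) : HasDerivAt rot (2 / (1 - s * I) ^ 2) s := by
  have h1 : HasDerivAt (fun s : ℝ => (s - I : ℂ)) 1 s := by
    simpa using (ofRealCLM.hasDerivAt (x := s)).sub_const I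
  have h2 : HasDerivAt (fun s : ℝ => (1 - s * I : ℂ)) (-I) s := by
    simpa using ((ofRealCLM.hasDerivAt (x := s)).mul_const I).const_sub 1
  have := h1.div h2 (one_sub_mul_I_ne s)
  refine this.congr_deriv ?_
  congr 1
  ring_nf; simp; norm_num

lemma hasDerivAt_rot_zpow (n : ℤ) (s : ℝ) :
    HasDerivAt (fun s => rot s ^ n) (n * rot s ^ (n - 1) * (2 / (1 - s * I) ^ 2)) s := by
  have := (hasDerivAt_zpow n (rot s) (Or.inl (rot_ne s))).comp_of_eq s (hasDerivAt_rot s) rfl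
  exact this

end Rot

/-! ### The half-plane Green function with mixed boundary conditions -/

section HalfPlane

open Complex MeasureTheory intervalIntegral
open scoped Real

/-- The integral of `kern x y`. -/
noncomputable def kernInt (x : ℤ) (y : ℕ) : ℂ := ∫ ψ in (-(π / 2))..(π / 2), kern x y (Real.sin ψ)

lemma continuous_kern_sin (x : ℤ) (y : ℕ) : Continuous fun ψ => kern x y (Real.sin ψ) :=
  (continuous_kern x y).comp Real.continuous_sin

/-- The difference of the two integrands is the derivative of `cos ψ * rot (sin ψ) ^ (n + 1) / (1 -
sin ψ * I)`, and the cosine vanishes at both ends. -/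
lemma kernInt_rec (n : ℤ) : (n + 2 : ℂ) * kernInt (n + 2) 0 = (n + 1) * kernInt n 0 := by
  have hd : ∀ ψ : ℝ, HasDerivAt
      (fun ψ : ℝ => (Real.cos ψ : ℂ) * (rot (Real.sin ψ) ^ (n + 1) / (1 - (Real.sin ψ : ℝ) * I)))
      ((n + 1) * kern n 0 (Real.sin ψ) - (n + 2) * kern (n + 2) 0 (Real.sin ψ)) ψ := by
    intro ψ
    have hc := (Real.hasDerivAt_cos ψ).ofReal_comp
    have h2 : HasDerivAt (fun s : ℝ => (1 - s * I : ℂ)) (-I) (Real.sin ψ) := by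
      simpa using ((ofRealCLM.hasDerivAt (x := Real.sin ψ)).mul_const I).const_sub 1
    have hq := ((hasDerivAt_rot_zpow (n + 1) (Real.sin ψ)).div h2
      (one_sub_mul_I_ne _)).scomp ψ (Real.hasDerivAt_sin ψ)
    refine (hc.mul hq).congr_deriv ?_
    have hcs : (Real.cos ψ : ℂ) ^ 2 = 1 - (Real.sin ψ : ℂ) ^ 2 := by
      rw [← ofReal_pow, Real.cos_sq', ofReal_sub, ofReal_one, ofReal_pow]
    simp only [Function.comp, kern, pow_zero, mul_one, Pi.div_apply]
    generalize Real.sin ψ = s at *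
    have h1 := one_sub_mul_I_ne s
    rw [show n + 2 = n + 1 + 1 by ring, add_sub_cancel_right]
    simp only [zpow_add_one₀ (rot_ne s)]
    rw [real_smul, ofReal_neg, Int.cast_add, Int.cast_one]
    have hr := rot_mul_one_sub s
    have hr' : rot s = (s - I) / (1 - s * I) := rfl
    generalize (Real.cos ψ : ℂ) = c at *
    generalize rot s ^ n = A
    have hpoly : -s * (s - I) * (1 - s * I) + (1 - s ^ 2) * (2 * (n + 1) + (s - I) * I) =
        (n + 1) * (1 - s * I) ^ 2 - (n + 2) * (s - I) ^ 2 := by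
      linear_combination ((n + 1) * (1 - s ^ 2) : ℂ) * I_sq
    rw [hr']
    generalize (1 - s * I : ℂ) = D at *
    generalize (s - I : ℂ) = N at *
    field_simp
    linear_combination A * hpoly + A * (2 * (n + 1) + N * I) * hcs
  have hi : ∀ (c : ℂ) m, IntervalIntegrable (fun ψ => c * kern m 0 (Real.sin ψ)) volume
      (-(π / 2)) (π / 2) := fun c m =>
    (continuous_const.mul (continuous_kern_sin m 0)).intervalIntegrable _ _
  have hint := integral_eq_sub_of_hasDerivAt (a := -(π / 2)) (b := π / 2) (fun ψ _ => hd ψ)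
    ((hi _ _).sub (hi _ _))
  rw [integral_sub (hi _ _) (hi _ _), intervalIntegral.integral_const_mul,
    intervalIntegral.integral_const_mul] at hint
  simp only [Real.cos_neg, Real.cos_pi_div_two, ofReal_zero, zero_mul, sub_zero] at hint
  exact (sub_eq_zero.mp hint).symm

/-- The usual antiderivative `arctan (√2 tan ψ) / √2` is singular in form at the ends. The addition
formula rewrites it as `ψ` plus the arctangent of a smooth function. -/
lemma integral_inv_one_add_sin_sq :
    ∫ ψ in (-(π / 2))..(π / 2), (1 + Real.sin ψ ^ 2)⁻¹ = π / √2 := by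
  have h2 : √2 ^ 2 = 2 := Real.sq_sqrt (by norm_num)
  have hr : 0 < √2 := by positivity
  set r := √2
  have hD : ∀ ψ, 0 < Real.cos ψ ^ 2 + r * Real.sin ψ ^ 2 := by
    intro ψ
    have h1 : 1 ≤ r := by nlinarith
    have := Real.sin_sq_add_cos_sq ψ
    nlinarith [sq_nonneg (Real.sin ψ)]
  have hd : ∀ ψ : ℝ, HasDerivAt (fun ψ => r⁻¹ * (ψ + Real.arctan
      ((r - 1) * Real.sin ψ * Real.cos ψ / (Real.cos ψ ^ 2 + r * Real.sin ψ ^ 2))))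
      (1 + Real.sin ψ ^ 2)⁻¹ ψ := by
    intro ψ
    have hs := Real.hasDerivAt_sin ψ
    have hc := Real.hasDerivAt_cos ψ
    have hN := (hs.const_mul (r - 1)).mul hc
    have hDD := (hc.pow 2).add ((hs.pow 2).const_mul r)
    have := (((hasDerivAt_id ψ).add ((hN.div hDD (hD ψ).ne').arctan)).const_mul r⁻¹)
    refine this.congr_deriv ?_
    simp only [Pi.mul_apply, Pi.add_apply, Pi.pow_apply, Pi.div_apply]
    have hD' := (hD ψ).ne'
    have hcs := Real.cos_sq' ψ
    have hp : (1 + Real.sin ψ ^ 2) ≠ 0 := by positivity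
    have hNN : 1 + ((r - 1) * Real.sin ψ * Real.cos ψ /
        (Real.cos ψ ^ 2 + r * Real.sin ψ ^ 2)) ^ 2 =
        (1 + Real.sin ψ ^ 2) / (Real.cos ψ ^ 2 + r * Real.sin ψ ^ 2) ^ 2 := by
      rw [div_pow, eq_div_iff (pow_ne_zero 2 hD'), add_mul, div_mul_cancel₀ _ (pow_ne_zero 2 hD')]
      generalize Real.sin ψ = s at *
      generalize Real.cos ψ = c at *
      rw [mul_pow, mul_pow, hcs]
      linear_combination s ^ 2 * h2
    rw [hNN]
    generalize Real.sin ψ = s at *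
    generalize Real.cos ψ = c at *
    field_simp
    have e : 1 + s ^ 2 + (r - 1) * ((c ^ 2 + r * s ^ 2) * (c ^ 2 + -s ^ 2) -
        s * c * 2 * (-(s * c) + r * c * s)) = 1 + s ^ 2 + (r - 1) *
        ((c ^ 2 + r * s ^ 2) * (c ^ 2 - s ^ 2) - 2 * s ^ 2 * c ^ 2 * (r - 1)) := by
      ring
    simp only [Nat.cast_ofNat, Nat.add_one_sub_one, pow_one]
    rw [e, hcs]
    linear_combination (-s ^ 2) * h2
  rw [integral_eq_sub_of_hasDerivAt (fun ψ _ => hd ψ)]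
  · simp; ring
  · refine Continuous.intervalIntegrable (Continuous.inv₀ (by fun_prop) fun ψ => ?_) _ _
    positivity

lemma intervalIntegrable_kern (x : ℤ) (y : ℕ) (a b : ℝ) :
    IntervalIntegrable (fun ψ => kern x y (Real.sin ψ)) volume a b :=
  (continuous_kern_sin x y).intervalIntegrable _ _

lemma kernInt_harmonic (x : ℤ) (y : ℕ) : 4 * kernInt x (y + 1) =
    kernInt (x + 1) (y + 2) + kernInt (x - 1) (y + 2) + kernInt (x + 1) y + kernInt (x - 1) y := by
  have hi := fun x y => intervalIntegrable_kern x y (-(π / 2)) (π / 2)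
  simp only [kernInt]
  rw [← integral_add (hi _ _) (hi _ _), ← integral_add ((hi _ _).add (hi _ _)) (hi _ _),
    ← integral_add (((hi _ _).add (hi _ _)).add (hi _ _)) (hi _ _),
    ← intervalIntegral.integral_const_mul]
  exact integral_congr fun ψ _ => kern_harmonic x y _

lemma kernInt_flux (x : ℤ) : 2 * kernInt x 0 - kernInt (x + 1) 1 - kernInt (x - 1) 1 =
    I * (kernInt (x + 1) 0 - kernInt (x - 1) 0) := by
  have hi := fun x y => intervalIntegrable_kern x y (-(π / 2)) (π / 2)
  simp only [kernInt]
  rw [← intervalIntegral.integral_const_mul, ← integral_sub ((hi _ _).const_mul _) (hi _ _),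
    ← integral_sub (((hi _ _).const_mul _).sub (hi _ _)) (hi _ _),
    ← integral_sub (hi _ _) (hi _ _), ← intervalIntegral.integral_const_mul]
  exact integral_congr fun ψ _ => kern_flux x _

lemma kernInt_conj (x : ℤ) (y : ℕ) :
    (starRingEnd ℂ) (kernInt x y) = -I * kernInt (-x - 1) y := by
  have := (conjCLE : ℂ →L[ℝ] ℂ).intervalIntegral_comp_comm
    (intervalIntegrable_kern x y (-(π / 2)) (π / 2))
  rw [kernInt, kernInt, ← intervalIntegral.integral_const_mul]
  refine this.symm.trans ?_
  exact integral_congr fun ψ _ => kern_conj x y _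

lemma im_kernInt_neg (x : ℤ) (y : ℕ) : (kernInt (-x - 1) y).im = (kernInt x y).re := by
  have := congrArg re (kernInt_conj x y)
  simpa using this.symm

lemma re_kernInt_neg (x : ℤ) (y : ℕ) : (kernInt (-x - 1) y).re = (kernInt x y).im := by
  have := congrArg im (kernInt_conj x y)
  simpa using this.symm

lemma re_kernInt (x : ℤ) (y : ℕ) :
    (kernInt x y).re = ∫ ψ in (-(π / 2))..(π / 2), (kern x y (Real.sin ψ)).re :=
  ((reCLM : ℂ →L[ℝ] ℝ).intervalIntegral_comp_comm
    (intervalIntegrable_kern x y (-(π / 2)) (π / 2))).symm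

lemma re_kern_zero (y : ℕ) (s : ℝ) : (kern 0 y s).re = s ^ y * (1 + s ^ 2)⁻¹ := by
  have h1 := one_sub_mul_I_ne s
  have : kern 0 y s = ((s ^ y * (1 + s ^ 2)⁻¹ : ℝ) : ℂ) * (1 + s * I) := by
    have h2 := one_add_sq_ne s
    rw [kern, zpow_zero, one_mul]
    push_cast
    field_simp
    linear_combination (s : ℂ) ^ y * s ^ 2 * I_sq
  rw [this, re_ofReal_mul]; simp

lemma re_kern_neg_one (y : ℕ) (s : ℝ) : kern (-1) (y + 1) s =
    ((s ^ (y + 1) * (1 + s ^ 2)⁻¹ : ℝ) : ℂ) * (s + I) := by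
  have h1 := one_sub_mul_I_ne s
  have h3 := sub_I_ne s
  have h2 := one_add_sq_ne s
  rw [kern, zpow_neg_one, rot, inv_div]
  push_cast
  field_simp
  linear_combination (s : ℂ) ^ (y + 1) * I_sq

lemma re_kernInt_zero : (kernInt 0 0).re = π / √2 := by
  rw [re_kernInt, ← integral_inv_one_add_sin_sq]
  exact integral_congr fun ψ _ => by simp [re_kern_zero]

/-- The numbers `4⁻ᵏ (2k choose k)`. -/
noncomputable def axisVal (k : ℕ) : ℝ := (Nat.centralBinom k : ℝ) / 4 ^ k

lemma axisVal_zero : axisVal 0 = 1 := by simp [axisVal]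

lemma axisVal_succ (k : ℕ) : (2 * k + 2) * axisVal (k + 1) = (2 * k + 1) * axisVal k := by
  have h := Nat.succ_mul_centralBinom_succ k
  have h' : ((k : ℝ) + 1) * Nat.centralBinom (k + 1) = 2 * (2 * k + 1) * Nat.centralBinom k := by
    exact_mod_cast h
  rw [axisVal, axisVal, pow_succ]
  field_simp
  linear_combination 2 * h'

lemma kernInt_even (k : ℕ) : kernInt (2 * k) 0 = axisVal k * kernInt 0 0 := by
  induction k with
  | zero => simp [axisVal_zero]
  | succ k ih =>
    have h := kernInt_rec (2 * k)
    have h2 : ((2 * k + 2) * axisVal (k + 1) : ℂ) = (2 * k + 1) * axisVal k := by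
      exact_mod_cast axisVal_succ k
    have h3 : (2 * k + 2 : ℂ) ≠ 0 := by exact_mod_cast (by omega : 2 * k + 2 ≠ 0)
    push_cast at h ⊢
    rw [ih] at h
    rw [show (2 * ((k : ℤ) + 1)) = 2 * k + 2 by ring]
    apply mul_left_cancel₀ h3
    linear_combination h - kernInt 0 0 * h2

/-- At `n = -1` the factor `n + 1` in `kernInt_rec` is zero, so the odd chain starts at 0. This is
the source of the Dirichlet condition at negative even points and of the absence of flux at positive
even points. -/
lemma kernInt_odd (k : ℕ) : kernInt (2 * k + 1) 0 = 0 := by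
  induction k with
  | zero => have := kernInt_rec (-1); norm_num at this; exact this
  | succ k ih =>
    have h := kernInt_rec (2 * k + 1)
    rw [ih, mul_zero] at h
    have h3 : (((2 * k + 1 : ℤ) : ℂ) + 2) ≠ 0 := by
      push_cast; exact_mod_cast (by omega : 2 * k + 1 + 2 ≠ 0)
    have := (mul_eq_zero.mp h).resolve_left h3
    rw [← this]; congr 1

/-- The half-plane Green function, with Dirichlet conditions on the negative axis and Neumann
conditions on the positive axis. -/
noncomputable def halfGreen (x : ℤ) (y : ℕ) : ℝ := √2 / π * (kernInt x y).re

lemma halfGreen_harmonic (x : ℤ) (y : ℕ) : 4 * halfGreen x (y + 1) =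
    halfGreen (x + 1) (y + 2) + halfGreen (x - 1) (y + 2) + halfGreen (x + 1) y +
      halfGreen (x - 1) y := by
  have := congrArg re (kernInt_harmonic x y)
  simp only [mul_re, add_re, re_ofNat, im_ofNat, zero_mul, sub_zero] at this
  simp only [halfGreen]
  linear_combination √2 / π * this

lemma two_mul_sqrt_two_div : √2 / π * (π / √2) = 1 := by
  have : √2 ≠ 0 := by positivity
  field_simp

lemma halfGreen_even (k : ℕ) : halfGreen (2 * k) 0 = axisVal k := by
  rw [halfGreen, kernInt_even, re_ofReal_mul, re_kernInt_zero, mul_left_comm,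
    two_mul_sqrt_two_div, mul_one]

lemma halfGreen_neg (k : ℕ) (hk : 1 ≤ k) : halfGreen (-2 * k) 0 = 0 := by
  obtain ⟨k, rfl⟩ := Nat.exists_eq_add_of_le' hk
  rw [halfGreen, show (-2 * ((k + 1 : ℕ) : ℤ)) = -(2 * k + 1) - 1 by push_cast; ring,
    re_kernInt_neg, kernInt_odd]
  simp

lemma halfGreen_flux (x : ℤ) : 2 * halfGreen x 0 - halfGreen (x + 1) 1 - halfGreen (x - 1) 1 =
    √2 / π * ((kernInt (x - 1) 0).im - (kernInt (x + 1) 0).im) := by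
  have := congrArg re (kernInt_flux x)
  simp only [mul_re, sub_re, re_ofNat, im_ofNat, zero_mul, sub_zero, I_re, I_im, sub_im,
    one_mul] at this
  simp only [halfGreen]
  linear_combination √2 / π * this

/-- The flux at `2 * k` is a difference of imaginary parts at the odd points `2 * k ± 1`. Only -1
contributes; there the imaginary part reflects to the real part at 0, which is `π / √2`, and the
normalization of `halfGreen` makes the source 1. -/
lemma halfGreen_flux_nonneg (k : ℕ) :
    2 * halfGreen (2 * k) 0 - halfGreen (2 * k + 1) 1 - halfGreen (2 * k - 1) 1 =
      if k = 0 then 1 else 0 := by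
  rw [halfGreen_flux, kernInt_odd, zero_im, sub_zero]
  cases k with
  | zero =>
    have := im_kernInt_neg 0 0
    norm_num at this ⊢
    rw [this, re_kernInt_zero, two_mul_sqrt_two_div]
  | succ k =>
    rw [show (2 * ((k + 1 : ℕ) : ℤ)) - 1 = 2 * k + 1 by push_cast; ring, kernInt_odd]
    simp

lemma halfGreen_flux_neg (k : ℕ) :
    2 * halfGreen (-2 * (k + 1)) 0 - halfGreen (-2 * (k + 1) + 1) 1 -
      halfGreen (-2 * (k + 1) - 1) 1 = axisVal (k + 1) - axisVal k := by
  have h1 := im_kernInt_neg (2 * k) 0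
  have h2 := im_kernInt_neg (2 * (k + 1 : ℕ)) 0
  rw [kernInt_even, re_ofReal_mul, re_kernInt_zero] at h1 h2
  rw [halfGreen_flux, show (-2 * ((k : ℤ) + 1) + 1) = -(2 * k) - 1 by ring, h1,
    show (-2 * ((k : ℤ) + 1) - 1) = -(2 * (k + 1 : ℕ)) - 1 by push_cast; ring, h2, ← sub_mul,
    mul_left_comm, two_mul_sqrt_two_div, mul_one]

/-- The integrands already agree: with `s = sin ψ`, both real parts are `s ^ (2 * k + 2) / (1 + s ^
2)`. -/
lemma halfGreen_neg_one (k : ℕ) : halfGreen (-1) (2 * k + 1) = halfGreen 0 (2 * k + 2) := by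
  rw [halfGreen, halfGreen, re_kernInt, re_kernInt]
  congr 1
  refine integral_congr fun ψ _ => ?_
  simp only [re_kern_neg_one, re_kern_zero, re_ofReal_mul, add_re, I_re, ofReal_re]
  ring

lemma prod_eq_axisVal (k : ℕ) :
    ∏ i ∈ Finset.range k, (2 * (i : ℝ) + 1) / (2 * i + 2) = axisVal k := by
  induction k with
  | zero => simp [axisVal_zero]
  | succ k ih =>
    rw [Finset.prod_range_succ, ih]
    have := axisVal_succ k
    field_simp
    linear_combination -this

lemma integral_sin_pow_even_symm (k : ℕ) :
    ∫ ψ in (-(π / 2))..(π / 2), Real.sin ψ ^ (2 * k) = π * axisVal k := by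
  have hp : Function.Periodic (fun ψ => Real.sin ψ ^ (2 * k)) π := fun ψ => by
    simp only [Real.sin_add_pi]
    rw [Even.neg_pow (even_two_mul k)]
  have := hp.intervalIntegral_add_eq (-(π / 2)) 0
  rw [show -(π / 2) + π = π / 2 by ring, zero_add] at this
  rw [this, integral_sin_pow_even, prod_eq_axisVal]

/-- The sum of the integrands cancels the denominator `1 + sin ψ ^ 2`, and Wallis' integral remains.
-/
lemma halfGreen_column (k : ℕ) :
    halfGreen 0 (2 * k) + halfGreen 0 (2 * k + 2) = √2 * axisVal k := by
  have hc : ∀ y, Continuous fun ψ => (kern 0 y (Real.sin ψ)).re := fun y =>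
    continuous_re.comp (continuous_kern_sin 0 y)
  rw [halfGreen, halfGreen, re_kernInt, re_kernInt, ← mul_add, ← integral_add
    ((hc _).intervalIntegrable _ _) ((hc _).intervalIntegrable _ _), div_mul_eq_mul_div,
    mul_div_assoc]
  congr 1
  rw [div_eq_iff Real.pi_ne_zero, mul_comm (axisVal k), ← integral_sin_pow_even_symm]
  refine integral_congr fun ψ _ => ?_
  simp only [re_kern_zero]
  have : (1 + Real.sin ψ ^ 2) ≠ 0 := by positivity
  field_simp
  ring

lemma abs_halfGreen_le (x : ℤ) (y : ℕ) : |halfGreen x y| ≤ √2 := by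
  have h : ‖kernInt x y‖ ≤ 1 * |π / 2 - -(π / 2)| := norm_integral_le_of_norm_le_const
    fun ψ _ => (norm_kern_le _ _ _).trans (pow_le_one₀ (abs_nonneg _) (Real.abs_sin_le_one ψ))
  rw [halfGreen, abs_mul, abs_of_pos (by positivity), div_mul_eq_mul_div,
    div_le_iff₀ Real.pi_pos]
  gcongr
  refine (abs_re_le_norm _).trans (h.trans_eq ?_)
  rw [abs_of_pos (by linarith [Real.pi_pos])]; ring

end HalfPlane

/-! ### The slit plane -/

lemma mem_slit {v : ℤ × ℤ} : v ∈ slit ↔ v.1 = v.2 ∧ v.1 ≤ -1 := by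
  obtain ⟨a, b⟩ := v
  simp only [slit, Set.mem_ofPred_eq, Prod.mk.injEq]
  exact ⟨fun ⟨k, hk, h1, h2⟩ => by omega, fun h => ⟨a, by omega, rfl, by omega⟩⟩

lemma zero_notMem_slit : (0 : ℤ × ℤ) ∉ slit := by simp [mem_slit]

lemma nondeg_slit : Nondeg 1 slit :=
  nondeg_of_mem isSign_one (u := (-1, -1)) (by simp [mem_slit])

lemma isInverseRow_GD {u : ℤ × ℤ} (hu : u ∉ slit) : IsInverseRow lattice 1 slit u (GD u) :=
  isInverseRow_greenFunction isSign_one nondeg_slit hu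

lemma GD_of_mem {u : ℤ × ℤ} (hu : u ∈ slit) (v : ℤ × ℤ) : GD u v = 0 :=
  greenFunction_of_mem isSign_one nondeg_slit hu v

/-- Slit and source are symmetric in the diagonal, so the row depends only on `i + j` and `|j - i|`.
On the diagonal every neighbor occurs together with its mirror image; the division by 2 turns the
resulting equation into the Neumann flux condition. -/
lemma isInverseRow_halfGreen : IsInverseRow lattice 1 slit 0
    fun v => halfGreen (v.1 + v.2) (v.2 - v.1).natAbs / 2 := by
  refine ⟨fun v hv => ?_, fun v hv => ?_, √2, fun v => ?_⟩
  · obtain ⟨i, j⟩ := v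
    rw [mem_slit] at hv
    obtain ⟨h1, h2⟩ := hv
    dsimp only at h1 h2 ⊢
    subst h1
    obtain ⟨k, rfl⟩ : ∃ k : ℕ, i = -k := ⟨i.natAbs, by omega⟩
    have := halfGreen_neg k (by omega)
    rw [sub_self, Int.natAbs_zero, show (-(k : ℤ) + -k) = -2 * k by ring, this, zero_div]
  · obtain ⟨i, j⟩ := v
    rw [mem_slit] at hv
    simp only [laplacian_lattice, Pi.one_apply, one_mul, Prod.mk_add_mk, add_zero]
    rcases lt_trichotomy i j with h | h | h
    · obtain ⟨n, rfl⟩ : ∃ n : ℕ, j = i + (n + 1) := ⟨(j - i - 1).natAbs, by omega⟩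
      have := halfGreen_harmonic (i + (i + (n + 1))) n
      rw [if_neg (by simp [Prod.ext_iff]; omega),
        show (i + (n + 1) - i : ℤ).natAbs = n + 1 by omega,
        show (i + (n + 1) - (i + 1) : ℤ).natAbs = n by omega,
        show (i + (n + 1) - (i + -1) : ℤ).natAbs = n + 2 by omega,
        show (i + (n + 1) + 1 - i : ℤ).natAbs = n + 2 by omega,
        show (i + (n + 1) + -1 - i : ℤ).natAbs = n by omega,
        show i + 1 + (i + (n + 1)) = i + (i + (n + 1 : ℤ)) + 1 by ring,
        show i + -1 + (i + (n + 1)) = i + (i + (n + 1 : ℤ)) - 1 by ring,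
        show i + (i + (n + 1 : ℤ) + 1) = i + (i + (n + 1 : ℤ)) + 1 by ring,
        show i + (i + (n + 1 : ℤ) + -1) = i + (i + (n + 1 : ℤ)) - 1 by ring]
      linarith
    · subst h
      have h0 : 0 ≤ i := by by_contra h; exact hv ⟨rfl, by dsimp only; omega⟩
      obtain ⟨k, rfl⟩ : ∃ k : ℕ, i = k := ⟨i.natAbs, by omega⟩
      have := halfGreen_flux_nonneg k
      rw [show (k - k : ℤ).natAbs = 0 by omega,
        show (k - (k + 1) : ℤ).natAbs = 1 by omega,
        show (k - (k + -1) : ℤ).natAbs = 1 by omega,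
        show (k + 1 - k : ℤ).natAbs = 1 by omega,
        show (k + -1 - k : ℤ).natAbs = 1 by omega,
        show (k : ℤ) + k = 2 * k by ring,
        show (k : ℤ) + 1 + k = 2 * k + 1 by ring,
        show (k : ℤ) + -1 + k = 2 * k - 1 by ring,
        show (k : ℤ) + (k + 1) = 2 * k + 1 by ring,
        show (k : ℤ) + (k + -1) = 2 * k - 1 by ring]
      have hk : ((k : ℤ), (k : ℤ)) = 0 ↔ k = 0 := by simp [Prod.ext_iff]
      simp only [hk]
      rw [← this]; ring
    · obtain ⟨n, rfl⟩ : ∃ n : ℕ, i = j + (n + 1) := ⟨(i - j - 1).natAbs, by omega⟩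
      have := halfGreen_harmonic (j + (n + 1) + j) n
      rw [if_neg (by simp [Prod.ext_iff]; omega),
        show (j - (j + (n + 1)) : ℤ).natAbs = n + 1 by omega,
        show (j - (j + (n + 1) + 1) : ℤ).natAbs = n + 2 by omega,
        show (j - (j + (n + 1) + -1) : ℤ).natAbs = n by omega,
        show (j + 1 - (j + (n + 1)) : ℤ).natAbs = n by omega,
        show (j + -1 - (j + (n + 1)) : ℤ).natAbs = n + 2 by omega,
        show j + (n + 1) + 1 + j = (j + (n + 1 : ℤ)) + j + 1 by ring,
        show j + (n + 1) + -1 + j = (j + (n + 1 : ℤ)) + j - 1 by ring,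
        show j + (n + 1 : ℤ) + (j + 1) = (j + (n + 1 : ℤ)) + j + 1 by ring,
        show j + (n + 1 : ℤ) + (j + -1) = (j + (n + 1 : ℤ)) + j - 1 by ring]
      linarith
  · rw [abs_div, abs_two]
    have := abs_halfGreen_le (v.1 + v.2) (v.2 - v.1).natAbs
    have := abs_nonneg (halfGreen (v.1 + v.2) (v.2 - v.1).natAbs)
    linarith

lemma GD_zero (v : ℤ × ℤ) : GD 0 v = halfGreen (v.1 + v.2) (v.2 - v.1).natAbs / 2 :=
  (congrFun (isInverseRow_halfGreen.eq_greenFunction isSign_one nondeg_slit zero_notMem_slit)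
    v).symm

lemma GH_eq {x y : ℤ} (h : Even (x + y)) : GH x y = halfGreen x y.natAbs := by
  obtain ⟨r, hr⟩ := h
  rw [GH, GD_zero]
  have h1 : (x - y) / 2 + (x + y) / 2 = x := by omega
  have h2 : (x + y) / 2 - (x - y) / 2 = y := by omega
  simp only [h1, h2]
  ring

/-! ### The diagonal zipper -/

lemma hEdge_mem_diagonalZipper {v : ℤ × ℤ} : hEdge v ∈ diagonalZipper ↔ v ∈ slit := by
  obtain ⟨i, j⟩ := v
  rw [mem_slit]
  constructor
  · rintro ⟨m, hm, h | h⟩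
    · have : hEdge (i, j) = hEdge (-m, -m) := by rw [h]; simp [hEdge]
      rw [hEdge_inj, Prod.mk.injEq] at this
      dsimp only; omega
    · have : hEdge (i, j) = vEdge (-m, -m - 1) := by rw [h]; simp [vEdge, Sym2.eq_swap]
      exact absurd this (hEdge_ne_vEdge _ _)
  · rintro ⟨h1, h2⟩
    dsimp only at h1 h2
    subst h1
    exact ⟨-i, by omega, Or.inl (by simp [hEdge])⟩

lemma vEdge_mem_diagonalZipper {v : ℤ × ℤ} :
    vEdge v ∈ diagonalZipper ↔ v + (0, 1) ∈ slit := by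
  obtain ⟨i, j⟩ := v
  rw [mem_slit]
  constructor
  · rintro ⟨m, hm, h | h⟩
    · have : vEdge (i, j) = hEdge (-m, -m) := by rw [h]; simp [hEdge]
      exact absurd this.symm (hEdge_ne_vEdge _ _)
    · have : vEdge (i, j) = vEdge (-m, -m - 1) := by rw [h]; simp [vEdge, Sym2.eq_swap]
      rw [vEdge_inj, Prod.mk.injEq] at this
      simp only [Prod.mk_add_mk]; omega
  · rintro ⟨h1, h2⟩
    simp only [Prod.mk_add_mk] at h1 h2
    obtain rfl : j = i - 1 := by omega
    exact ⟨-i, by omega, Or.inr (by simp [vEdge, Sym2.eq_swap])⟩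

lemma isZipper_diagonalZipper : IsZipper (-1, -1) diagonalZipper := by
  rw [isZipper_iff]
  constructor
  · rintro e ⟨m, _, rfl | rfl⟩
    · simpa using adj_right (-m, -m)
    · have := (adj_up (-m, -m - 1)).symm
      simpa using this
  · rintro ⟨i, j⟩
    rw [holonomy_eq]
    simp only [edgeSign, hEdge_mem_diagonalZipper, vEdge_mem_diagonalZipper, mem_slit,
      Prod.mk_add_mk, Prod.mk.injEq]
    split_ifs <;> first
      | (refine iff_of_true (by decide) ?_; omega)
      | (refine iff_of_false (by decide) ?_; omega)

/-- The isometry of the lattice that maps `p` to the origin and the orthonormal frame `d`, `n` to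
the standard one. -/
def frameIso (p d n : ℤ × ℤ) (h : (d.1 = 0 ∧ n.2 = 0 ∧ d.2 * d.2 = 1 ∧ n.1 * n.1 = 1) ∨
    (d.2 = 0 ∧ n.1 = 0 ∧ d.1 * d.1 = 1 ∧ n.2 * n.2 = 1)) : lattice ≃g lattice where
  toFun v := ((v.1 - p.1) * d.1 + (v.2 - p.2) * d.2, (v.1 - p.1) * n.1 + (v.2 - p.2) * n.2)
  invFun w := (p.1 + w.1 * d.1 + w.2 * n.1, p.2 + w.1 * d.2 + w.2 * n.2)
  left_inv v := by
    rcases h with ⟨h1, h2, h3, h4⟩ | ⟨h1, h2, h3, h4⟩ <;> ext <;> simp only [h1, h2]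
    · linear_combination (v.1 - p.1) * h4
    · linear_combination (v.2 - p.2) * h3
    · linear_combination (v.1 - p.1) * h3
    · linear_combination (v.2 - p.2) * h4
  right_inv v := by
    rcases h with ⟨h1, h2, h3, h4⟩ | ⟨h1, h2, h3, h4⟩ <;> ext <;> simp only [h1, h2]
    · linear_combination v.1 * h3
    · linear_combination v.2 * h4
    · linear_combination v.1 * h3
    · linear_combination v.2 * h4
  map_rel_iff' {u v} := by
    have habs : ∀ x : ℤ, x * x = 1 → |x| = 1 := fun x hx => by
      rcases mul_self_eq_one_iff.mp hx with rfl | rfl <;> rfl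
    change |_| + |_| = 1 ↔ |_| + |_| = 1
    simp only [Equiv.coe_fn_mk]
    rcases h with ⟨h1, h2, h3, h4⟩ | ⟨h1, h2, h3, h4⟩ <;> simp only [h1, h2, mul_zero, zero_add,
      add_zero, ← sub_mul, sub_sub_sub_cancel_right, abs_mul, habs _ h3, habs _ h4, mul_one]
    rw [add_comm]

lemma frameIso_apply (p d n h v) : frameIso p d n h v =
    ((v.1 - p.1) * d.1 + (v.2 - p.2) * d.2, (v.1 - p.1) * n.1 + (v.2 - p.2) * n.2) := rfl

lemma frameIso_symm_apply (p d n h w) : (frameIso p d n h).symm w =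
    (p.1 + w.1 * d.1 + w.2 * n.1, p.2 + w.1 * d.2 + w.2 * n.2) := rfl

lemma GZ_comm (u v : ℤ × ℤ) : GZ u v = GZ v u := greenZipper_comm isZipper_diagonalZipper u v

/-- The sign of the gauge transformation that reflects the diagonal zipper. -/
noncomputable def slitSign (v : ℤ × ℤ) : ℤˣ := if v ∈ slit then -1 else 1

/-- At every slit vertex the zipper contains the right and the lower edge, and its reflection the
upper and the left edge. Together these are all edges at that vertex, so the gauge sign -1 on the
slit exchanges the two zippers. -/
lemma GZ_swap (u v : ℤ × ℤ) :
    GZ u.swap v.swap = ((slitSign u * slitSign v : ℤˣ) : ℤ) * GZ u v := by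
  have := greenZipper_map isZipper_diagonalZipper isZipper_diagonalZipper
    (frameIso 0 (0, 1) (1, 0) (by simp)) slitSign ?_ u v
  · simpa [frameIso_apply, GZ, Prod.swap] using this
  intro v w h
  refine adj_cases (P := fun v w => slitSign v * slitSign w = edgeSign diagonalZipper s(v, w) *
    edgeSign diagonalZipper s(frameIso 0 (0, 1) (1, 0) (by simp) v,
      frameIso 0 (0, 1) (1, 0) (by simp) w)) ?_ ?_ ?_ h
  · intro v w h
    rw [mul_comm, h, Sym2.eq_swap, Sym2.eq_swap (a := frameIso 0 (0, 1) (1, 0) (by simp) v)]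
  · rintro ⟨i, j⟩
    have e : s(frameIso 0 (0, 1) (1, 0) (by simp) (i, j),
        frameIso 0 (0, 1) (1, 0) (by simp) ((i, j) + (1, 0))) = vEdge (j, i) := by
      simp [frameIso_apply, vEdge]
    rw [e]
    change _ = edgeSign diagonalZipper (hEdge _) * _
    simp only [edgeSign, slitSign, hEdge_mem_diagonalZipper, vEdge_mem_diagonalZipper, mem_slit,
      Prod.mk_add_mk]
    split_ifs <;> first | rfl | omega
  · rintro ⟨i, j⟩
    have e : s(frameIso 0 (0, 1) (1, 0) (by simp) (i, j),
        frameIso 0 (0, 1) (1, 0) (by simp) ((i, j) + (0, 1))) = hEdge (j, i) := by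
      simp [frameIso_apply, hEdge]
    rw [e]
    change _ = edgeSign diagonalZipper (vEdge _) * _
    simp only [edgeSign, slitSign, hEdge_mem_diagonalZipper, vEdge_mem_diagonalZipper, mem_slit,
      Prod.mk_add_mk]
    split_ifs <;> first | rfl | omega

/-- Every zipper edge has an end on the slit, so from outside the slit the signs only multiply
zeros. -/
lemma laplacian_diagonal_of_slit {g : ℤ × ℤ → ℝ} (hg : ∀ v ∈ slit, g v = 0) {v : ℤ × ℤ}
    (hv : v ∉ slit) :
    laplacian lattice (zipperSign diagonalZipper) g v = laplacian lattice 1 g v := by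
  unfold laplacian
  refine finsum_mem_congr rfl fun w hw => ?_
  by_cases h : w ∈ slit
  · simp [hg w h]
  · have : s(v, w) ∉ diagonalZipper := by
      refine adj_cases (P := fun v w => v ∉ slit → w ∉ slit → s(v, w) ∉ diagonalZipper) ?_ ?_ ?_
        hw hv h
      · intro u v h hv hu
        rw [Sym2.eq_swap]; exact h hu hv
      · intro v hv _ h
        exact hv (hEdge_mem_diagonalZipper.mp h)
      · intro v _ hv h
        exact hv (vEdge_mem_diagonalZipper.mp h)
    simp [zipperSign, this]

lemma swap_notMem_slit {v : ℤ × ℤ} (hv : v ∉ slit) : v.swap ∉ slit := by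
  rw [mem_slit] at *; simp only [Prod.fst_swap, Prod.snd_swap]; omega

/-- The symmetric parts of the zipper Green function and of the slit Green function agree. -/
lemma GZ_add_swap {u : ℤ × ℤ} (hu : u ∉ slit) (v : ℤ × ℤ) :
    GZ u v + GZ u.swap v = GD u v + GD u.swap v := by
  have hu' := swap_notMem_slit hu
  obtain ⟨-, a1, C1, b1⟩ := isInverseRow_greenZipper isZipper_diagonalZipper u
  obtain ⟨-, a2, C2, b2⟩ := isInverseRow_greenZipper isZipper_diagonalZipper u.swap
  obtain ⟨z3, a3, C3, b3⟩ := isInverseRow_GD hu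
  obtain ⟨z4, a4, C4, b4⟩ := isInverseRow_GD hu'
  -- The reflection fixes `w`, and the gauge sign is -1 at `w` and 1 at `u`; so the two values are
  -- opposite.
  have hz : ∀ w ∈ slit, GZ u w + GZ u.swap w = 0 := by
    intro w hw
    have h := GZ_swap u w
    have hws : w.swap = w := by
      rw [mem_slit] at hw; ext <;> simp [hw.1]
    rw [hws, slitSign, slitSign, if_neg hu, if_pos hw] at h
    rw [h]; simp
  have := eq_zero_of_harmonic isSign_one nondeg_slit
    (g := fun w => (GZ u w + GZ u.swap w) - (GD u w + GD u.swap w)) (fun w hw => ?_)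
    (fun w hw => ?_) ⟨(C1 + C2) + (C3 + C4), fun w => ?_⟩ v
  · linarith
  · rw [hz w hw, z3 w hw, z4 w hw]; simp
  · rw [laplacian_sub, ← laplacian_diagonal_of_slit hz hw,
      laplacian_add (neighborSet_lattice_finite _), laplacian_add (neighborSet_lattice_finite _),
      a3 w hw, a4 w hw]
    have e1 := a1 w (by simp)
    have e2 := a2 w (by simp)
    rw [show laplacian lattice (zipperSign diagonalZipper) (GZ u) w = _ from e1,
      show laplacian lattice (zipperSign diagonalZipper) (GZ u.swap) w = _ from e2, sub_self]
  · refine (abs_sub _ _).trans (add_le_add ((abs_add_le _ _).trans (add_le_add (b1 w) (b2 w)))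
      ((abs_add_le _ _).trans (add_le_add (b3 w) (b4 w))))

lemma GZ_zero_eq_GD (v : ℤ × ℤ) : GZ 0 v = GD 0 v := by
  have := GZ_add_swap zero_notMem_slit v
  rw [show (0 : ℤ × ℤ).swap = 0 from rfl] at this
  linarith

lemma GZ_zero (v : ℤ × ℤ) : GZ 0 v = halfGreen (v.1 + v.2) (v.2 - v.1).natAbs / 2 := by
  rw [GZ_zero_eq_GD, GD_zero]

lemma GZ_zero_zero : GZ 0 0 = 1 / 2 := by
  have := halfGreen_even 0
  rw [axisVal_zero] at this
  have h : halfGreen 0 0 = 1 := by simpa using this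
  rw [GZ_zero]; simp [h]

lemma halfGreen_zero_two : halfGreen 0 2 = √2 - 1 := by
  have h1 := halfGreen_column 0
  have h2 := halfGreen_even 0
  rw [axisVal_zero] at h1 h2
  simp only [Nat.cast_zero, mul_zero, zero_add, mul_one] at h1 h2
  linarith

lemma GZ_zero_left : GZ 0 (-1, 0) = (√2 - 1) / 2 := by
  have := halfGreen_neg_one 0
  rw [GZ_zero, ← halfGreen_zero_two]
  simpa using this

/-! ### Values at the corners of the end face -/

/-- An oriented edge of a face determines the isometry. The eight oriented edges correspond to the
eight elements of the symmetry group of the square. -/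
lemma exists_frame {f p q : ℤ × ℤ} (h : s(p, q) ∈ faceEdges f) : ∃ φ : lattice ≃g lattice,
    φ '' faceCorners f = faceCorners (-1, -1) ∧ φ p = 0 ∧ φ q = (-1, 0) := by
  have himg : ∀ d n hdn, (∀ w, (frameIso p d n hdn).symm w ∈ faceCorners f ↔
      w ∈ faceCorners (-1, -1)) →
      frameIso p d n hdn '' faceCorners f = faceCorners (-1, -1) := by
    intro d n hdn h
    ext w
    rw [← h w]
    constructor
    · rintro ⟨x, hx, rfl⟩
      rwa [RelIso.symm_apply_apply]
    · exact fun h => ⟨_, h, RelIso.apply_symm_apply _ _⟩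
  have h0 : ∀ d n hdn, frameIso p d n hdn p = 0 := by
    intro d n hdn; simp [frameIso_apply]
  obtain ⟨a, b⟩ := f
  simp only [faceEdges, Set.mem_insert_iff, Set.mem_singleton_iff, Sym2.eq_iff,
    Prod.mk_add_mk] at h
  rcases h with (⟨rfl, rfl⟩ | ⟨rfl, rfl⟩) | (⟨rfl, rfl⟩ | ⟨rfl, rfl⟩) | (⟨rfl, rfl⟩ | ⟨rfl, rfl⟩) |
    (⟨rfl, rfl⟩ | ⟨rfl, rfl⟩)
  · refine ⟨frameIso _ (-1, 0) (0, -1) (by simp), himg _ _ _ fun w => ?_, h0 _ _ _,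
      by simp [frameIso_apply]⟩
    simp only [mem_faceCorners, frameIso_symm_apply]; omega
  · refine ⟨frameIso _ (1, 0) (0, -1) (by simp), himg _ _ _ fun w => ?_, h0 _ _ _,
      by simp [frameIso_apply]⟩
    simp only [mem_faceCorners, frameIso_symm_apply]; omega
  · refine ⟨frameIso _ (0, -1) (1, 0) (by simp), himg _ _ _ fun w => ?_, h0 _ _ _,
      by simp [frameIso_apply]⟩
    simp only [mem_faceCorners, frameIso_symm_apply]; omega
  · refine ⟨frameIso _ (0, 1) (1, 0) (by simp), himg _ _ _ fun w => ?_, h0 _ _ _,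
      by simp [frameIso_apply]⟩
    simp only [mem_faceCorners, frameIso_symm_apply]; omega
  · refine ⟨frameIso _ (1, 0) (0, 1) (by simp), himg _ _ _ fun w => ?_, h0 _ _ _,
      by simp [frameIso_apply]⟩
    simp only [mem_faceCorners, frameIso_symm_apply]; omega
  · refine ⟨frameIso _ (-1, 0) (0, 1) (by simp), himg _ _ _ fun w => ?_, h0 _ _ _,
      by simp [frameIso_apply]⟩
    simp only [mem_faceCorners, frameIso_symm_apply]; omega
  · refine ⟨frameIso _ (0, 1) (-1, 0) (by simp), himg _ _ _ fun w => ?_, h0 _ _ _,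
      by simp [frameIso_apply]⟩
    simp only [mem_faceCorners, frameIso_symm_apply]; omega
  · refine ⟨frameIso _ (0, -1) (-1, 0) (by simp), himg _ _ _ fun w => ?_, h0 _ _ _,
      by simp [frameIso_apply]⟩
    simp only [mem_faceCorners, frameIso_symm_apply]; omega

/-- The values for the diagonal zipper are transported by `exists_frame`. The edge and its image
both lie off their zippers, so the gauge signs at `p` and `q` agree and the value at `(p, q)` keeps
its sign. -/
lemma greenZipper_corner {f p q : ℤ × ℤ} {Z : Set (Sym2 (ℤ × ℤ))} (hZ : IsZipper f Z)
    (h : s(p, q) ∈ faceEdges f) (he : s(p, q) ∉ Z) :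
    greenZipper Z p p = 1 / 2 ∧ greenZipper Z p q = (√2 - 1) / 2 := by
  obtain ⟨φ, hφ, hp, hq⟩ := exists_frame h
  obtain ⟨ε, h1, h2⟩ := exists_sign_greenZipper hZ isZipper_diagonalZipper hφ
  have hpp := h2 p p
  have hpq := h2 p q
  have hadj : lattice.Adj p q := faceEdges_subset f h
  have hε : ε p = ε q := by
    rw [h1 p q hadj, hp, hq]
    refine iff_of_false (fun h => ?_) he
    have : s((0 : ℤ × ℤ), (-1, 0)) = hEdge (-1, 0) := by simp [hEdge, Sym2.eq_swap, Prod.zero_eq_mk]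
    rw [this, hEdge_mem_diagonalZipper, mem_slit] at h
    simp at h
  rw [hp, Int.units_mul_self] at hpp
  rw [hp, hq, hε, Int.units_mul_self] at hpq
  have e1 := GZ_zero_zero
  have e2 := GZ_zero_left
  unfold GZ at e1 e2
  rw [e1] at hpp
  rw [e2] at hpq
  simp only [Units.val_one, Int.cast_one, one_mul] at hpp hpq
  exact ⟨hpp.symm, hpq.symm⟩

/-- Moving the endpoint of a zipper. -/
theorem greenZipper_move {f f' : ℤ × ℤ} {Z : Set (Sym2 (ℤ × ℤ))} {p q : ℤ × ℤ}
    (hZ : IsZipper f Z) (hne : f ≠ f') (hf : s(p, q) ∈ faceEdges f)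
    (hf' : s(p, q) ∈ faceEdges f') (he : s(p, q) ∉ Z) : IsZipper f' (insert s(p, q) Z) ∧
      ∀ u v, greenZipper (insert s(p, q) Z) u v = greenZipper Z u v +
        (2 * greenZipper Z u p - 2 * √2 * greenZipper Z u q) * greenZipper Z p v +
        (2 * greenZipper Z u q - 2 * √2 * greenZipper Z u p) * greenZipper Z q v := by
  have hZ' := isZipper_insert hZ hne hf hf' he
  obtain ⟨h1, h2⟩ := greenZipper_corner hZ hf he
  obtain ⟨h3, -⟩ := greenZipper_corner (p := q) (q := p) hZ (by rwa [Sym2.eq_swap])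
    (by rwa [Sym2.eq_swap])
  exact ⟨hZ', greenZipper_insert hZ hZ' (faceEdges_subset f hf) he h1 h3 h2⟩

/-! ### Primitive recursive functions with values in `ℚ[√2]` -/

section Computability

open Primrec Encodable

variable {α β : Type} [Primcodable α] [Primcodable β]

lemma encode_natCast (n : ℕ) : encode (n : ℤ) = 2 * n := rfl

lemma encode_negSucc (n : ℕ) : encode (Int.negSucc n) = 2 * n + 1 := rfl

lemma primrec_natCast : Primrec fun n : ℕ => (n : ℤ) :=
  ((Primrec.ofNat ℤ).comp nat_double).of_eq fun n => by
    rw [← encode_natCast, Denumerable.ofNat_encode]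

lemma primrec_negSucc : Primrec fun n : ℕ => Int.negSucc n :=
  ((Primrec.ofNat ℤ).comp nat_double_succ).of_eq fun n => by
    rw [← encode_negSucc, Denumerable.ofNat_encode]

lemma primrec_toNat : Primrec Int.toNat := by
  refine (Primrec.ite (c := fun z : ℤ => encode z % 2 = 0)
    (Primrec.eq.comp (nat_mod.comp Primrec.encode (Primrec.const 2)) (Primrec.const 0))
    (nat_div.comp Primrec.encode (Primrec.const 2)) (Primrec.const 0)).of_eq fun z => ?_
  rcases z with n | n
  · rw [Int.ofNat_eq_natCast, encode_natCast, if_pos (by omega)]; simp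
  · rw [encode_negSucc, if_neg (by omega)]; simp

lemma primrec_neg : Primrec fun z : ℤ => -z := by
  refine (Primrec.ite (c := fun z : ℤ => encode z % 2 = 0)
    (Primrec.eq.comp (nat_mod.comp Primrec.encode (Primrec.const 2)) (Primrec.const 0))
    (Primrec.ite (c := fun z : ℤ => z.toNat = 0)
      (Primrec.eq.comp primrec_toNat (Primrec.const 0)) (Primrec.const 0)
      (primrec_negSucc.comp (nat_sub.comp primrec_toNat (Primrec.const 1))))
    (primrec_natCast.comp (nat_add.comp (nat_div.comp Primrec.encode (Primrec.const 2))
      (Primrec.const 1)))).of_eq fun z => ?_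
  rcases z with n | n
  · rw [Int.ofNat_eq_natCast, encode_natCast, if_pos (by omega)]
    split_ifs with h
    · simp only [Int.toNat_natCast] at h; simp [h]
    · simp only [Int.toNat_natCast] at h ⊢; omega
  · rw [encode_negSucc, if_neg (by omega)]; omega

lemma primrec_natCast_sub : Primrec₂ fun m n : ℕ => (m : ℤ) - n := by
  refine (Primrec.ite (c := fun p : ℕ × ℕ => p.2 ≤ p.1)
    (nat_le.comp Primrec.snd Primrec.fst)
    (primrec_natCast.comp (nat_sub.comp Primrec.fst Primrec.snd))
    (primrec_neg.comp (primrec_natCast.comp (nat_sub.comp Primrec.snd Primrec.fst)))).of_eq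
    fun p => ?_
  change (if p.2 ≤ p.1 then _ else _) = (p.1 : ℤ) - p.2
  split_ifs <;> omega

lemma _root_.Primrec.int_neg {f : α → ℤ} (hf : Primrec f) : Primrec fun a => -f a := primrec_neg.comp hf

lemma _root_.Primrec.int_toNat {f : α → ℤ} (hf : Primrec f) : Primrec fun a => (f a).toNat :=
  primrec_toNat.comp hf

lemma _root_.Primrec.int_add {f g : α → ℤ} (hf : Primrec f) (hg : Primrec g) :
    Primrec fun a => f a + g a :=
  (primrec_natCast_sub.comp (nat_add.comp hf.int_toNat hg.int_toNat)
    (nat_add.comp hf.int_neg.int_toNat hg.int_neg.int_toNat)).of_eq fun a => by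
    push_cast; omega

lemma _root_.Primrec.int_sub {f g : α → ℤ} (hf : Primrec f) (hg : Primrec g) :
    Primrec fun a => f a - g a :=
  (hf.int_add hg.int_neg).of_eq fun _ => (sub_eq_add_neg _ _).symm

lemma _root_.Primrec.int_mul {f g : α → ℤ} (hf : Primrec f) (hg : Primrec g) :
    Primrec fun a => f a * g a :=
  (primrec_natCast_sub.comp
    (nat_add.comp (nat_mul.comp hf.int_toNat hg.int_toNat)
      (nat_mul.comp hf.int_neg.int_toNat hg.int_neg.int_toNat))
    (nat_add.comp (nat_mul.comp hf.int_toNat hg.int_neg.int_toNat)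
      (nat_mul.comp hf.int_neg.int_toNat hg.int_toNat))).of_eq fun a => by
    have h1 : f a = (f a).toNat - (-f a).toNat := by omega
    have h2 : g a = (g a).toNat - (-g a).toNat := by omega
    conv_rhs => rw [h1, h2]
    push_cast
    ring

lemma _root_.Primrec.int_natAbs {f : α → ℤ} (hf : Primrec f) : Primrec fun a => (f a).natAbs :=
  (nat_add.comp hf.int_toNat hf.int_neg.int_toNat).of_eq fun a => by omega

lemma primrecPred_int_le {f g : α → ℤ} (hf : Primrec f) (hg : Primrec g) :
    PrimrecPred fun a => f a ≤ g a :=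
  (Primrec.eq.comp (hf.int_sub hg).int_toNat (Primrec.const 0)).of_eq fun a => by omega

lemma primrecPred_int_eq {f g : α → ℤ} (hf : Primrec f) (hg : Primrec g) :
    PrimrecPred fun a => f a = g a := Primrec.eq.comp hf hg

/-- The number `(a + b √2) / (d + 1)`. -/
noncomputable def numVal (r : ℤ × ℤ × ℕ) : ℝ := (r.1 + r.2.1 * √2) / (r.2.2 + 1)

/-- Real valued functions with primitive recursive values in `ℚ[√2]`. -/
def Rep (F : α → ℝ) : Prop := ∃ f : α → ℤ × ℤ × ℕ, Primrec f ∧ ∀ a, numVal (f a) = F a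

lemma Rep.of_eq {F G : α → ℝ} (hF : Rep F) (h : ∀ a, F a = G a) : Rep G :=
  (funext h : F = G) ▸ hF

lemma Rep.comp {F : β → ℝ} (hF : Rep F) {g : α → β} (hg : Primrec g) : Rep fun a => F (g a) := by
  obtain ⟨f, hf, hF⟩ := hF
  exact ⟨fun a => f (g a), hf.comp hg, fun a => hF _⟩

lemma rep_int {f : α → ℤ} (hf : Primrec f) : Rep fun a => (f a : ℝ) :=
  ⟨fun a => (f a, 0, 0), hf.pair (Primrec.const _), fun a => by simp [numVal]⟩

lemma rep_const (n : ℤ) : Rep fun _ : α => (n : ℝ) := rep_int (Primrec.const n)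

lemma rep_half : Rep fun _ : α => (1 / 2 : ℝ) :=
  ⟨fun _ => (1, 0, 1), Primrec.const _, fun a => by simp [numVal]; norm_num⟩

lemma rep_sqrt_two : Rep fun _ : α => √2 :=
  ⟨fun _ => (0, 1, 0), Primrec.const _, fun a => by simp [numVal]⟩

/-- Addition of codes. -/
def numAdd (r t : ℤ × ℤ × ℕ) : ℤ × ℤ × ℕ :=
  (r.1 * (t.2.2 + 1) + t.1 * (r.2.2 + 1), r.2.1 * (t.2.2 + 1) + t.2.1 * (r.2.2 + 1),
    r.2.2 * t.2.2 + r.2.2 + t.2.2)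

/-- Multiplication of codes. -/
def numMul (r t : ℤ × ℤ × ℕ) : ℤ × ℤ × ℕ :=
  (r.1 * t.1 + 2 * (r.2.1 * t.2.1), r.1 * t.2.1 + r.2.1 * t.1,
    r.2.2 * t.2.2 + r.2.2 + t.2.2)

lemma numVal_numAdd (r t : ℤ × ℤ × ℕ) : numVal (numAdd r t) = numVal r + numVal t := by
  simp only [numVal, numAdd]
  have h1 : ((r.2.2 : ℝ) + 1) ≠ 0 := by positivity
  have h2 : ((t.2.2 : ℝ) + 1) ≠ 0 := by positivity
  have h3 : ((r.2.2 * t.2.2 + r.2.2 + t.2.2 : ℕ) : ℝ) + 1 = (r.2.2 + 1) * (t.2.2 + 1) := by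
    push_cast; ring
  rw [h3, div_add_div _ _ h1 h2]
  push_cast
  ring

lemma numVal_numMul (r t : ℤ × ℤ × ℕ) : numVal (numMul r t) = numVal r * numVal t := by
  simp only [numVal, numMul]
  have h3 : ((r.2.2 * t.2.2 + r.2.2 + t.2.2 : ℕ) : ℝ) + 1 = (r.2.2 + 1) * (t.2.2 + 1) := by
    push_cast; ring
  have h2 : √2 * √2 = 2 := Real.mul_self_sqrt (by norm_num)
  rw [h3, div_mul_div_comm]
  push_cast
  congr 1
  linear_combination (-(r.2.1 * t.2.1 : ℝ)) * h2

lemma primrec_num_den {f g : α → ℤ × ℤ × ℕ} (hf : Primrec f) (hg : Primrec g) :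
    Primrec fun a => (f a).2.2 * (g a).2.2 + (f a).2.2 + (g a).2.2 := by
  have f3 := Primrec.snd.comp (Primrec.snd.comp hf)
  have g3 := Primrec.snd.comp (Primrec.snd.comp hg)
  exact nat_add.comp (nat_add.comp (nat_mul.comp f3 g3) f3) g3

lemma primrec_numAdd {f g : α → ℤ × ℤ × ℕ} (hf : Primrec f) (hg : Primrec g) :
    Primrec fun a => numAdd (f a) (g a) := by
  have f1 := Primrec.fst.comp hf
  have g1 := Primrec.fst.comp hg
  have f2 := Primrec.fst.comp (Primrec.snd.comp hf)
  have g2 := Primrec.fst.comp (Primrec.snd.comp hg)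
  have f3 := (primrec_natCast.comp (Primrec.snd.comp (Primrec.snd.comp hf))).int_add
    (Primrec.const 1)
  have g3 := (primrec_natCast.comp (Primrec.snd.comp (Primrec.snd.comp hg))).int_add
    (Primrec.const 1)
  exact ((f1.int_mul g3).int_add (g1.int_mul f3)).pair
    (((f2.int_mul g3).int_add (g2.int_mul f3)).pair (primrec_num_den hf hg))

lemma primrec_numMul {f g : α → ℤ × ℤ × ℕ} (hf : Primrec f) (hg : Primrec g) :
    Primrec fun a => numMul (f a) (g a) := by
  have f1 := Primrec.fst.comp hf
  have g1 := Primrec.fst.comp hg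
  have f2 := Primrec.fst.comp (Primrec.snd.comp hf)
  have g2 := Primrec.fst.comp (Primrec.snd.comp hg)
  exact ((f1.int_mul g1).int_add ((Primrec.const 2).int_mul (f2.int_mul g2))).pair
    (((f1.int_mul g2).int_add (f2.int_mul g1)).pair (primrec_num_den hf hg))

lemma Rep.add {F G : α → ℝ} (hF : Rep F) (hG : Rep G) : Rep fun a => F a + G a := by
  obtain ⟨f, hf, hF⟩ := hF
  obtain ⟨g, hg, hG⟩ := hG
  exact ⟨_, primrec_numAdd hf hg, fun a => by rw [numVal_numAdd, hF, hG]⟩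

lemma Rep.mul {F G : α → ℝ} (hF : Rep F) (hG : Rep G) : Rep fun a => F a * G a := by
  obtain ⟨f, hf, hF⟩ := hF
  obtain ⟨g, hg, hG⟩ := hG
  exact ⟨_, primrec_numMul hf hg, fun a => by rw [numVal_numMul, hF, hG]⟩

lemma Rep.sub {F G : α → ℝ} (hF : Rep F) (hG : Rep G) : Rep fun a => F a - G a :=
  (hF.add ((rep_const (-1)).mul hG)).of_eq fun a => by push_cast; ring

lemma Rep.ite {c : α → Prop} [DecidablePred c] (hc : PrimrecPred c) {F G : α → ℝ} (hF : Rep F)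
    (hG : Rep G) : Rep fun a => if c a then F a else G a := by
  obtain ⟨f, hf, hF⟩ := hF
  obtain ⟨g, hg, hG⟩ := hG
  refine ⟨_, Primrec.ite hc hf hg, fun a => ?_⟩
  dsimp only
  split_ifs
  exacts [hF a, hG a]

lemma primrec_numSum : Primrec fun L : List (ℤ × ℤ × ℕ) => L.foldr numAdd (0, 0, 0) :=
  list_foldr Primrec.id (Primrec.const _)
    (primrec_numAdd (Primrec.fst.comp Primrec.snd) (Primrec.snd.comp Primrec.snd)).to₂

lemma numVal_numSum (L : List (ℤ × ℤ × ℕ)) :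
    numVal (L.foldr numAdd (0, 0, 0)) = (L.map numVal).sum := by
  induction L with
  | nil => simp [numVal]
  | cons r L ih => rw [List.foldr_cons, numVal_numAdd, ih, List.map_cons, List.sum_cons]

/-- Linear recursions along a primitive recursive measure. -/
theorem rep_of_rec {F B C₁ C₂ : α → ℝ} (hB : Rep B) (hC₁ : Rep C₁) (hC₂ : Rep C₂) {m : α → ℕ}
    {l₁ l₂ : α → List α} (hm : Primrec m) (hl₁ : Primrec l₁) (hl₂ : Primrec l₂)
    (h₁ : ∀ a, ∀ b ∈ l₁ a, m b < m a) (h₂ : ∀ a, ∀ b ∈ l₂ a, m b < m a)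
    (h : ∀ a, F a = B a + C₁ a * ((l₁ a).map F).sum + C₂ a * ((l₂ a).map F).sum) : Rep F := by
  obtain ⟨b, hb, hB⟩ := hB
  obtain ⟨c₁, hc₁, hC₁⟩ := hC₁
  obtain ⟨c₂, hc₂, hC₂⟩ := hC₂
  let sum : List (ℤ × ℤ × ℕ) → ℤ × ℤ × ℕ := fun L => L.foldr numAdd (0, 0, 0)
  -- The recursion principle supplies the earlier values in a single list; cutting it at the length
  -- of `l₁ a` recovers the two sums.
  let g : α → List (ℤ × ℤ × ℕ) → ℤ × ℤ × ℕ := fun a L =>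
    numAdd (numAdd (b a) (numMul (c₁ a) (sum (L.take (l₁ a).length))))
      (numMul (c₂ a) (sum (L.drop (l₁ a).length)))
  have hlen : Primrec fun p : α × List (ℤ × ℤ × ℕ) => (l₁ p.1).length :=
    list_length.comp (hl₁.comp Primrec.fst)
  have hg : Primrec₂ g := primrec_numAdd (primrec_numAdd (hb.comp Primrec.fst)
      (primrec_numMul (hc₁.comp Primrec.fst) (primrec_numSum.comp
        (list_take.comp hlen Primrec.snd))))
    (primrec_numMul (hc₂.comp Primrec.fst) (primrec_numSum.comp
        (list_drop.comp hlen Primrec.snd)))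
  have hord : ∀ a, ∀ x ∈ l₁ a ++ l₂ a, m x < m a := fun a x hx =>
    (List.mem_append.mp hx).elim (h₁ a x) (h₂ a x)
  -- The codes are first defined by well-founded recursion on `m`; `nat_omega_rec'` then shows that
  -- this function is primitive recursive.
  obtain ⟨f, hf⟩ : ∃ f : α → ℤ × ℤ × ℕ, ∀ a, f a = g a ((l₁ a ++ l₂ a).map f) := by
    let step : (a : α) → ((x : α) → m x < m a → ℤ × ℤ × ℕ) → ℤ × ℤ × ℕ := fun a rec =>
      g a ((l₁ a ++ l₂ a).attach.map fun x => rec x.1 (hord a x.1 x.2))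
    refine ⟨(measure m).wf.fix step, fun a => ?_⟩
    rw [WellFounded.fix_eq]
    change g a ((l₁ a ++ l₂ a).attach.map fun x => (measure m).wf.fix step x.1) = _
    rw [List.attach_map_val (l := l₁ a ++ l₂ a) (f := (measure m).wf.fix step)]
  refine ⟨f, nat_omega_rec' f (l := fun a => l₁ a ++ l₂ a) (g := fun a L => some (g a L)) hm
    (list_append.comp hl₁ hl₂) (option_some.comp hg) hord fun a => by rw [← hf], ?_⟩
  have key : ∀ n a, m a < n → numVal (f a) = F a := by
    intro n
    induction n with
    | zero => intro a ha; omega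
    | succ n ih =>
      intro a ha
      have e₁ : ((l₁ a).map f).map numVal = (l₁ a).map F := by
        rw [List.map_map]
        exact List.map_congr_left fun x hx => ih x (by have := h₁ a x hx; omega)
      have e₂ : ((l₂ a).map f).map numVal = (l₂ a).map F := by
        rw [List.map_map]
        exact List.map_congr_left fun x hx => ih x (by have := h₂ a x hx; omega)
      rw [hf a, h a]
      simp only [g, sum]
      rw [List.map_append, List.take_left' (by simp), List.drop_left' (by simp), numVal_numAdd,
        numVal_numAdd, numVal_numMul, numVal_numMul, numVal_numSum, numVal_numSum, e₁, e₂, hB,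
        hC₁, hC₂]
  exact fun a => key _ a (Nat.lt_succ_self _)

end Computability

/-! ### The algorithm for the zipper Green function -/

section Algorithm

open Primrec

variable {α β : Type} [Primcodable α] [Primcodable β]

lemma rep_axisVal : Rep axisVal := by
  -- The ratio `(2n - 1) / (2n)` of consecutive values, coded with the denominator lowered by one.
  -- The truncated subtraction at `n = 0` is harmless, as the list of predecessors is empty there.
  have hC : Rep fun n : ℕ => ((2 * n - 1 : ℕ) : ℝ) / ((2 * n - 1 : ℕ) + 1) :=
    ⟨fun n => (((2 * n - 1 : ℕ) : ℤ), 0, 2 * n - 1),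
      have h : Primrec fun n : ℕ => 2 * n - 1 := nat_sub.comp nat_double (Primrec.const 1)
      (primrec_natCast.comp h).pair ((Primrec.const 0).pair h), fun n => by simp [numVal]⟩
  refine rep_of_rec (B := fun n : ℕ => if n = 0 then ((1 : ℤ) : ℝ) else ((0 : ℤ) : ℝ))
    (m := id) (l₁ := fun n => if n = 0 then [] else [n - 1]) (l₂ := fun _ => [])
    (Rep.ite (Primrec.eq.comp Primrec.id (Primrec.const 0)) (rep_const 1) (rep_const 0)) hC
    (rep_const 0) Primrec.id
    (Primrec.ite (Primrec.eq.comp Primrec.id (Primrec.const 0)) (Primrec.const [])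
      (list_cons.comp (nat_sub.comp Primrec.id (Primrec.const 1)) (Primrec.const [])))
    (Primrec.const []) (fun a b hb => ?_) (fun a b hb => by simp at hb) fun n => ?_
  · split_ifs at hb with h
    · simp at hb
    · simp only [List.mem_singleton] at hb
      simp only [id]; omega
  · rcases n with _ | n
    · simp [axisVal_zero]
    · have := axisVal_succ n
      have h2 : (2 * (n + 1) - 1 : ℕ) = 2 * n + 1 := by omega
      rw [h2]
      simp
      field_simp
      linear_combination this

lemma primrecPred_parity : PrimrecPred fun p : ℤ × ℕ => (p.1.natAbs + p.2) % 2 = 0 :=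
  Primrec.eq.comp (nat_mod.comp (nat_add.comp Primrec.fst.int_natAbs Primrec.snd)
    (Primrec.const 2)) (Primrec.const 0)

/-- The step towards the vertical axis. -/
def axisStep (x : ℤ) : ℤ := if 0 ≤ x then 1 else -1

/-- The inhomogeneous terms in the recursion for `halfGreen`. -/
noncomputable def halfBase (p : ℤ × ℕ) : ℝ :=
  if p.2 = 0 then if 0 ≤ p.1 then axisVal (p.1.natAbs / 2) else 0
  else if p.2 = 1 then
    if p.1 = -1 then √2 - 1
    else if 0 ≤ p.1 then 2 * axisVal (p.1.natAbs / 2) - if p.1 = 1 then 1 else 0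
    else axisVal (p.1.natAbs / 2 - 1) - axisVal (p.1.natAbs / 2)
  else if p.1 = 0 ∨ p.1 = -1 then √2 * axisVal ((p.2 - 1) / 2) else 0

/-- The restriction of `halfGreen` to the even sublattice. -/
noncomputable def evenGreen (p : ℤ × ℕ) : ℝ :=
  if (p.1.natAbs + p.2) % 2 = 0 then halfGreen p.1 p.2 else 0

lemma rep_halfBase : Rep halfBase := by
  have px : Primrec fun p : ℤ × ℕ => p.1 := Primrec.fst
  have py : Primrec fun p : ℤ × ℕ => p.2 := Primrec.snd
  have h0 : Primrec fun _ : ℤ × ℕ => (0 : ℤ) := Primrec.const 0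
  have pk : Primrec fun p : ℤ × ℕ => p.1.natAbs / 2 :=
    nat_div.comp px.int_natAbs (Primrec.const 2)
  have ha := rep_axisVal.comp pk
  have h1 : Rep fun p : ℤ × ℕ => if p.1 = 1 then ((1 : ℤ) : ℝ) else ((0 : ℤ) : ℝ) :=
    Rep.ite (primrecPred_int_eq px (Primrec.const 1)) (rep_const 1) (rep_const 0)
  have h := Rep.ite (Primrec.eq.comp py (Primrec.const 0))
    (Rep.ite (primrecPred_int_le h0 px) ha (rep_const 0))
    (Rep.ite (Primrec.eq.comp py (Primrec.const 1))
      (Rep.ite (primrecPred_int_eq px (Primrec.const (-1))) (rep_sqrt_two.sub (rep_const 1))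
        (Rep.ite (primrecPred_int_le h0 px) (((rep_const 2).mul ha).sub h1)
          ((rep_axisVal.comp (nat_sub.comp pk (Primrec.const 1))).sub ha)))
      (Rep.ite ((primrecPred_int_eq px h0).or (primrecPred_int_eq px (Primrec.const (-1))))
        (rep_sqrt_two.mul (rep_axisVal.comp (nat_div.comp (nat_sub.comp py (Primrec.const 1))
          (Primrec.const 2)))) (rep_const 0)))
  refine h.of_eq fun p => ?_
  simp only [halfBase, Int.cast_one, Int.cast_zero, Int.cast_ofNat]

lemma primrec_axisStep : Primrec axisStep :=
  Primrec.ite (primrecPred_int_le (Primrec.const 0) Primrec.id) (Primrec.const 1)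
    (Primrec.const (-1))

lemma evenGreen_of_odd {x : ℤ} {y : ℕ} (h : ¬ (x.natAbs + y) % 2 = 0) : evenGreen (x, y) = 0 :=
  if_neg h

lemma evenGreen_of_even {x : ℤ} {y : ℕ} (h : (x.natAbs + y) % 2 = 0) :
    evenGreen (x, y) = halfGreen x y := if_pos h

lemma evenGreen_axis (x : ℤ) (h : x.natAbs % 2 = 0) : evenGreen (x, 0) = halfBase (x, 0) := by
  rw [evenGreen_of_even (by simpa using h)]
  simp only [halfBase, if_true]
  split_ifs with hx
  · rw [← halfGreen_even]; congr 1; omega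
  · rw [← halfGreen_neg (x.natAbs / 2) (by omega)]; congr 1; omega

/-- This is the boundary flux relation at `x - axisStep x`, solved for the outer of the two values
in the first row. On the negative side the flux is a difference of `axisVal`. -/
lemma evenGreen_one (x : ℤ) (h : (x.natAbs + 1) % 2 = 0) (h1 : x ≠ -1) :
    evenGreen (x, 1) = halfBase (x, 1) - evenGreen (x - 2 * axisStep x, 1) := by
  rw [evenGreen_of_even h, evenGreen_of_even (by unfold axisStep; split_ifs <;> omega)]
  simp only [halfBase, one_ne_zero, if_false, if_true, if_neg h1, axisStep]
  split_ifs with hx hx1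
  · subst hx1
    have := halfGreen_flux_nonneg 0
    rw [halfGreen_even] at this
    norm_num at this ⊢
    linarith
  · obtain ⟨k, hk⟩ : ∃ k : ℕ, x = 2 * k + 1 := ⟨x.natAbs / 2, by omega⟩
    have := halfGreen_flux_nonneg k
    rw [halfGreen_even, if_neg (by omega)] at this
    rw [show x.natAbs / 2 = k by omega, hk,
      show (2 * (k : ℤ) + 1 - 2 * 1) = 2 * k - 1 by ring]
    linarith
  · obtain ⟨k, hk⟩ : ∃ k : ℕ, x = -2 * (k + 1) - 1 := ⟨x.natAbs / 2 - 1, by omega⟩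
    have := halfGreen_flux_neg k
    have h3 := halfGreen_neg (k + 1) (by omega)
    push_cast at h3
    rw [h3] at this
    rw [show x.natAbs / 2 = k + 1 by omega, hk, Nat.add_sub_cancel,
      show (-2 * ((k : ℤ) + 1) - 1 - 2 * -1) = -2 * (k + 1) + 1 by ring]
    linarith

/-- By `halfGreen_neg_one` the column -1 repeats the column 0 shifted by one level, so both obey the
two-term recursion of `halfGreen_column`. -/
lemma evenGreen_column (x : ℤ) (y : ℕ) (h : (x.natAbs + (y + 2)) % 2 = 0) (hx : x = 0 ∨ x = -1) :
    evenGreen (x, y + 2) = halfBase (x, y + 2) - evenGreen (x, y) := by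
  rw [evenGreen_of_even h, evenGreen_of_even (by omega)]
  simp only [halfBase, if_neg (show y + 2 ≠ 0 by omega), if_neg (show y + 2 ≠ 1 by omega), if_pos hx]
  rcases hx with rfl | rfl
  · obtain ⟨k, rfl⟩ : ∃ k, y = 2 * k := ⟨y / 2, by simp at h; omega⟩
    have := halfGreen_column k
    rw [show (2 * k + 2 - 1) / 2 = k by omega]
    linarith
  · obtain ⟨k, rfl⟩ : ∃ k, y = 2 * k + 1 := ⟨y / 2, by simp at h; omega⟩
    have h1 := halfGreen_column (k + 1)
    have h2 := halfGreen_neg_one k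
    have h3 := halfGreen_neg_one (k + 1)
    rw [show (2 * k + 1 + 2 - 1) / 2 = k + 1 by omega, show 2 * k + 1 + 2 = 2 * (k + 1) + 1 by ring,
      h3, h2]
    rw [show 2 * (k + 1) = 2 * k + 2 by ring] at h1 ⊢
    linarith

/-- Harmonicity at `(x - axisStep x, y + 1)`, solved for the upper outer neighbor. The other four
points are nearer to the columns 0 and -1, or lie lower in the same column. -/
lemma evenGreen_bulk (x : ℤ) (y : ℕ) (h : (x.natAbs + (y + 2)) % 2 = 0)
    (hx : ¬ (x = 0 ∨ x = -1)) :
    evenGreen (x, y + 2) = 4 * evenGreen (x - axisStep x, y + 1) -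
      (evenGreen (x, y) + (evenGreen (x - 2 * axisStep x, y + 2) +
        evenGreen (x - 2 * axisStep x, y))) := by
  rw [evenGreen_of_even h, evenGreen_of_even (by unfold axisStep; split_ifs <;> omega),
    evenGreen_of_even (by omega), evenGreen_of_even (by unfold axisStep; split_ifs <;> omega),
    evenGreen_of_even (by unfold axisStep; split_ifs <;> omega)]
  unfold axisStep
  split_ifs
  · have := halfGreen_harmonic (x - 1) y
    rw [sub_add_cancel, show x - 1 - 1 = x - 2 * 1 by ring] at this
    linarith
  · have := halfGreen_harmonic (x + 1) y
    rw [add_sub_cancel_right, show x + 1 + 1 = x - 2 * -1 by ring] at this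
    rw [show x - -1 = x + 1 by ring]
    linarith

theorem rep_evenGreen : Rep evenGreen := by
  have px : Primrec fun p : ℤ × ℕ => p.1 := Primrec.fst
  have py : Primrec fun p : ℤ × ℕ => p.2 := Primrec.snd
  have h0 : Primrec fun _ : ℤ × ℕ => (0 : ℤ) := Primrec.const 0
  have hc : PrimrecPred fun p : ℤ × ℕ => p.1 = 0 ∨ p.1 = -1 :=
    (primrecPred_int_eq px h0).or (primrecPred_int_eq px (Primrec.const (-1)))
  have h1 : Primrec fun p : ℤ × ℕ => p.1 - axisStep p.1 := px.int_sub (primrec_axisStep.comp px)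
  have h2 : Primrec fun p : ℤ × ℕ => p.1 - 2 * axisStep p.1 :=
    px.int_sub ((Primrec.const 2).int_mul (primrec_axisStep.comp px))
  have y1 : Primrec fun p : ℤ × ℕ => p.2 - 1 := nat_sub.comp py (Primrec.const 1)
  have y2 : Primrec fun p : ℤ × ℕ => p.2 - 2 := nat_sub.comp py (Primrec.const 2)
  have hy0 : PrimrecPred fun p : ℤ × ℕ => p.2 = 0 := Primrec.eq.comp py (Primrec.const 0)
  have hy1 : PrimrecPred fun p : ℤ × ℕ => p.2 = 1 := Primrec.eq.comp py (Primrec.const 1)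
  have hn : Primrec fun _ : ℤ × ℕ => ([] : List (ℤ × ℕ)) := Primrec.const []
  -- The columns 0 and -1, where the recursion only descends, both have distance 0 in the measure;
  -- from 1 and -2 a double step lands on -1 and 0. Points with `x + y` odd get the value 0, and the
  -- recursion preserves this parity.
  refine rep_of_rec
    (B := fun p => if (p.1.natAbs + p.2) % 2 = 0 then halfBase p else ((0 : ℤ) : ℝ))
    (C₁ := fun _ => ((4 : ℤ) : ℝ)) (C₂ := fun _ => ((-1 : ℤ) : ℝ))
    (m := fun p => p.2 + 2 * (if 0 ≤ p.1 then p.1.natAbs else p.1.natAbs - 1))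
    (l₁ := fun p => if p.2 = 0 then [] else if p.2 = 1 then [] else if p.1 = 0 ∨ p.1 = -1 then []
      else [(p.1 - axisStep p.1, p.2 - 1)])
    (l₂ := fun p => if p.2 = 0 then [] else if p.1 = 0 ∨ p.1 = -1 then
        if p.2 = 1 then [] else [(p.1, p.2 - 2)]
      else if p.2 = 1 then [(p.1 - 2 * axisStep p.1, 1)]
      else [(p.1, p.2 - 2), (p.1 - 2 * axisStep p.1, p.2), (p.1 - 2 * axisStep p.1, p.2 - 2)])
    (Rep.ite primrecPred_parity rep_halfBase (rep_const 0)) (rep_const 4) (rep_const (-1))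
    (nat_add.comp py (nat_mul.comp (Primrec.const 2) (Primrec.ite (primrecPred_int_le h0 px)
      px.int_natAbs (nat_sub.comp px.int_natAbs (Primrec.const 1)))))
    (Primrec.ite hy0 hn (Primrec.ite hy1 hn (Primrec.ite hc hn
      (list_cons.comp (h1.pair y1) hn))))
    (Primrec.ite hy0 hn (Primrec.ite hc (Primrec.ite hy1 hn (list_cons.comp (px.pair y2) hn))
      (Primrec.ite hy1 (list_cons.comp (h2.pair (Primrec.const 1)) hn)
        (list_cons.comp (px.pair y2) (list_cons.comp (h2.pair py)
          (list_cons.comp (h2.pair y2) hn))))))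
    ?_ ?_ ?_
  · rintro ⟨x, y⟩ ⟨x', y'⟩ hb
    dsimp only at hb ⊢
    split_ifs at hb with a1 a2 a3
    · simp at hb
    · simp at hb
    · simp at hb
    · simp only [List.mem_singleton, Prod.mk.injEq, axisStep] at hb
      obtain ⟨rfl, rfl⟩ := hb
      split_ifs <;> omega
  · rintro ⟨x, y⟩ ⟨x', y'⟩ hb
    dsimp only at hb ⊢
    split_ifs at hb with a1 a2 a3 a4
    · simp at hb
    · simp at hb
    · simp only [List.mem_singleton, Prod.mk.injEq] at hb
      obtain ⟨rfl, rfl⟩ := hb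
      omega
    · simp only [List.mem_singleton, Prod.mk.injEq, axisStep] at hb
      obtain ⟨rfl, rfl⟩ := hb
      split_ifs <;> omega
    · simp only [List.mem_cons, List.not_mem_nil, or_false, Prod.mk.injEq, axisStep] at hb
      rcases hb with ⟨rfl, rfl⟩ | ⟨rfl, rfl⟩ | ⟨rfl, rfl⟩ <;> split_ifs <;> omega
  · rintro ⟨x, y⟩
    dsimp only
    by_cases hp : (x.natAbs + y) % 2 = 0
    · rw [if_pos hp]
      rcases y with _ | _ | y
      · simpa using evenGreen_axis x (by simpa using hp)
      · have hx0 : x ≠ 0 := by rintro rfl; simp at hp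
        by_cases hx1 : x = -1
        · subst hx1
          rw [evenGreen_of_even hp]
          have := halfGreen_neg_one 0
          simp only [mul_zero, zero_add, halfGreen_zero_two] at this
          simpa [halfBase] using this
        · have := evenGreen_one x hp hx1
          simp [hx0, hx1, this, sub_eq_add_neg]
      · by_cases hx : x = 0 ∨ x = -1
        · have := evenGreen_column x y hp hx
          simp [hx, this, sub_eq_add_neg]
        · have hb : halfBase (x, y + 1 + 1) = 0 := by simp [halfBase, hx]
          have := evenGreen_bulk x y hp hx
          simp only [hb, if_neg hx, if_neg (show y + 1 + 1 ≠ 0 by omega),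
            if_neg (show y + 1 + 1 ≠ 1 by omega), List.map_cons, List.map_nil, List.sum_cons,
            List.sum_nil, show y + 1 + 1 - 1 = y + 1 by omega, show y + 1 + 1 - 2 = y by omega]
          push_cast
          linarith
    · rw [if_neg hp, evenGreen_of_odd hp]
      have z1 : ∀ z : ℤ, z = x - axisStep x → evenGreen (z, y - 1) = 0 ∨ y = 0 := by
        rintro z rfl
        by_cases hy : y = 0
        · exact Or.inr hy
        · exact Or.inl (evenGreen_of_odd (by unfold axisStep; split_ifs <;> omega))
      have z2 : evenGreen (x - 2 * axisStep x, y) = 0 :=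
        evenGreen_of_odd (by unfold axisStep; split_ifs <;> omega)
      have z3 : 2 ≤ y → evenGreen (x - 2 * axisStep x, y - 2) = 0 := fun hy =>
        evenGreen_of_odd (by unfold axisStep; split_ifs <;> omega)
      have z4 : 2 ≤ y → evenGreen (x, y - 2) = 0 := fun hy => evenGreen_of_odd (by omega)
      split_ifs with a1 a2 a3 a4
      · simp
      · simp
      · subst a2; simp [z2]
      · simp [z4 (by omega)]
      · simp [z4 (by omega), z2, z3 (by omega), (z1 _ rfl).resolve_right a1]

end Algorithm

/-! ### Recursion in the first argument of the zipper Green function -/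

section Algorithm

open Primrec

lemma rep_GZ_zero : Rep (GZ 0) := by
  have p1 : Primrec fun v : ℤ × ℤ => v.1 := Primrec.fst
  have p2 : Primrec fun v : ℤ × ℤ => v.2 := Primrec.snd
  refine (rep_half.mul (rep_evenGreen.comp ((p1.int_add p2).pair
    (p2.int_sub p1).int_natAbs))).of_eq fun v => ?_
  rw [GZ_zero, evenGreen_of_even (by omega)]
  ring

/-- The sign of the gauge transformation that rotates the diagonal zipper by a quarter turn around
the center of its end face. -/
def turnSign (v : ℤ × ℤ) : ℤˣ := if v.1 ≤ v.2 ∧ v.2 ≤ -2 - v.1 then -1 else 1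

/-- The zipper and its rotated copy bound a wedge, on which the gauge sign is -1. The turn takes
`(0, -1)` to the origin and so gives the second row that occurs in `moveTerm`. -/
lemma GZ_turn (u v : ℤ × ℤ) : GZ (-1 - u.2, u.1) (-1 - v.2, v.1) =
    ((turnSign u * turnSign v : ℤˣ) : ℤ) * GZ u v := by
  have := greenZipper_map isZipper_diagonalZipper isZipper_diagonalZipper
    (frameIso (0, -1) (0, -1) (1, 0) (by simp)) turnSign ?_ u v
  · rw [frameIso_apply, frameIso_apply] at this
    unfold GZ
    rw [← this]
    congr 1 <;> (ext <;> ring)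
  intro v w h
  refine adj_cases (P := fun v w => turnSign v * turnSign w = edgeSign diagonalZipper s(v, w) *
    edgeSign diagonalZipper s(frameIso (0, -1) (0, -1) (1, 0) (by simp) v,
      frameIso (0, -1) (0, -1) (1, 0) (by simp) w)) ?_ ?_ ?_ h
  · intro v w h
    rw [mul_comm, h, Sym2.eq_swap (a := v), Sym2.eq_swap (a := frameIso _ _ _ _ v)]
  · rintro ⟨i, j⟩
    have e : s(frameIso (0, -1) (0, -1) (1, 0) (by simp) (i, j),
        frameIso (0, -1) (0, -1) (1, 0) (by simp) ((i, j) + (1, 0))) = vEdge (-1 - j, i) := by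
      simp only [frameIso_apply, vEdge, Prod.mk_add_mk, Sym2.eq_iff, Prod.mk.injEq]
      omega
    rw [e]
    change _ = edgeSign diagonalZipper (hEdge _) * _
    simp only [edgeSign, turnSign, hEdge_mem_diagonalZipper, vEdge_mem_diagonalZipper, mem_slit,
      Prod.mk_add_mk]
    split_ifs <;> first | rfl | omega
  · rintro ⟨i, j⟩
    have e : s(frameIso (0, -1) (0, -1) (1, 0) (by simp) (i, j),
        frameIso (0, -1) (0, -1) (1, 0) (by simp) ((i, j) + (0, 1))) = hEdge (-2 - j, i) := by
      simp only [frameIso_apply, hEdge, Prod.mk_add_mk, Sym2.eq_iff, Prod.mk.injEq]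
      omega
    rw [e]
    change _ = edgeSign diagonalZipper (vEdge _) * _
    simp only [edgeSign, turnSign, hEdge_mem_diagonalZipper, vEdge_mem_diagonalZipper, mem_slit,
      Prod.mk_add_mk]
    split_ifs <;> first | rfl | omega

/-- The sign of the gauge transformation for the translation of the diagonal zipper. -/
def shearSign (v : ℤ × ℤ) : ℤˣ := if v.1 = v.2 + 1 ∧ v.2 ≤ -1 then -1 else 1

/-- The rank-two correction for moving the endpoint of the zipper by one unit. -/
noncomputable def moveTerm (u v : ℤ × ℤ) : ℝ :=
  (2 * GZ 0 u - 2 * √2 * GZ (0, -1) u) * GZ 0 v + (2 * GZ (0, -1) u - 2 * √2 * GZ 0 u) * GZ (0, -1) v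

/-- The endpoint moves one face to the right across the edge from the origin to `(0, -1)`, and a
translation to the left brings it back. The moved zipper differs from the translated one by the
gauge sign -1 on the half-line of lattice points between them. -/
lemma GZ_shift (u v : ℤ × ℤ) : GZ (u.1 - 1, u.2) (v.1 - 1, v.2) =
    ((shearSign u * shearSign v : ℤˣ) : ℤ) * (GZ u v + moveTerm u v) := by
  have hf : s((0, 0), (0, -1)) ∈ faceEdges (-1, -1) := by
    simp [faceEdges]
  have hf' : s((0, 0), (0, -1)) ∈ faceEdges (0, -1) := by
    simp [faceEdges]
  have hmem : ∀ v : ℤ × ℤ, s(((0 : ℤ), (0 : ℤ)), (0, -1)) = vEdge v ↔ v = (0, -1) := by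
    rintro ⟨i, j⟩
    simp only [vEdge, Sym2.eq_iff, Prod.mk_add_mk, Prod.mk.injEq]
    omega
  have hmem' : ∀ v : ℤ × ℤ, s(((0 : ℤ), (0 : ℤ)), (0, -1)) ≠ hEdge v := by
    rintro ⟨i, j⟩
    simp only [hEdge, ne_eq, Sym2.eq_iff, Prod.mk_add_mk, Prod.mk.injEq]
    omega
  have he : s((0, 0), (0, -1)) ∉ diagonalZipper := by
    rw [(hmem (0, -1)).2 rfl, vEdge_mem_diagonalZipper, mem_slit]
    simp
  obtain ⟨hZ, hmove⟩ := greenZipper_move isZipper_diagonalZipper (by simp) hf hf' he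
  have := greenZipper_map hZ isZipper_diagonalZipper
    (frameIso (1, 0) (1, 0) (0, 1) (by simp)) shearSign ?_ u v
  · rw [frameIso_apply, frameIso_apply, hmove] at this
    have e : moveTerm u v = (2 * GZ u 0 - 2 * √2 * GZ u (0, -1)) * GZ 0 v +
        (2 * GZ u (0, -1) - 2 * √2 * GZ u 0) * GZ (0, -1) v := by
      rw [moveTerm, GZ_comm 0 u, GZ_comm (0, -1) u]
    rw [e, ← add_assoc]
    unfold GZ
    rw [show (0 : ℤ × ℤ) = (0, 0) from rfl, ← this]
    congr 1 <;> (ext <;> ring)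
  intro v w h
  refine adj_cases (P := fun v w => shearSign v * shearSign w =
    edgeSign (insert s((0, 0), (0, -1)) diagonalZipper) s(v, w) *
    edgeSign diagonalZipper s(frameIso (1, 0) (1, 0) (0, 1) (by simp) v,
      frameIso (1, 0) (1, 0) (0, 1) (by simp) w)) ?_ ?_ ?_ h
  · intro v w h
    rw [mul_comm, h, Sym2.eq_swap (a := v), Sym2.eq_swap (a := frameIso _ _ _ _ v)]
  · rintro ⟨i, j⟩
    have e : s(frameIso (1, 0) (1, 0) (0, 1) (by simp) (i, j),
        frameIso (1, 0) (1, 0) (0, 1) (by simp) ((i, j) + (1, 0))) = hEdge (i - 1, j) := by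
      simp only [frameIso_apply, hEdge, Prod.mk_add_mk, Sym2.eq_iff, Prod.mk.injEq]
      omega
    rw [e]
    change _ = edgeSign _ (hEdge _) * _
    simp only [edgeSign, shearSign, Set.mem_insert_iff, (hmem' _).symm, false_or,
      hEdge_mem_diagonalZipper, mem_slit, Prod.mk_add_mk]
    split_ifs <;> first | rfl | omega
  · rintro ⟨i, j⟩
    have e : s(frameIso (1, 0) (1, 0) (0, 1) (by simp) (i, j),
        frameIso (1, 0) (1, 0) (0, 1) (by simp) ((i, j) + (0, 1))) = vEdge (i - 1, j) := by
      simp only [frameIso_apply, vEdge, Prod.mk_add_mk, Sym2.eq_iff, Prod.mk.injEq]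
      omega
    rw [e]
    change _ = edgeSign _ (vEdge _) * _
    simp only [edgeSign, shearSign, Set.mem_insert_iff, eq_comm (a := vEdge (i, j)), hmem,
      vEdge_mem_diagonalZipper, mem_slit, Prod.mk_add_mk, Prod.mk.injEq]
    split_ifs <;> first | rfl | omega

variable {α : Type} [Primcodable α]

lemma rep_sign {c : α → Prop} [DecidablePred c] (hc : PrimrecPred c) :
    Rep fun a => (((if c a then -1 else 1 : ℤˣ) : ℤ) : ℝ) :=
  (Rep.ite hc (rep_const (-1)) (rep_const 1)).of_eq fun a => by split_ifs <;> simp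

lemma rep_turnSign : Rep fun v => ((turnSign v : ℤ) : ℝ) :=
  rep_sign ((primrecPred_int_le Primrec.fst Primrec.snd).and
    (primrecPred_int_le Primrec.snd ((Primrec.const (-2)).int_sub Primrec.fst)))

lemma rep_shearSign : Rep fun v => ((shearSign v : ℤ) : ℝ) :=
  rep_sign ((primrecPred_int_eq Primrec.fst (Primrec.snd.int_add (Primrec.const 1))).and
    (primrecPred_int_le Primrec.snd (Primrec.const (-1))))

lemma rep_slitSign : Rep fun v => ((slitSign v : ℤ) : ℝ) := by
  have := rep_sign (c := fun v : ℤ × ℤ => v.1 = v.2 ∧ v.2 ≤ -1)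
    ((primrecPred_int_eq Primrec.fst Primrec.snd).and
      (primrecPred_int_le Primrec.snd (Primrec.const (-1))))
  refine this.of_eq fun v => ?_
  simp only [slitSign, mem_slit]
  congr 2
  apply if_congr _ rfl rfl
  omega

lemma rep_GZ_below : Rep (GZ (0, -1)) := by
  have h := rep_turnSign.mul (rep_GZ_zero.comp
    (((Primrec.const (-1)).int_sub Primrec.snd).pair Primrec.fst))
  refine h.of_eq fun v => ?_
  have := GZ_turn (0, -1) v
  have h1 : turnSign (0, -1) = 1 := by simp [turnSign]
  rw [h1, one_mul] at this
  simp only [sub_neg_eq_add, neg_add_cancel] at this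
  rw [show (0 : ℤ × ℤ) = (0, 0) from rfl, this, ← mul_assoc]
  rcases Int.units_eq_one_or (turnSign v) with h | h <;> simp [h]

lemma rep_moveTerm : Rep fun p : (ℤ × ℤ) × ℤ × ℤ => moveTerm p.1 p.2 := by
  have a1 := rep_GZ_zero.comp (Primrec.fst (α := ℤ × ℤ) (β := ℤ × ℤ))
  have a2 := rep_GZ_zero.comp (Primrec.snd (α := ℤ × ℤ) (β := ℤ × ℤ))
  have b1 := rep_GZ_below.comp (Primrec.fst (α := ℤ × ℤ) (β := ℤ × ℤ))
  have b2 := rep_GZ_below.comp (Primrec.snd (α := ℤ × ℤ) (β := ℤ × ℤ))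
  have h2 : Rep fun _ : (ℤ × ℤ) × ℤ × ℤ => ((2 : ℤ) : ℝ) := rep_const 2
  have hs : Rep fun _ : (ℤ × ℤ) × ℤ × ℤ => √2 := rep_sqrt_two
  refine ((((h2.mul a1).sub ((h2.mul hs).mul b1)).mul a2).add
    (((h2.mul b1).sub ((h2.mul hs).mul a1)).mul b2)).of_eq fun p => ?_
  simp only [moveTerm, Int.cast_ofNat]

/-- The pair of points at which the recursion for `GZ` continues. -/
def movePair (p : (ℤ × ℤ) × ℤ × ℤ) : (ℤ × ℤ) × ℤ × ℤ :=
  if p.1.1 = 0 then (p.1.swap, p.2.swap)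
  else if 0 ≤ p.1.1 then ((p.1.1 - 1, p.1.2), (p.2.1 - 1, p.2.2))
  else ((p.1.1 + 1, p.1.2), (p.2.1 + 1, p.2.2))

/-- Shifts bring the first coordinate of `u` to 0, the reflection then makes the second coordinate
the first, and so on until `u = 0`. The measure `2 |u.1| + 3 |u.2|` drops in both kinds of move. For
positive `u.1`, `GZ_shift` is solved for its right-hand side; for negative `u.1` it is read from
left to right at the shifted pair. -/
theorem rep_GZ : Rep fun p : (ℤ × ℤ) × ℤ × ℤ => GZ p.1 p.2 := by
  have p1 : Primrec fun p : (ℤ × ℤ) × ℤ × ℤ => p.1 := Primrec.fst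
  have p2 : Primrec fun p : (ℤ × ℤ) × ℤ × ℤ => p.2 := Primrec.snd
  have p11 := Primrec.fst.comp p1
  have p12 := Primrec.snd.comp p1
  have p21 := Primrec.fst.comp p2
  have p22 := Primrec.snd.comp p2
  have c0 : Primrec fun _ : (ℤ × ℤ) × ℤ × ℤ => (0 : ℤ) := Primrec.const 0
  have c1 : Primrec fun _ : (ℤ × ℤ) × ℤ × ℤ => (1 : ℤ) := Primrec.const 1
  have hc0 := primrecPred_int_eq p11 c0
  have hc1 := primrecPred_int_le c0 p11
  have hpair : Primrec movePair := Primrec.ite hc0 ((p12.pair p11).pair (p22.pair p21))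
    (Primrec.ite hc1 (((p11.int_sub c1).pair p12).pair ((p21.int_sub c1).pair p22))
      (((p11.int_add c1).pair p12).pair ((p21.int_add c1).pair p22)))
  have hB : Rep fun p : (ℤ × ℤ) × ℤ × ℤ => if p.1.1 = 0 then
      if p.1.2 = 0 then GZ 0 p.2 else ((0 : ℤ) : ℝ)
    else if 0 ≤ p.1.1 then ((-1 : ℤ) : ℝ) * moveTerm p.1 p.2
    else ((shearSign (movePair p).1 : ℤ) : ℝ) * ((shearSign (movePair p).2 : ℤ) : ℝ) *
      moveTerm (movePair p).1 (movePair p).2 :=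
    Rep.ite hc0 (Rep.ite (primrecPred_int_eq p12 c0) (rep_GZ_zero.comp p2) (rep_const 0))
      (Rep.ite hc1 ((rep_const (-1)).mul rep_moveTerm)
        (((rep_shearSign.comp (p1.comp hpair)).mul (rep_shearSign.comp (p2.comp hpair))).mul
          (rep_moveTerm.comp hpair)))
  have hC : Rep fun p : (ℤ × ℤ) × ℤ × ℤ =>
      if p.1.1 = 0 then ((slitSign p.1 : ℤ) : ℝ) * ((slitSign p.2 : ℤ) : ℝ)
      else if 0 ≤ p.1.1 then ((shearSign p.1 : ℤ) : ℝ) * ((shearSign p.2 : ℤ) : ℝ)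
      else ((shearSign (movePair p).1 : ℤ) : ℝ) * ((shearSign (movePair p).2 : ℤ) : ℝ) :=
    Rep.ite hc0 ((rep_slitSign.comp p1).mul (rep_slitSign.comp p2))
      (Rep.ite hc1 ((rep_shearSign.comp p1).mul (rep_shearSign.comp p2))
        ((rep_shearSign.comp (p1.comp hpair)).mul (rep_shearSign.comp (p2.comp hpair))))
  have hsq : ∀ s : ℤˣ, ((s : ℤ) : ℝ) * ((s : ℤ) : ℝ) = 1 := fun s => by
    rcases Int.units_eq_one_or s with h | h <;> simp [h]
  refine rep_of_rec hB hC (rep_const 0) (m := fun p => 2 * p.1.1.natAbs + 3 * p.1.2.natAbs)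
    (l₁ := fun p => if p.1.1 = 0 ∧ p.1.2 = 0 then [] else [movePair p]) (l₂ := fun _ => [])
    (nat_add.comp (nat_mul.comp (Primrec.const 2) p11.int_natAbs)
      (nat_mul.comp (Primrec.const 3) p12.int_natAbs))
    (Primrec.ite (hc0.and (primrecPred_int_eq p12 c0)) (Primrec.const [])
      (list_cons.comp hpair (Primrec.const []))) (Primrec.const [])
    ?_ (fun a b hb => by simp at hb) ?_
  · rintro ⟨⟨i, j⟩, v⟩ b hb
    dsimp only at hb
    split_ifs at hb with h
    · simp at hb
    · simp only [List.mem_singleton, movePair] at hb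
      subst hb
      dsimp only at h ⊢
      split_ifs <;> simp only [Prod.swap] <;> omega
  · rintro ⟨⟨i, j⟩, v⟩
    dsimp only
    by_cases hi : i = 0
    · subst hi
      by_cases hj : j = 0
      · subst hj
        simp [show (0 : ℤ × ℤ) = (0, 0) from rfl]
      · have := GZ_swap (0, j) v
        push_cast at this
        simp only [hj, movePair, if_true, and_false, if_false, List.map_cons, List.map_nil,
          List.sum_cons, List.sum_nil, add_zero, this, Int.cast_zero, mul_zero, zero_add]
        linear_combination (-GZ (0, j) v * (((slitSign v : ℤ) : ℝ) * ((slitSign v : ℤ) : ℝ))) *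
          hsq (slitSign (0, j)) - GZ (0, j) v * hsq (slitSign v)
    · by_cases hi' : 0 ≤ i
      · have := GZ_shift (i, j) v
        push_cast at this
        simp only [hi, hi', movePair, if_true, false_and, if_false, List.map_cons, List.map_nil,
          List.sum_cons, List.sum_nil, add_zero, this, Int.cast_zero, mul_zero]
        push_cast
        linear_combination (-(GZ (i, j) v + moveTerm (i, j) v) *
          (((shearSign v : ℤ) : ℝ) * ((shearSign v : ℤ) : ℝ))) *
          hsq (shearSign (i, j)) - (GZ (i, j) v + moveTerm (i, j) v) * hsq (shearSign v)
      · have := GZ_shift (i + 1, j) (v.1 + 1, v.2)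
        simp only [add_sub_cancel_right] at this
        push_cast at this
        simp only [hi, hi', movePair, false_and, if_false, List.map_cons, List.map_nil,
          List.sum_cons, List.sum_nil, add_zero, this, Int.cast_zero, mul_zero]
        ring

theorem exists_computable_GZ : ∃ (a b : (ℤ × ℤ) × (ℤ × ℤ) → ℤ) (d : (ℤ × ℤ) × (ℤ × ℤ) → ℕ),
    Computable a ∧ Computable b ∧ Computable d ∧
      ∀ u v, 0 < d (u, v) ∧ GZ u v = (a (u, v) + b (u, v) * √2) / d (u, v) := by
  obtain ⟨f, hf, h⟩ := rep_GZ
  refine ⟨fun p => (f p).1, fun p => (f p).2.1, fun p => (f p).2.2 + 1,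
    (Primrec.fst.comp hf).to_comp, (Primrec.fst.comp (Primrec.snd.comp hf)).to_comp,
    (Primrec.succ.comp (Primrec.snd.comp (Primrec.snd.comp hf))).to_comp,
    fun u v => ⟨Nat.succ_pos _, ?_⟩⟩
  have := h (u, v)
  dsimp only at this ⊢
  rw [← this, numVal]
  push_cast
  rfl

end Algorithm

/-! ### The potential kernel in rotated coordinates -/

section PotentialKernel

open Complex MeasureTheory intervalIntegral
open scoped Real

/-- The integral of `kern x y` over the unit interval. -/
noncomputable def unitInt (x : ℤ) (y : ℕ) : ℂ := ∫ s in (0 : ℝ)..1, kern x y s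

/-- The increments of the potential kernel in the direction `(1, 1)`. -/
noncomputable def potStep (x : ℤ) (y : ℕ) : ℝ := (unitInt x y).re / π

lemma kern_integrable (x : ℤ) (y : ℕ) (a b : ℝ) : IntervalIntegrable (kern x y) volume a b :=
  (continuous_kern x y).intervalIntegrable _ _

/-- By `kern_conj` imaginary parts of `unitInt` are again increments. A complex identity for
`unitInt` thus yields two real ones for `potStep`. -/
lemma potStep_neg (x : ℤ) (y : ℕ) : potStep (-x - 1) y = (unitInt x y).im / π := by
  have h : (starRingEnd ℂ) (unitInt x y) = -I * unitInt (-x - 1) y := by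
    rw [unitInt, unitInt, ← intervalIntegral_conj, ← intervalIntegral.integral_const_mul]
    exact integral_congr fun s _ => kern_conj x y s
  have := congrArg im h
  simp only [conj_im, mul_im, neg_re, I_re, neg_zero, zero_mul, neg_im, I_im, zero_add] at this
  rw [potStep]
  congr 1
  linarith

/-- A discrete Cauchy-Riemann equation, equivalent to `rot_mul_one_sub`. After integration its real
part says that the increments are closed, so that they have a potential, and its imaginary part
gives the harmonicity of that potential. -/
lemma kern_closed (x : ℤ) (y : ℕ) (s : ℝ) :
    kern (x + 1) y s - I * kern (x + 1) (y + 1) s + I * kern x y s - kern x (y + 1) s = 0 := by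
  simp only [kern, mul_div_assoc', ← sub_div, ← add_div]
  rw [zpow_add_one₀ (rot_ne s), div_eq_zero_iff]
  left
  linear_combination (rot s ^ x * s ^ y) * rot_mul_one_sub s

lemma unitInt_closed (x : ℤ) (y : ℕ) :
    unitInt (x + 1) y - I * unitInt (x + 1) (y + 1) + I * unitInt x y - unitInt x (y + 1) = 0 := by
  simp only [unitInt, ← intervalIntegral.integral_const_mul]
  rw [← integral_sub (kern_integrable _ _ _ _) ((kern_integrable _ _ _ _).const_mul _),
    ← integral_add (((kern_integrable _ _ _ _).sub ((kern_integrable _ _ _ _).const_mul _)))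
      ((kern_integrable _ _ _ _).const_mul _),
    ← integral_sub ((((kern_integrable _ _ _ _).sub ((kern_integrable _ _ _ _).const_mul _))).add
      ((kern_integrable _ _ _ _).const_mul _)) (kern_integrable _ _ _ _)]
  simp only [kern_closed, intervalIntegral.integral_zero]

lemma potStep_closed (x : ℤ) (y : ℕ) :
    potStep (x + 1) y + potStep (-x - 2) (y + 1) = potStep (-x - 1) y + potStep x (y + 1) := by
  have := congrArg re (unitInt_closed x y)
  have h1 := potStep_neg x y
  have h2 := potStep_neg (x + 1) (y + 1)
  rw [show -(x + 1) - 1 = -x - 2 by ring] at h2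
  simp only [sub_re, add_re, mul_re, I_re, I_im, zero_mul, one_mul, zero_sub, zero_re] at this
  rw [h1, h2, potStep, potStep]
  field_simp
  linarith

lemma potStep_closed' (x : ℤ) (y : ℕ) :
    potStep (x + 1) (y + 1) + potStep (-x - 1) (y + 1) = potStep x y + potStep (-x - 2) y := by
  have := congrArg im (unitInt_closed x y)
  have h1 := potStep_neg x (y + 1)
  have h2 := potStep_neg (x + 1) y
  rw [show -(x + 1) - 1 = -x - 2 by ring] at h2
  simp only [sub_im, add_im, mul_im, I_re, I_im, zero_mul, one_mul, zero_add, zero_im] at this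
  rw [h1, h2, potStep, potStep]
  field_simp
  linarith

lemma rot_zero : rot 0 = -I := by simp [rot]

lemma rot_one : rot 1 = 1 := by
  have := one_sub_mul_I_ne 1
  rw [rot]
  push_cast at this ⊢
  rw [one_mul] at *
  exact div_self this

lemma integral_rot_zpow (n : ℤ) :
    ∫ s in (0 : ℝ)..1, (n * rot s ^ (n - 1) * (2 / (1 - s * I) ^ 2)) = 1 - (-I) ^ n := by
  rw [integral_eq_sub_of_hasDerivAt (fun s _ => hasDerivAt_rot_zpow n s), rot_one, rot_zero,
    one_zpow]
  refine Continuous.intervalIntegrable ?_ _ _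
  refine ((continuous_rot.zpow₀ _ fun s => Or.inl (rot_ne s)).const_mul _ |>.mul ?_)
  exact Continuous.div (by fun_prop) (by fun_prop) fun s => pow_ne_zero 2 (one_sub_mul_I_ne s)

lemma negI_zpow_even (k : ℤ) : (-I : ℂ) ^ (2 * k) = (-1) ^ k := by
  rw [zpow_mul]; congr 1; rw [zpow_ofNat]; simp

lemma re_neg_one_zpow (k : ℤ) : ((-1 : ℂ) ^ k).im = 0 := by
  have : ((-1 : ℂ) ^ k) = (((-1 : ℝ) ^ k : ℝ) : ℂ) := by push_cast; rfl
  rw [this, ofReal_im]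

/-- The right-hand side is the derivative of `rot s ^ (x + 1)`, so it integrates to boundary values
at `rot 0 = -I` and `rot 1 = 1`. -/
lemma kern_axis (x : ℤ) (s : ℝ) : (x + 1) * (kern x 0 s + I * kern (x + 1) 0 s) =
    ((x + 1 : ℤ) : ℂ) * rot s ^ (x + 1 - 1) * (2 / (1 - s * I) ^ 2) := by
  have h := one_sub_mul_I_ne s
  have h1 := rot_mul_one_sub s
  rw [kern, kern, zpow_add_one₀ (rot_ne s), add_sub_cancel_right]
  push_cast
  rw [pow_zero]
  field_simp
  linear_combination ((x + 1) * rot s ^ x) * (I * h1 - I_sq)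

/-- The integral is `1 - (-I) ^ (2 * k + 1)`, whose second term is purely imaginary; so its real
part is 1. This produces the reciprocals of odd numbers in `axisPot`. -/
lemma potStep_axis (k : ℤ) :
    (2 * k + 1) * (potStep (2 * k) 0 - potStep (-(2 * k) - 2) 0) = 1 / π := by
  have h : (((2 * k : ℤ) : ℂ) + 1) * (unitInt (2 * k) 0 + I * unitInt (2 * k + 1) 0) =
      1 - (-I) ^ (2 * k + 1) := by
    rw [← integral_rot_zpow, unitInt, unitInt, ← intervalIntegral.integral_const_mul,
      ← integral_add (kern_integrable _ _ _ _) ((kern_integrable _ _ _ _).const_mul _),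
      ← intervalIntegral.integral_const_mul]
    exact integral_congr fun s _ => kern_axis _ s
  have h2 := potStep_neg (2 * k + 1) 0
  rw [show -(2 * k + 1) - 1 = -(2 * k) - 2 by ring] at h2
  rw [zpow_add_one₀ (by simp), negI_zpow_even] at h
  have e : (((2 * k : ℤ) : ℂ) + 1) = ((2 * k + 1 : ℝ) : ℂ) := by push_cast; rfl
  rw [e] at h
  have := congrArg re h
  rw [re_ofReal_mul] at this
  simp only [add_re, mul_re, I_re, I_im, zero_mul, one_mul, zero_sub, sub_re, one_re, neg_re,
    neg_im, neg_zero, mul_zero, re_neg_one_zpow, sub_zero] at this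
  rw [h2, potStep, ← sub_div, mul_div_assoc', sub_eq_add_neg, this]

lemma kern_source (x : ℤ) (s : ℝ) : x * (kern x 0 s - I * kern (x - 1) 0 s) =
    -I * (x * rot s ^ (x - 1) * (2 / (1 - s * I) ^ 2)) := by
  have h := one_sub_mul_I_ne s
  have h1 := rot_mul_one_sub s
  have h2 : rot s ^ x = rot s ^ (x - 1) * rot s := by
    rw [← zpow_add_one₀ (rot_ne s), sub_add_cancel]
  rw [kern, kern, h2, pow_zero]
  field_simp
  linear_combination (x * rot s ^ (x - 1)) * (h1 + s * I_sq)

lemma potStep_source (k : ℤ) (hk : k ≠ 0) : potStep (2 * k) 0 + potStep (-(2 * k)) 0 = 0 := by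
  have h : ((2 * k : ℤ) : ℂ) * (unitInt (2 * k) 0 - I * unitInt (2 * k - 1) 0) =
      -I * (1 - (-I) ^ (2 * k)) := by
    rw [← integral_rot_zpow, unitInt, unitInt, ← intervalIntegral.integral_const_mul,
      ← integral_sub (kern_integrable _ _ _ _) ((kern_integrable _ _ _ _).const_mul _),
      ← intervalIntegral.integral_const_mul, ← intervalIntegral.integral_const_mul]
    exact integral_congr fun s _ => kern_source _ s
  have h2 := potStep_neg (2 * k - 1) 0
  rw [show -(2 * k - 1) - 1 = -(2 * k) by ring] at h2
  rw [negI_zpow_even] at h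
  have e : ((2 * k : ℤ) : ℂ) = ((2 * k : ℝ) : ℂ) := by push_cast; rfl
  rw [e] at h
  have := congrArg re h
  rw [re_ofReal_mul] at this
  simp only [mul_re, I_re, I_im, zero_mul, one_mul, zero_sub, sub_re, neg_re, sub_im, one_im,
    neg_im, neg_zero, re_neg_one_zpow, mul_zero, sub_zero, sub_neg_eq_add] at this
  have hk' : (2 * k : ℝ) ≠ 0 := by
    have : (k : ℝ) ≠ 0 := by exact_mod_cast hk
    simpa using this
  rw [h2, potStep, ← add_div, (mul_eq_zero.mp this).resolve_left hk', zero_div]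

lemma potStep_zero : potStep 0 0 = 1 / 4 := by
  have h : (unitInt 0 0).re = π / 4 := by
    have := reCLM.intervalIntegral_comp_comm (kern_integrable 0 0 0 1)
    simp only [reCLM_apply] at this
    rw [unitInt, ← this]
    have e : ∀ s : ℝ, (kern 0 0 s).re = 1 / (1 + s ^ 2) := fun s => by
      rw [kern, zpow_zero, pow_zero, one_mul, one_div, inv_re]
      simp [normSq_apply, sq]
    simp only [e, integral_one_div_one_add_sq, Real.arctan_one, Real.arctan_zero, sub_zero]
  rw [potStep, h]
  field_simp

lemma potStep_column (y : ℕ) :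
    potStep 0 y + potStep (-1) (y + 1) = 1 / (π * (y + 1)) := by
  have h2 := potStep_neg 0 (y + 1)
  rw [show -(0 : ℤ) - 1 = -1 by ring] at h2
  have h : unitInt 0 y - I * unitInt 0 (y + 1) = ((1 / (y + 1) : ℝ) : ℂ) := by
    rw [unitInt, unitInt, ← intervalIntegral.integral_const_mul,
      ← integral_sub (kern_integrable _ _ _ _) ((kern_integrable _ _ _ _).const_mul _)]
    have e : ∀ s : ℝ, kern 0 y s - I * kern 0 (y + 1) s = ((s ^ y : ℝ) : ℂ) := fun s => by
      have h := one_sub_mul_I_ne s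
      rw [kern, kern, zpow_zero]
      push_cast
      field_simp
      ring
    simp only [e]
    rw [intervalIntegral.integral_ofReal, integral_pow]
    simp
  have := congrArg re h
  simp only [sub_re, mul_re, I_re, I_im, zero_mul, one_mul, zero_sub, ofReal_re,
    sub_neg_eq_add] at this
  rw [h2, potStep, ← add_div, this]
  field_simp

lemma norm_unitInt_le (x : ℤ) (y : ℕ) : ‖unitInt x y‖ * (y + 1) ≤ 1 := by
  have h : ‖unitInt x y‖ ≤ ∫ s in (0 : ℝ)..1, s ^ y := by
    refine intervalIntegral.norm_integral_le_of_norm_le zero_le_one ?_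
      ((continuous_pow y).intervalIntegrable _ _)
    refine Filter.Eventually.of_forall fun s hs => (norm_kern_le x y s).trans_eq ?_
    rw [abs_of_pos hs.1]
  rw [integral_pow] at h
  simp only [one_pow, ne_eq, Nat.add_eq_zero_iff, one_ne_zero, and_false, not_false_eq_true,
    zero_pow, sub_zero] at h
  rwa [le_div_iff₀ (by positivity)] at h

/-- Integration by parts against the oscillating factor `rot s ^ x`. The boundary terms are at most
2 and 1 and the remainder is at most 3, together 6 for twice the left-hand side. -/
lemma norm_unitInt_le' (x : ℤ) (y : ℕ) : ‖unitInt x y‖ * |(x : ℝ)| ≤ 3 := by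
  let R : ℝ → ℂ := fun s => rot s ^ x * (y * s ^ (y - 1) * (1 + s * I) + s ^ y * I)
  have hR : Continuous R := (continuous_rot.zpow₀ x fun s => Or.inl (rot_ne s)).mul (by fun_prop)
  have hd : ∀ s : ℝ, HasDerivAt (fun s : ℝ => rot s ^ x * ((s : ℂ) ^ y * (1 + s * I)))
      (2 * I * x * kern x y s + R s) s := by
    intro s
    have h1 : HasDerivAt (fun s : ℝ => (s : ℂ) ^ y) (y * (s : ℂ) ^ (y - 1)) s := by
      simpa using (ofRealCLM.hasDerivAt (x := s)).fun_pow y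
    have h2 : HasDerivAt (fun s : ℝ => (1 + s * I : ℂ)) I s := by
      simpa using ((ofRealCLM.hasDerivAt (x := s)).mul_const I).const_add 1
    refine ((hasDerivAt_rot_zpow x s).mul (h1.mul h2)).congr_deriv ?_
    have h := one_sub_mul_I_ne s
    have h3 := rot_mul_one_sub s
    have h4 := rot_ne s
    simp only [R, kern, zpow_sub_one₀ h4, Pi.mul_apply]
    field_simp
    linear_combination (-(2 * I * x) * (s : ℂ) ^ y) * h3 + (2 * x * (s : ℂ) ^ y) * I_sq
  have hint := integral_eq_sub_of_hasDerivAt (a := 0) (b := 1) (fun s _ => hd s)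
    ((((continuous_kern x y).const_mul _).add hR).intervalIntegrable _ _)
  rw [integral_add ((kern_integrable _ _ _ _).const_mul _) (hR.intervalIntegrable _ _),
    intervalIntegral.integral_const_mul] at hint
  change 2 * I * x * unitInt x y + _ = _ at hint
  have hb : ‖∫ s in (0 : ℝ)..1, R s‖ ≤ 3 := by
    have hb1 : ‖∫ s in (0 : ℝ)..1, R s‖ ≤
        ∫ s in (0 : ℝ)..1, ((2 * (y * s ^ (y - 1)) + s ^ y : ℝ)) := by
      refine intervalIntegral.norm_integral_le_of_norm_le zero_le_one ?_
        (Continuous.intervalIntegrable (by fun_prop) _ _)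
      refine Filter.Eventually.of_forall fun s hs => ?_
      have hs0 : |s| = s := abs_of_pos hs.1
      have hn : ‖(1 + s * I : ℂ)‖ ≤ 2 := by
        refine (norm_add_le _ _).trans ?_
        simp only [norm_one, norm_mul, norm_real, Real.norm_eq_abs, norm_I, mul_one, hs0]
        linarith [hs.2]
      have hp : 0 ≤ (y : ℝ) * s ^ (y - 1) := mul_nonneg (by positivity) (pow_nonneg hs.1.le _)
      simp only [R]
      rw [norm_mul, norm_zpow, norm_rot, one_zpow, one_mul]
      refine (norm_add_le _ _).trans ?_
      simp only [norm_mul, norm_pow, norm_real, Real.norm_eq_abs, hs0, norm_I, mul_one, Complex.norm_natCast]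
      nlinarith
    refine hb1.trans ?_
    rw [integral_add (Continuous.intervalIntegrable (by fun_prop) _ _)
      (Continuous.intervalIntegrable (by fun_prop) _ _), intervalIntegral.integral_const_mul,
      intervalIntegral.integral_const_mul, integral_pow, integral_pow]
    have h1 : (y : ℝ) * ((1 ^ (y - 1 + 1) - 0 ^ (y - 1 + 1)) / ((y - 1 : ℕ) + 1)) ≤ 1 := by
      rcases y with _ | y
      · simp
      · simp; field_simp; exact le_rfl
    have h2 : ((1 : ℝ) ^ (y + 1) - 0 ^ (y + 1)) / (y + 1) ≤ 1 := by
      rw [div_le_one (by positivity)]; simp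
    linarith
  have hP1 : ‖rot 1 ^ x * (((1 : ℝ) : ℂ) ^ y * (1 + (1 : ℝ) * I))‖ ≤ 2 := by
    rw [norm_mul, norm_zpow, norm_rot, one_zpow, one_mul]
    push_cast
    rw [one_pow, one_mul, one_mul]
    refine (norm_add_le _ _).trans ?_
    simp; norm_num
  have hP0 : ‖rot 0 ^ x * (((0 : ℝ) : ℂ) ^ y * (1 + (0 : ℝ) * I))‖ ≤ 1 := by
    rw [norm_mul, norm_zpow, norm_rot, one_zpow, one_mul]
    push_cast
    rw [zero_mul, add_zero, mul_one, norm_pow, norm_zero]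
    exact pow_le_one₀ le_rfl zero_le_one
  have hn : ‖2 * I * x * unitInt x y‖ = 2 * (‖unitInt x y‖ * |(x : ℝ)|) := by
    simp only [norm_mul, norm_I, mul_one, norm_intCast, Complex.norm_ofNat]
    ring
  have : ‖2 * I * x * unitInt x y‖ ≤ 2 + 1 + 3 := by
    rw [eq_sub_of_add_eq hint]
    refine (norm_sub_le _ _).trans (add_le_add ((norm_sub_le _ _).trans (add_le_add hP1 hP0)) hb)
  linarith

lemma abs_potStep_le (x : ℤ) (y : ℕ) : |potStep x y| * (|(x : ℝ)| + y + 1) ≤ 2 := by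
  have h1 := norm_unitInt_le x y
  have h2 := norm_unitInt_le' x y
  have h3 := abs_re_le_norm (unitInt x y)
  have h4 := Real.pi_gt_three
  rw [potStep, abs_div, abs_of_pos Real.pi_pos, div_mul_eq_mul_div, div_le_iff₀ Real.pi_pos]
  have : |(unitInt x y).re| * (|(x : ℝ)| + y + 1) ≤ ‖unitInt x y‖ * (|(x : ℝ)| + y + 1) := by
    gcongr
  nlinarith

/-- The potential kernel on the axis. -/
noncomputable def axisPot (n : ℕ) : ℝ := ∑ j ∈ Finset.range n, 1 / (π * (2 * j + 1))

lemma axisPot_succ (n : ℕ) : axisPot (n + 1) = axisPot n + 1 / (π * (2 * n + 1)) :=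
  Finset.sum_range_succ _ _

/-- The potential kernel at the point with `i + j = x` and `j - i = ± y`. -/
noncomputable def potA : ℤ → ℕ → ℝ
  | x, 0 => axisPot (x.natAbs / 2)
  | x, y + 1 => potA (x - 1) y + potStep (x - 1) y

lemma potA_axis (k : ℕ) : potA (2 * k) 0 = axisPot k := by
  rw [potA]; congr 1; omega

lemma potA_up_right (x : ℤ) (y : ℕ) : potA (x + 1) (y + 1) = potA x y + potStep x y := by
  rw [potA, add_sub_cancel_right]

/-- `potA` is defined by summation along one diagonal direction. Closedness of the increments
propagates the rule for the other direction from row to row, starting from `potStep_axis`. Parity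
matters on the axis, where the halved index is meaningful only for even `x`. -/
lemma potA_up_left (x : ℤ) (y : ℕ) (h : Even (x + y)) :
    potA (x - 1) (y + 1) = potA x y + potStep (-x) y := by
  induction y generalizing x with
  | zero =>
    obtain ⟨k, hk⟩ := h
    obtain rfl : x = 2 * k := by push_cast at hk; omega
    have h1 := potStep_axis (k - 1)
    rw [show 2 * (k - 1) = 2 * k - 1 - 1 by ring, show -(2 * k - 1 - 1) - 2 = -(2 * k) by ring]
      at h1
    have hk : (2 * ((k - 1 : ℤ) : ℝ) + 1) ≠ 0 := by
      exact_mod_cast (by omega : 2 * (k - 1) + 1 ≠ 0)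
    have h2 : potStep (2 * k - 1 - 1) 0 - potStep (-(2 * k)) 0 =
        1 / (π * (2 * ((k - 1 : ℤ) : ℝ) + 1)) := by
      rw [eq_div_iff (mul_ne_zero Real.pi_ne_zero hk)]
      have := Real.pi_ne_zero
      field_simp at h1
      linarith
    rw [potA, potA, potA]
    rcases le_or_gt 1 k with h0 | h0
    · obtain ⟨n, rfl⟩ : ∃ n : ℕ, k = n + 1 := ⟨(k - 1).toNat, by omega⟩
      rw [show (2 * ((n : ℤ) + 1) - 1 - 1).natAbs / 2 = n by omega,
        show (2 * ((n : ℤ) + 1)).natAbs / 2 = n + 1 by omega, axisPot_succ]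
      push_cast at h2
      rw [add_sub_cancel_right] at h2
      linarith
    · obtain ⟨n, rfl⟩ : ∃ n : ℕ, k = -n := ⟨(-k).toNat, by omega⟩
      rw [show (2 * (-(n : ℤ)) - 1 - 1).natAbs / 2 = n + 1 by omega,
        show (2 * (-(n : ℤ))).natAbs / 2 = n by omega, axisPot_succ]
      have e : 1 / (π * (2 * ((-(n : ℤ) - 1 : ℤ) : ℝ) + 1)) = -(1 / (π * (2 * n + 1))) := by
        push_cast
        rw [← div_neg]
        congr 1
        ring
      rw [e] at h2
      linarith
  | succ y ih =>
    have h' : Even (x - 1 + y) := by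
      obtain ⟨r, hr⟩ := h
      exact ⟨r - 1, by push_cast at hr; omega⟩
    have h1 := ih (x - 1) h'
    have h2 := potStep_closed (x - 2) y
    rw [show x - 2 + 1 = x - 1 by ring, show -(x - 2) - 2 = -x by ring,
      show -(x - 2) - 1 = -(x - 1) by ring] at h2
    have h3 := potA_up_right (x - 2) (y + 1)
    have h4 := potA_up_right (x - 1) y
    rw [show x - 2 + 1 = x - 1 by ring] at h3
    rw [sub_add_cancel] at h4
    rw [show x - 1 - 1 = x - 2 by ring] at h1
    linarith

lemma potA_neg (x : ℤ) (y : ℕ) (h : Even (x + y)) : potA (-x) y = potA x y := by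
  cases y with
  | zero => rw [potA, potA, Int.natAbs_neg]
  | succ y =>
    have h' : Even (x + 1 + y) := by convert h using 1; push_cast; ring
    have h1 := potA_up_left (x + 1) y h'
    have h2 := potA_up_right (-x - 1) y
    have h3 : potA (-x - 1) y = potA (x + 1) y := by
      have ih := potA_neg (x + 1) y h'
      rw [← ih]; congr 1; ring
    rw [add_sub_cancel_right] at h1
    rw [sub_add_cancel] at h2
    rw [h1, h2, h3]
    congr 2; ring

lemma potA_harmonic (x : ℤ) (y : ℕ) (h : Even (x + (y + 1 : ℕ))) :
    4 * potA x (y + 1) = potA (x + 1) (y + 2) + potA (x - 1) (y + 2) + potA (x + 1) y +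
      potA (x - 1) y := by
  have h' : Even (x + 1 + y) := by convert h using 1; push_cast; ring
  have h1 := potA_up_right x (y + 1)
  have h2 := potA_up_left x (y + 1) h
  have h3 := potA_up_right (x - 1) y
  have h4 := potA_up_left (x + 1) y h'
  have h5 := potStep_closed' (x - 1) y
  rw [sub_add_cancel, show -(x - 1) - 1 = -x by ring, show -(x - 1) - 2 = -(x + 1) by ring] at h5
  rw [sub_add_cancel] at h3
  rw [add_sub_cancel_right] at h4
  linarith

lemma potA_source (k : ℤ) : 4 * potA (2 * k) 0 - 2 * potA (2 * k + 1) 1 - 2 * potA (2 * k - 1) 1 =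
    if k = 0 then -1 else 0 := by
  have h1 := potA_up_right (2 * k) 0
  have h2 := potA_up_left (2 * k) 0 (by simp)
  rw [zero_add] at h1 h2
  split_ifs with hk
  · subst hk
    have := potStep_zero
    simp only [mul_zero, neg_zero] at *
    linarith
  · have := potStep_source k hk
    linarith

lemma potA_column (k : ℕ) : potA 0 (2 * k) = axisPot k := by
  induction k with
  | zero => simp [potA]
  | succ k ih =>
    have h1 := potA_up_left 0 (2 * k) (by simp)
    have h2 := potA_up_right (-1) (2 * k + 1)
    have h3 := potStep_column (2 * k)
    rw [neg_add_cancel] at h2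
    rw [zero_sub, neg_zero] at h1
    rw [mul_add, mul_one, h2, h1, ih, axisPot_succ]
    push_cast at h3
    linarith

end PotentialKernel

/-! ### The potential kernel on the square lattice -/

/-- The potential kernel of the square lattice. -/
noncomputable def pot (v : ℤ × ℤ) : ℝ := potA (v.1 + v.2) (v.2 - v.1).natAbs

lemma even_add_natAbs (v : ℤ × ℤ) : Even (v.1 + v.2 + (v.2 - v.1).natAbs) := by
  rw [Int.even_iff]; omega

lemma pot_zero : pot 0 = 0 := by
  have := potA_axis 0
  simpa [pot, axisPot] using this

lemma pot_neg (v : ℤ × ℤ) : pot (-v) = pot v := by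
  rw [pot, pot, ← potA_neg _ _ (even_add_natAbs v)]
  simp only [Prod.fst_neg, Prod.snd_neg]
  congr 1
  · ring
  · omega

lemma pot_swap (v : ℤ × ℤ) : pot v.swap = pot v := by
  rw [pot, pot]
  congr 1
  · exact add_comm _ _
  · simp only [Prod.fst_swap, Prod.snd_swap]; omega

lemma laplacian_pot (v : ℤ × ℤ) : laplacian lattice 1 pot v = if v = 0 then -1 else 0 := by
  obtain ⟨i, j⟩ := v
  simp only [laplacian_lattice, Pi.one_apply, one_mul, Prod.mk_add_mk, add_zero, pot]
  rcases lt_trichotomy i j with h | h | h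
  · obtain ⟨n, rfl⟩ : ∃ n : ℕ, j = i + (n + 1) := ⟨(j - i - 1).natAbs, by omega⟩
    have := potA_harmonic (i + (i + (n + 1))) n (by rw [Int.even_iff]; omega)
    rw [if_neg (by simp [Prod.ext_iff]; omega),
      show (i + (n + 1) - i : ℤ).natAbs = n + 1 by omega,
      show (i + (n + 1) - (i + 1) : ℤ).natAbs = n by omega,
      show (i + (n + 1) - (i + -1) : ℤ).natAbs = n + 2 by omega,
      show (i + (n + 1) + 1 - i : ℤ).natAbs = n + 2 by omega,
      show (i + (n + 1) + -1 - i : ℤ).natAbs = n by omega,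
      show i + 1 + (i + (n + 1)) = i + (i + (n + 1 : ℤ)) + 1 by ring,
      show i + -1 + (i + (n + 1)) = i + (i + (n + 1 : ℤ)) - 1 by ring,
      show i + (i + (n + 1 : ℤ) + 1) = i + (i + (n + 1 : ℤ)) + 1 by ring,
      show i + (i + (n + 1 : ℤ) + -1) = i + (i + (n + 1 : ℤ)) - 1 by ring]
    linarith
  · subst h
    have := potA_source i
    rw [show (i - i : ℤ).natAbs = 0 by omega,
      show (i - (i + 1) : ℤ).natAbs = 1 by omega,
      show (i - (i + -1) : ℤ).natAbs = 1 by omega,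
      show (i + 1 - i : ℤ).natAbs = 1 by omega,
      show (i + -1 - i : ℤ).natAbs = 1 by omega,
      show (i : ℤ) + i = 2 * i by ring,
      show (i : ℤ) + 1 + i = 2 * i + 1 by ring,
      show (i : ℤ) + -1 + i = 2 * i - 1 by ring,
      show (i : ℤ) + (i + 1) = 2 * i + 1 by ring,
      show (i : ℤ) + (i + -1) = 2 * i - 1 by ring]
    have hk : (i, i) = 0 ↔ i = 0 := by simp [Prod.ext_iff]
    simp only [hk]
    rw [← this]; ring
  · obtain ⟨n, rfl⟩ : ∃ n : ℕ, i = j + (n + 1) := ⟨(i - j - 1).natAbs, by omega⟩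
    have := potA_harmonic (j + (n + 1) + j) n (by rw [Int.even_iff]; omega)
    rw [if_neg (by simp [Prod.ext_iff]; omega),
      show (j - (j + (n + 1)) : ℤ).natAbs = n + 1 by omega,
      show (j - (j + (n + 1) + 1) : ℤ).natAbs = n + 2 by omega,
      show (j - (j + (n + 1) + -1) : ℤ).natAbs = n by omega,
      show (j + 1 - (j + (n + 1)) : ℤ).natAbs = n by omega,
      show (j + -1 - (j + (n + 1)) : ℤ).natAbs = n + 2 by omega,
      show j + (n + 1) + 1 + j = (j + (n + 1 : ℤ)) + j + 1 by ring,
      show j + (n + 1) + -1 + j = (j + (n + 1 : ℤ)) + j - 1 by ring,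
      show j + (n + 1 : ℤ) + (j + 1) = (j + (n + 1 : ℤ)) + j + 1 by ring,
      show j + (n + 1 : ℤ) + (j + -1) = (j + (n + 1 : ℤ)) + j - 1 by ring]
    linarith

lemma laplacian_pot_sub (z v : ℤ × ℤ) :
    laplacian lattice 1 (fun w => pot (w - z)) v = if v = z then -1 else 0 := by
  have := laplacian_pot (v - z)
  simp only [sub_eq_zero] at this
  rw [← this]
  simp only [laplacian_lattice, Pi.one_apply, add_sub_right_comm]

/-- In rotated coordinates a unit step is a diagonal step, so the difference is `potStep` up to
sign, and `abs_potStep_le` gives its decay. Moving away from or towards the axis distinguishes the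
cases. -/
lemma abs_pot_sub_le (v : ℤ × ℤ) :
    |pot (v + (1, 0)) - pot v| * (supNorm v : ℝ) ≤ 2 ∧
    |pot (v + (0, 1)) - pot v| * (supNorm v : ℝ) ≤ 2 := by
  obtain ⟨i, j⟩ := v
  have key : ∀ (x : ℤ) (y : ℕ), supNorm (i, j) ≤ x.natAbs + y + 1 →
      |potStep x y| * (supNorm (i, j) : ℝ) ≤ 2 := by
    intro x y h
    refine le_trans ?_ (abs_potStep_le x y)
    have hx : |(x : ℝ)| = (x.natAbs : ℝ) := by rw [Nat.cast_natAbs, Int.cast_abs]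
    rw [hx]
    gcongr
    exact_mod_cast h
  simp only [pot, Prod.mk_add_mk, add_zero]
  constructor
  · rcases le_or_gt j i with h | h
    · have := potA_up_right (i + j) (j - i).natAbs
      rw [show i + 1 + j = i + j + 1 by ring, show (j - (i + 1)).natAbs = (j - i).natAbs + 1 by omega,
        this, add_sub_cancel_left]
      exact key _ _ (by simp only [supNorm]; omega)
    · have := potA_up_left (i + j + 1) (j - (i + 1)).natAbs (by rw [Int.even_iff]; omega)
      rw [show i + 1 + j = i + j + 1 by ring,
        show (j - i).natAbs = (j - (i + 1)).natAbs + 1 by omega]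
      rw [add_sub_cancel_right] at this
      rw [this, sub_add_cancel_left, abs_neg]
      exact key _ _ (by simp only [supNorm]; omega)
  · rcases le_or_gt i j with h | h
    · have := potA_up_right (i + j) (j - i).natAbs
      rw [show i + (j + 1) = i + j + 1 by ring,
        show (j + 1 - i).natAbs = (j - i).natAbs + 1 by omega, this, add_sub_cancel_left]
      exact key _ _ (by simp only [supNorm]; omega)
    · have := potA_up_left (i + j + 1) (j + 1 - i).natAbs (by rw [Int.even_iff]; omega)
      rw [show i + (j + 1) = i + j + 1 by ring,
        show (j - i).natAbs = (j + 1 - i).natAbs + 1 by omega]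
      rw [add_sub_cancel_right] at this
      rw [this, sub_add_cancel_left, abs_neg]
      exact key _ _ (by simp only [supNorm]; omega)

lemma tendsto_cofinite_of_mul_supNorm {f : ℤ × ℤ → ℝ} {C : ℝ}
    (h : ∀ v, |f v| * (supNorm v : ℝ) ≤ C) : Tendsto f cofinite (𝓝 0) := by
  rw [Metric.tendsto_nhds]
  intro ε hε
  obtain ⟨N, hN⟩ := exists_nat_gt (C / ε)
  rw [div_lt_iff₀ hε] at hN
  refine (box N).finite_toSet.subset fun v hv => ?_
  simp only [Set.mem_compl_iff, Set.mem_ofPred_eq, dist_zero_right, Real.norm_eq_abs, not_lt] at hv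
  rw [Finset.mem_coe, mem_box]
  by_contra! hlt
  have h1 := h v
  have h2 : (N : ℝ) ≤ supNorm v := by exact_mod_cast hlt.le
  have h3 : (0 : ℝ) ≤ N := Nat.cast_nonneg N
  nlinarith

/-- The translations `z` such that `pot (w + z) - pot w` vanishes at infinity. -/
def flatTranslations : AddSubgroup (ℤ × ℤ) where
  carrier := {z | Tendsto (fun w => pot (w + z) - pot w) cofinite (𝓝 0)}
  zero_mem' := by simp
  add_mem' {z z'} h h' := by
    have := (h'.comp (add_left_injective z).tendsto_cofinite).add h
    rw [zero_add] at this
    refine this.congr fun w => ?_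
    simp only [Function.comp]
    rw [← add_assoc]; ring
  neg_mem' {z} h := by
    have := (h.comp (add_left_injective (-z)).tendsto_cofinite).neg
    rw [neg_zero] at this
    refine this.congr fun w => ?_
    simp only [Function.comp]
    rw [neg_add_cancel_right]; ring

lemma tendsto_pot_sub (z : ℤ × ℤ) : Tendsto (fun w => pot (w + z) - pot w) cofinite (𝓝 0) := by
  change z ∈ flatTranslations
  have h1 : ((1, 0) : ℤ × ℤ) ∈ flatTranslations :=
    tendsto_cofinite_of_mul_supNorm fun v => (abs_pot_sub_le v).1
  have h2 : ((0, 1) : ℤ × ℤ) ∈ flatTranslations :=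
    tendsto_cofinite_of_mul_supNorm fun v => (abs_pot_sub_le v).2
  have := flatTranslations.add_mem (flatTranslations.zsmul_mem h1 z.1)
    (flatTranslations.zsmul_mem h2 z.2)
  simpa using this

lemma tendsto_pot_sub_sub (u v : ℤ × ℤ) :
    Tendsto (fun w => pot (w - u) - pot (w - v)) cofinite (𝓝 0) := by
  refine ((tendsto_pot_sub (v - u)).comp (sub_left_injective (b := v)).tendsto_cofinite).congr
    fun w => ?_
  simp

lemma abs_pot_sub_sub_bounded (u v : ℤ × ℤ) : ∃ C : ℝ, ∀ w, |pot (w - u) - pot (w - v)| ≤ C := by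
  have h := (tendsto_pot_sub_sub u v).abs.bddAbove_range_of_cofinite
  obtain ⟨C, hC⟩ := h
  exact ⟨C, fun w => hC ⟨w, rfl⟩⟩

/-! ### Values of the potential kernel -/

/-- The numbers `a + b / π` with rational `a` and `b`. -/
def IsPiRational (r : ℝ) : Prop := ∃ a b : ℚ, r = a + b * (1 / Real.pi)

lemma IsPiRational.add {r t : ℝ} (hr : IsPiRational r) (ht : IsPiRational t) :
    IsPiRational (r + t) := by
  obtain ⟨a, b, rfl⟩ := hr
  obtain ⟨c, d, rfl⟩ := ht
  exact ⟨a + c, b + d, by push_cast; ring⟩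

lemma IsPiRational.const_mul (q : ℚ) {r : ℝ} (hr : IsPiRational r) : IsPiRational (q * r) := by
  obtain ⟨a, b, rfl⟩ := hr
  exact ⟨q * a, q * b, by push_cast; ring⟩

lemma IsPiRational.sub {r t : ℝ} (hr : IsPiRational r) (ht : IsPiRational t) :
    IsPiRational (r - t) := by
  have := hr.add (ht.const_mul (-1))
  convert this using 1
  push_cast; ring

lemma isPiRational_axisPot (n : ℕ) : IsPiRational (axisPot n) := by
  induction n with
  | zero => exact ⟨0, 0, by simp [axisPot]⟩
  | succ n ih =>
    rw [axisPot_succ]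
    refine ih.add ⟨0, 1 / (2 * n + 1), ?_⟩
    push_cast
    rw [zero_add, one_div_mul_one_div, mul_comm]

lemma isPiRational_potA_one (n : ℕ) : IsPiRational (potA (2 * n + 1) 1) := by
  induction n with
  | zero =>
    have := potA_up_right 0 0
    rw [potStep_zero] at this
    simp only [zero_add] at this
    simp only [Nat.cast_zero, mul_zero, zero_add, this]
    have h := potA_axis 0
    simp only [Nat.cast_zero, mul_zero] at h
    rw [h]
    exact (isPiRational_axisPot 0).add ⟨1 / 4, 0, by norm_num⟩
  | succ n ih =>
    have := potA_source (n + 1)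
    rw [if_neg (by omega), show 2 * ((n : ℤ) + 1) - 1 = 2 * n + 1 by ring] at this
    have h := potA_axis (n + 1)
    push_cast at h ⊢
    rw [h] at this
    have e : potA (2 * (n + 1) + 1) 1 = ((2 : ℚ) : ℝ) * axisPot (n + 1) - potA (2 * n + 1) 1 := by
      push_cast; linarith
    rw [e]
    exact ((isPiRational_axisPot _).const_mul 2).sub ih

/-- Harmonicity gives the row `y + 2` from the two rows below, moving outwards in steps of two. The
start is `potA_column` in column 0; in column 1 the symmetry `potA_neg` identifies the columns 1 and
-1. -/
lemma isPiRational_potA_succ {y : ℕ} (h0 : ∀ n : ℕ, Even ((n : ℤ) + y) → IsPiRational (potA n y))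
    (h1 : ∀ n : ℕ, Even ((n : ℤ) + (y + 1 : ℕ)) → IsPiRational (potA n (y + 1))) (n : ℕ)
    (h : Even ((n : ℤ) + (y + 2 : ℕ))) : IsPiRational (potA n (y + 2)) := by
  induction n using Nat.strong_induction_on with
  | _ n ih =>
    rcases n with _ | _ | n
    · obtain ⟨k, hk⟩ : ∃ k, y + 2 = 2 * k := ⟨(y + 2) / 2, by
        rw [Int.even_iff] at h; push_cast at h; omega⟩
      rw [hk, Nat.cast_zero, potA_column]
      exact isPiRational_axisPot k
    · have e1 := potA_harmonic 0 y (by rw [Int.even_iff] at h ⊢; push_cast at h ⊢; omega)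
      have e2 := potA_neg 1 (y + 2) (by simpa using h)
      have e3 := potA_neg 1 y (by rw [Int.even_iff] at h ⊢; push_cast at h ⊢; omega)
      rw [zero_add, zero_sub, e2, e3] at e1
      have a1 := h1 0 (by rw [Int.even_iff] at h ⊢; push_cast at h ⊢; omega)
      have a2 := h0 1 (by rw [Int.even_iff] at h ⊢; push_cast at h ⊢; omega)
      push_cast at a1 a2 ⊢
      have e : potA 1 (y + 2) = ((2 : ℚ) : ℝ) * potA 0 (y + 1) - potA 1 y := by
        push_cast; linarith
      rw [e]
      exact (a1.const_mul 2).sub a2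
    · have e1 := potA_harmonic (n + 1) y (by rw [Int.even_iff] at h ⊢; push_cast at h ⊢; omega)
      have a0 := ih n (by omega) (by rw [Int.even_iff] at h ⊢; push_cast at h ⊢; omega)
      have a1 := h1 (n + 1) (by rw [Int.even_iff] at h ⊢; push_cast at h ⊢; omega)
      have a2 := h0 n (by rw [Int.even_iff] at h ⊢; push_cast at h ⊢; omega)
      have a3 := h0 (n + 2) (by rw [Int.even_iff] at h ⊢; push_cast at h ⊢; omega)
      rw [add_sub_cancel_right] at e1
      push_cast at a1 a3 ⊢
      rw [show (n : ℤ) + 1 + 1 = n + 2 by ring] at *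
      have e : potA (n + 2) (y + 2) = ((4 : ℚ) : ℝ) * potA (n + 1) (y + 1) - potA n (y + 2) -
          potA (n + 2) y - potA n y := by
        push_cast; linarith
      rw [e]
      exact (((a1.const_mul 4).sub a0).sub a3).sub a2

lemma isPiRational_potA_nat (y : ℕ) :
    (∀ n : ℕ, Even ((n : ℤ) + y) → IsPiRational (potA n y)) ∧
    ∀ n : ℕ, Even ((n : ℤ) + (y + 1 : ℕ)) → IsPiRational (potA n (y + 1)) := by
  induction y with
  | zero =>
    refine ⟨fun n _ => ?_, fun n h => ?_⟩
    · rw [potA]; exact isPiRational_axisPot _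
    · obtain ⟨k, rfl⟩ : ∃ k, n = 2 * k + 1 := ⟨n / 2, by
        rw [Int.even_iff] at h; push_cast at h; omega⟩
      exact_mod_cast isPiRational_potA_one k
  | succ y ih => exact ⟨ih.2, isPiRational_potA_succ ih.1 ih.2⟩

lemma isPiRational_pot (v : ℤ × ℤ) : IsPiRational (pot v) := by
  have h := even_add_natAbs v
  rw [pot]
  rcases le_total 0 (v.1 + v.2) with h0 | h0
  · obtain ⟨n, hn⟩ := Int.eq_ofNat_of_zero_le h0
    rw [hn] at h ⊢
    exact (isPiRational_potA_nat _).1 n h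
  · obtain ⟨n, hn⟩ := Int.eq_ofNat_of_zero_le (neg_nonneg.mpr h0)
    rw [← potA_neg _ _ h, hn]
    refine (isPiRational_potA_nat _).1 n ?_
    rw [Int.even_iff] at h ⊢
    omega

/-! ### The slit plane -/

lemma swap_eq_of_mem_slit {w : ℤ × ℤ} (hw : w ∈ slit) : w.swap = w := by
  rw [mem_slit] at hw; ext <;> simp [hw.1]

/-- The method of images: the difference of potential kernels is bounded and vanishes on the whole
diagonal, hence on the slit, and it has the Laplacian of the left-hand side. Uniqueness applies. -/
lemma GD_sub_swap {v : ℤ × ℤ} (hv : v ∉ slit) (w : ℤ × ℤ) :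
    GD v w - GD v.swap w = pot (w - v.swap) - pot (w - v) := by
  have hv' := swap_notMem_slit hv
  obtain ⟨z1, a1, C1, b1⟩ := isInverseRow_GD hv
  obtain ⟨z2, a2, C2, b2⟩ := isInverseRow_GD hv'
  obtain ⟨C3, b3⟩ := abs_pot_sub_sub_bounded v.swap v
  have := eq_zero_of_harmonic isSign_one nondeg_slit
    (g := fun w => (GD v w - GD v.swap w) - (pot (w - v.swap) - pot (w - v))) (fun w hw => ?_)
    (fun w hw => ?_) ⟨(C1 + C2) + C3, fun w => ?_⟩ w
  · linarith
  · rw [z1 w hw, z2 w hw, ← pot_swap (w - v.swap), Prod.swap_sub, Prod.swap_swap,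
      swap_eq_of_mem_slit hw]
    ring
  · rw [laplacian_sub, laplacian_sub, laplacian_sub, a1 w hw, a2 w hw, laplacian_pot_sub,
      laplacian_pot_sub]
    split_ifs <;> norm_num
  · exact (abs_sub _ _).trans (add_le_add ((abs_sub _ _).trans (add_le_add (b1 w) (b2 w))) (b3 w))

theorem exists_rat_GZ (u v : ℤ × ℤ) : ∃ a b : ℚ, GZ u v = a + b * √2 := by
  obtain ⟨a, b, d, -, -, -, h⟩ := exists_computable_GZ
  refine ⟨a (u, v) / d (u, v), b (u, v) / d (u, v), ?_⟩
  rw [(h u v).2]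
  push_cast
  ring

/-- `GD v` is half the sum of its parts even and odd under `swap`. The even part lies in ℚ[√2] by
`GZ_add_swap`, the odd part in ℚ + ℚ/π by `GD_sub_swap`. -/
theorem exists_rat_GD (v w : ℤ × ℤ) :
    ∃ a b c : ℚ, GD v w = a + b * (1 / √2) + c * (1 / Real.pi) := by
  by_cases hv : v ∈ slit
  · exact ⟨0, 0, 0, by rw [GD_of_mem hv]; simp⟩
  obtain ⟨a1, b1, h1⟩ := exists_rat_GZ v w
  obtain ⟨a2, b2, h2⟩ := exists_rat_GZ v.swap w
  obtain ⟨a, c, h3⟩ := ((isPiRational_pot (w - v.swap)).sub (isPiRational_pot (w - v)))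
  have e1 := GZ_add_swap hv w
  have e2 := GD_sub_swap hv w
  refine ⟨(a1 + a2 + a) / 2, b1 + b2, c / 2, ?_⟩
  have hs : 1 / √2 = √2 / 2 := by
    rw [div_eq_div_iff (by positivity) (by norm_num)]
    have := Real.mul_self_sqrt (show (0 : ℝ) ≤ 2 by norm_num)
    linarith
  rw [hs]
  rw [h3] at e2
  rw [h1, h2] at e1
  push_cast
  linarith

/-! ### Convergence to the potential kernel -/

/-- By recurrence `Nondeg` fails for the plain lattice without boundary. Any vertex outside `U`
serves as boundary and does not affect the Dirichlet problem on `U`. -/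
lemma exists_nondeg_one (U : Finset (ℤ × ℤ)) : ∃ B : Set (ℤ × ℤ),
    Nondeg (1 : ℤ × ℤ → ℤ × ℤ → ℝ) B ∧ ∀ x ∈ U, x ∉ B := by
  obtain ⟨p, hp⟩ := Infinite.exists_notMem_finset U
  exact ⟨{p}, nondeg_of_mem isSign_one (Set.mem_singleton p),
    fun x hx h => hp (by rwa [← Set.mem_singleton_iff.mp h])⟩

/-- The difference of the rows at `w` and `v`, corrected by potential kernels, is harmonic in `U n`.
Outside it equals `pot (x - w) - pot (x - v)`, which is small far away, so by the maximum principle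
it is small at `v`. -/
theorem tendsto_dirichletGreen_sub {U : ℕ → Finset (ℤ × ℤ)}
    (hU : ∀ N, ∀ᶠ n in atTop, box N ⊆ U n) (v w : ℤ × ℤ) :
    Tendsto (fun n => dirichletGreen lattice 1 (U n) v w - dirichletGreen lattice 1 (U n) v v)
      atTop (𝓝 (-pot (w - v))) := by
  rw [Metric.tendsto_nhds]
  intro ε hε
  have h1 := (Metric.tendsto_nhds.mp (tendsto_pot_sub_sub w v)) (ε / 2) (by linarith)
  rw [eventually_cofinite] at h1
  obtain ⟨N, hN⟩ : ∃ N, ∀ x ∉ box N, |pot (x - w) - pot (x - v)| ≤ ε / 2 := by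
    refine ⟨h1.toFinset.sup supNorm, fun x hx => ?_⟩
    by_contra! hlt
    refine hx (mem_box.mpr (Finset.le_sup (f := supNorm) ?_))
    simp only [Set.Finite.mem_toFinset, Set.mem_ofPred_eq, dist_zero_right, Real.norm_eq_abs, not_lt]
    exact hlt.le
  filter_upwards [hU N, hU (supNorm v), hU (supNorm w)] with n hn hv hw
  have hvU : v ∈ U n := hv (mem_box.mpr le_rfl)
  have hwU : w ∈ U n := hw (mem_box.mpr le_rfl)
  obtain ⟨B, hnd, hB⟩ := exists_nondeg_one (U n)
  obtain ⟨z1, a1⟩ := dirichletGreen_row isSign_one hnd hB hvU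
  obtain ⟨z2, a2⟩ := dirichletGreen_row isSign_one hnd hB hwU
  have := abs_le_of_harmonicOn (U := U n) (M := ε / 2) isSign_one
    (g := fun x => (dirichletGreen lattice 1 (U n) w x - dirichletGreen lattice 1 (U n) v x) +
      (pot (x - w) - pot (x - v))) (fun x hx => ?_) (fun x hx => ?_) v
  · rw [sub_self, pot_zero, sub_zero, dirichletGreen_comm isSign_one hnd hB w v, ← pot_neg,
      neg_sub] at this
    rw [Real.dist_eq, sub_neg_eq_add]
    linarith
  · rw [laplacian_add (neighborSet_lattice_finite _), laplacian_sub, laplacian_sub,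
      laplacian_pot_sub, laplacian_pot_sub, a1 x hx, a2 x hx]
    split_ifs <;> norm_num
  · rw [z1 x hx, z2 x hx, sub_self, zero_add]
    exact hN x fun h => hx (hn h)

/-! ### Green functions on the branched covers -/

section Cover

variable {X : Type*} {H : SimpleGraph X} {π : X → ℤ × ℤ} {v : X}

lemma laplacian_comp (hb : Set.BijOn π (H.neighborSet v) (lattice.neighborSet (π v)))
    (h : ℤ × ℤ → ℝ) : laplacian H 1 (fun x => h (π x)) v = laplacian lattice 1 h (π v) :=
  finsum_mem_eq_of_bijOn π hb fun _ _ => rfl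

/-- The sign relation is required only after multiplication by `k`, so it may fail at neighbors
where `k` vanishes. This admits the branch vertex of `Σ`. -/
lemma laplacian_twist (hb : Set.BijOn π (H.neighborSet v) (lattice.neighborSet (π v)))
    {σ : X → ℝ} {s : ℤ × ℤ → ℤ × ℤ → ℝ} {k : ℤ × ℤ → ℝ}
    (hs : ∀ x ∈ H.neighborSet v, σ x * k (π x) = σ v * (s (π v) (π x) * k (π x))) :
    laplacian H 1 (fun x => σ x * k (π x)) v = σ v * laplacian lattice s k (π v) := by
  rw [← laplacian_const_mul (neighborSet_lattice_finite _)]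
  refine finsum_mem_eq_of_bijOn π hb fun x hx => ?_
  simp only [Pi.one_apply, one_mul]
  rw [hs x hx]
  ring

end Cover

/-- The sign of a sheet. -/
def sheetSign (b : Bool) : ℝ := if b then -1 else 1

lemma sheetSign_mul_self (b : Bool) : sheetSign b * sheetSign b = 1 := by
  cases b <;> simp [sheetSign]

lemma sheetSign_not (b : Bool) : sheetSign (!b) = -sheetSign b := by
  cases b <;> simp [sheetSign]

lemma sheetSign_of_adj {b c : Bool} {p q : ℤ × ℤ} (h : b = c ↔ s(p, q) ∉ diagonalZipper) :
    sheetSign c = sheetSign b * zipperSign diagonalZipper p q := by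
  unfold zipperSign
  by_cases hz : s(p, q) ∈ diagonalZipper <;> cases b <;> cases c <;>
    simp_all [sheetSign]

lemma sheet_unique {b c d : Bool} {P : Prop} (h1 : b = c ↔ P) (h2 : b = d ↔ P) : c = d := by
  by_cases hP : P <;> cases b <;> cases c <;> cases d <;> simp_all

lemma sheet_exists (b : Bool) (P : Prop) : ∃ c : Bool, b = c ↔ P := by
  by_cases hP : P
  · exact ⟨b, by simp [hP]⟩
  · exact ⟨!b, by simp [hP]⟩

/-! #### The cover branched over a face -/

lemma xiGraph_bijOn (x : XiVertex) :
    Set.BijOn Prod.fst (xiGraph.neighborSet x) (lattice.neighborSet x.1) := by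
  refine ⟨fun y hy => hy.1, fun y hy z hz h => ?_, fun q hq => ?_⟩
  · refine Prod.ext h (sheet_unique hy.2 ?_)
    rw [h]; exact hz.2
  · obtain ⟨c, hc⟩ := sheet_exists x.2 (s(x.1, q) ∉ diagonalZipper)
    exact ⟨(q, c), ⟨hq, hc⟩, rfl⟩

lemma xiGraph_finite (x : XiVertex) : (xiGraph.neighborSet x).Finite :=
  (xiGraph_bijOn x).finite_iff_finite.mpr (neighborSet_lattice_finite _)

/-- The projection of `xiBox n`. -/
noncomputable def halfBox (n : ℕ) : Finset (ℤ × ℤ) :=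
  Finset.Icc (-(n : ℤ)) (n - 1) ×ˢ Finset.Icc (-(n : ℤ)) (n - 1)

lemma mem_xiBox {n : ℕ} {x : XiVertex} : x ∈ xiBox n ↔ x.1 ∈ halfBox n := by
  simp [xiBox, halfBox]

/-- A delta function on the cover is half the sum of a sheet-even and a sheet-odd function. Even
functions descend to the lattice, and odd ones descend to the lattice with zipper signs. -/
lemma dirichletGreen_xi {n : ℕ} {v w : XiVertex} (hv : v ∈ xiBox n) (hw : w ∈ xiBox n) :
    dirichletGreen xiGraph 1 (xiBox n) v w = (dirichletGreen lattice 1 (halfBox n) v.1 w.1 +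
      sheetSign v.2 * (sheetSign w.2 *
        dirichletGreen lattice (zipperSign diagonalZipper) (halfBox n) v.1 w.1)) / 2 := by
  obtain ⟨B, hnd, hB⟩ := exists_nondeg_one (halfBox n)
  have hz := nondeg_zipper isZipper_diagonalZipper ∅
  have hz0 : ∀ x ∈ halfBox n, x ∉ (∅ : Set (ℤ × ℤ)) := fun x _ h => h
  have hsz := isSign_zipperSign diagonalZipper
  rw [dirichletGreen_eq_of_rows xiGraph_finite (xiBox n) (fun u x => 1 / 2 *
    (dirichletGreen lattice 1 (halfBox n) u.1 x.1 + sheetSign u.2 * (sheetSign x.2 *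
        dirichletGreen lattice (zipperSign diagonalZipper) (halfBox n) u.1 x.1))) ?_ ?_ hv hw,
    dirichletGreen_comm isSign_one hnd hB, dirichletGreen_comm hsz hz hz0]
  · ring
  · intro u hu x hx
    rw [mem_xiBox] at hx
    rw [dirichletGreen_of_notMem fun h => hx h.2, dirichletGreen_of_notMem fun h => hx h.2]
    simp
  · intro u hu x hx
    have hu' := hu
    rw [mem_xiBox] at hu hx
    have hfin := xiGraph_finite x
    rw [laplacian_const_mul hfin, laplacian_add hfin, laplacian_const_mul hfin,
      laplacian_comp (xiGraph_bijOn x), laplacian_twist (σ := fun y : XiVertex => sheetSign y.2)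
        (s := zipperSign diagonalZipper) (xiGraph_bijOn x)
        (fun y hy => by rw [sheetSign_of_adj hy.2]; ring),
      (dirichletGreen_row isSign_one hnd hB hu).2 _ hx, (dirichletGreen_row hsz hz hz0 hu).2 _ hx]
    obtain ⟨p, b⟩ := u
    obtain ⟨q, c⟩ := x
    by_cases hpq : q = p
    · subst hpq
      cases b <;> cases c <;> simp [sheetSign] <;> norm_num
    · simp [hpq]

lemma exists_box_subset_halfBox (N : ℕ) : ∀ᶠ n in atTop, box N ⊆ halfBox n := by
  filter_upwards [eventually_ge_atTop (N + 1)] with n hn x hx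
  rw [mem_box, supNorm] at hx
  simp only [halfBox, Finset.mem_product, Finset.mem_Icc]
  omega

lemma tendsto_atTop_of_box {U : ℕ → Finset (ℤ × ℤ)} (hU : ∀ N, ∀ᶠ n in atTop, box N ⊆ U n) :
    Tendsto U atTop atTop := by
  refine tendsto_atTop.mpr fun V => ?_
  filter_upwards [hU (V.sup supNorm)] with n hn
  exact fun x hx => hn (mem_box.mpr (Finset.le_sup (f := supNorm) hx))

lemma tendsto_xi (v w : XiVertex) :
    Tendsto (fun n => dirichletGreen xiGraph 1 (xiBox n) v w - dirichletGreen xiGraph 1 (xiBox n) v v)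
      atTop (𝓝 ((-pot (w.1 - v.1) + (sheetSign v.2 * (sheetSign w.2 * GZ v.1 w.1) -
        GZ v.1 v.1)) / 2)) := by
  have hU := exists_box_subset_halfBox
  have h1 := tendsto_dirichletGreen_sub hU v.1 w.1
  have hz : ∀ q, Tendsto (fun n => dirichletGreen lattice (zipperSign diagonalZipper) (halfBox n)
      v.1 q) atTop (𝓝 (GZ v.1 q)) := fun q => by
    have := (greenConverges (isSign_zipperSign diagonalZipper)
      (nondeg_zipper isZipper_diagonalZipper ∅) v.1 q).comp (tendsto_atTop_of_box hU)
    refine this.congr fun n => ?_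
    simp [Function.comp]
  refine ((h1.add ((((hz w.1).const_mul (sheetSign w.2)).const_mul (sheetSign v.2)).sub
    (hz v.1))).div_const 2).congr' ?_
  filter_upwards [hU (supNorm v.1), hU (supNorm w.1)] with n hv hw
  have hv := mem_xiBox.mpr (hv (mem_box.mpr le_rfl))
  have hw := mem_xiBox.mpr (hw (mem_box.mpr le_rfl))
  rw [dirichletGreen_xi hv hw, dirichletGreen_xi hv hv, ← mul_assoc (sheetSign v.2) (sheetSign v.2),
    sheetSign_mul_self]
  ring

theorem potentialConverges_xi (v w : XiVertex) : PotentialConverges xiGraph xiBox v w := by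
  have h := tendsto_xi v w
  rwa [← h.limUnder_eq] at h

lemma GXi_eq (v w : XiVertex) : GXi v w = (-pot (w.1 - v.1) +
    (sheetSign v.2 * (sheetSign w.2 * GZ v.1 w.1) - GZ v.1 v.1)) / 2 :=
  (tendsto_xi v w).limUnder_eq

/-- The potential kernel and the diagonal term do not depend on the sheet of `v` and cancel. -/
theorem GXiA_eq (v w : XiVertex) : GXiA v w = sheetSign v.2 * sheetSign w.2 * GZ v.1 w.1 := by
  rw [GXiA, GXi_eq, GXi_eq]
  simp only [xiSwap, sheetSign_not]
  ring

/-! #### The cover branched over a vertex -/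

lemma zero_ne_of_adj {q : ℤ × ℤ} (h : lattice.Adj 0 q) : q ≠ 0 := fun e =>
  lattice.loopless.irrefl _ (e ▸ h)

lemma sigmaGraph_bijOn {x : SigmaVertex} (hx : x.1.1 ≠ 0) :
    Set.BijOn (fun y : SigmaVertex => y.1.1) (sigmaGraph.neighborSet x)
      (lattice.neighborSet x.1.1) := by
  refine ⟨fun y hy => hy.1, fun y hy z hz h => ?_, fun q hq => ?_⟩
  · dsimp only at h
    refine Subtype.ext (Prod.ext h ?_)
    by_cases h0 : y.1.1 = 0
    · rw [y.2 h0, z.2 (h ▸ h0)]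
    · have hy' := (hy.2.resolve_left hx).resolve_left h0
      have hz' := (hz.2.resolve_left hx).resolve_left (h ▸ h0)
      rw [← h] at hz'
      exact sheet_unique hy' hz'
  · by_cases h0 : q = 0
    · exact ⟨⟨(q, false), fun _ => rfl⟩, ⟨hq, Or.inr (Or.inl h0)⟩, rfl⟩
    · obtain ⟨c, hc⟩ := sheet_exists x.1.2 (s(x.1.1, q) ∉ diagonalZipper)
      exact ⟨⟨(q, c), fun h => absurd h h0⟩, ⟨hq, Or.inr (Or.inr hc)⟩, rfl⟩

lemma sigmaGraph_finite (x : SigmaVertex) : (sigmaGraph.neighborSet x).Finite :=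
  (((neighborSet_lattice_finite x.1.1).prod (Set.finite_univ (α := Bool))).preimage
    Subtype.val_injective.injOn).subset fun _ hy => ⟨hy.1, Set.mem_univ _⟩

lemma mem_sigmaBox {n : ℕ} {x : SigmaVertex} : x ∈ sigmaBox n ↔ x.1.1 ∈ box n := by
  simp [sigmaBox, box]

/-- The eight neighbors of the branch vertex form two copies of the four lattice neighbors: the even
part is doubled, and the sheet signs cancel the odd part. -/
lemma laplacian_sigma_zero {x : SigmaVertex} (hx : x.1.1 = 0) {h k : ℤ × ℤ → ℝ} (hk : k 0 = 0) :
    laplacian sigmaGraph 1 (fun y => h y.1.1 + sheetSign y.1.2 * k y.1.1) x =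
      2 * laplacian lattice 1 h 0 := by
  have hN : sigmaGraph.neighborSet x =
      (sigmaGraph.neighborSet x ∩ {y | y.1.2 = false}) ∪
        (sigmaGraph.neighborSet x ∩ {y | y.1.2 = true}) := by
    rw [← Set.inter_union_distrib_left, eq_comm, Set.inter_eq_left]
    intro y _
    cases hy : y.1.2
    · exact Or.inl hy
    · exact Or.inr hy
  have hd : Disjoint (sigmaGraph.neighborSet x ∩ {y | y.1.2 = false})
      (sigmaGraph.neighborSet x ∩ {y | y.1.2 = true}) := by
    rw [Set.disjoint_left]
    rintro y ⟨_, h1⟩ ⟨_, h2⟩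
    have h1' : y.1.2 = false := h1
    have h2' : y.1.2 = true := h2
    rw [h1'] at h2'
    cases h2'
  have hsheet : ∀ b : Bool, ∑ᶠ y ∈ sigmaGraph.neighborSet x ∩ {y | y.1.2 = b},
      ((h x.1.1 + sheetSign x.1.2 * k x.1.1) -
        (1 : SigmaVertex → SigmaVertex → ℝ) x y * (h y.1.1 + sheetSign y.1.2 * k y.1.1)) =
      laplacian lattice 1 h 0 + sheetSign b * laplacian lattice 1 k 0 := by
    intro b
    rw [← laplacian_const_mul (neighborSet_lattice_finite _),
      ← laplacian_add (neighborSet_lattice_finite _)]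
    refine finsum_mem_eq_of_bijOn (fun y : SigmaVertex => y.1.1)
      ⟨fun y hy => ?_, fun y hy z hz e => ?_, fun q hq => ?_⟩ fun y hy => ?_
    · have h1 : lattice.Adj x.1.1 y.1.1 := hy.1.1
      rw [hx] at h1
      exact h1
    · have h1 : y.1.2 = b := hy.2
      have h2 : z.1.2 = b := hz.2
      exact Subtype.ext (Prod.ext e (h1.trans h2.symm))
    · exact ⟨⟨(q, b), fun e => absurd e (zero_ne_of_adj hq)⟩, ⟨⟨by rw [hx]; exact hq, Or.inl hx⟩, rfl⟩, rfl⟩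
    · have h1 : y.1.2 = b := hy.2
      rw [hx, hk, h1]
      simp [hk]
  rw [laplacian, hN, finsum_mem_union hd ((sigmaGraph_finite x).inter_of_left _)
    ((sigmaGraph_finite x).inter_of_left _), hsheet, hsheet]
  simp only [sheetSign]
  norm_num
  ring

/-- The Green function of the diagonal zipper with Dirichlet boundary at the origin. -/
noncomputable def GZ0 : ℤ × ℤ → ℤ × ℤ → ℝ := greenFunction lattice (zipperSign diagonalZipper) {0}

/-- The part of `box n` off the origin. -/
noncomputable def puncturedBox (n : ℕ) : Finset (ℤ × ℤ) :=
  (box n).filter (· ∉ ({0} : Set (ℤ × ℤ)))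

lemma mem_puncturedBox {n : ℕ} {x : ℤ × ℤ} : x ∈ puncturedBox n ↔ x ∈ box n ∧ x ≠ 0 := by
  simp [puncturedBox]

/-- As for `Ξ`, except that an odd function vanishes at the branch vertex, which the exchange of
sheets fixes; hence the punctured box. At that vertex the factor 1/2 is compensated by the doubling
in `laplacian_sigma_zero`. -/
lemma dirichletGreen_sigma {n : ℕ} {v w : SigmaVertex} (hv : v ∈ sigmaBox n)
    (hw : w ∈ sigmaBox n) :
    dirichletGreen sigmaGraph 1 (sigmaBox n) v w = (dirichletGreen lattice 1 (box n) v.1.1 w.1.1 +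
      sheetSign v.1.2 * (sheetSign w.1.2 *
        dirichletGreen lattice (zipperSign diagonalZipper) (puncturedBox n) v.1.1 w.1.1)) / 2 := by
  obtain ⟨B, hnd, hB⟩ := exists_nondeg_one (box n)
  have hz := nondeg_zipper isZipper_diagonalZipper {0}
  have hz0 : ∀ x ∈ puncturedBox n, x ∉ ({0} : Set (ℤ × ℤ)) := fun x h =>
    (mem_puncturedBox.mp h).2
  have hsz := isSign_zipperSign diagonalZipper
  have hzero : ∀ u, dirichletGreen lattice (zipperSign diagonalZipper) (puncturedBox n) u 0 = 0 :=
    fun u => dirichletGreen_of_notMem fun h => (mem_puncturedBox.mp h.2).2 rfl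
  rw [dirichletGreen_eq_of_rows sigmaGraph_finite (sigmaBox n) (fun u x => 1 / 2 *
    (dirichletGreen lattice 1 (box n) u.1.1 x.1.1 + sheetSign x.1.2 * (sheetSign u.1.2 *
        dirichletGreen lattice (zipperSign diagonalZipper) (puncturedBox n) u.1.1 x.1.1))) ?_ ?_
    hv hw, dirichletGreen_comm isSign_one hnd hB, dirichletGreen_comm hsz hz hz0]
  · ring
  · intro u hu x hx
    rw [mem_sigmaBox] at hx
    rw [dirichletGreen_of_notMem fun h => hx h.2,
      dirichletGreen_of_notMem fun h => hx (mem_puncturedBox.mp h.2).1]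
    simp
  · intro u hu x hx
    rw [mem_sigmaBox] at hu hx
    have hfin := sigmaGraph_finite x
    rw [laplacian_const_mul hfin]
    by_cases hx0 : x.1.1 = 0
    · rw [laplacian_sigma_zero (h := fun q => dirichletGreen lattice 1 (box n) u.1.1 q)
        (k := fun q => sheetSign u.1.2 *
          dirichletGreen lattice (zipperSign diagonalZipper) (puncturedBox n) u.1.1 q) hx0
        (by rw [hzero, mul_zero])]
      have h0 : (0 : ℤ × ℤ) ∈ box n := hx0 ▸ hx
      rw [(dirichletGreen_row isSign_one hnd hB hu).2 _ h0]
      have : (0 = u.1.1) ↔ x = u := by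
        constructor
        · intro e
          exact Subtype.ext (Prod.ext (hx0.trans e) ((x.2 hx0).trans (u.2 e.symm).symm))
        · rintro rfl; exact hx0.symm
      simp only [this]
      split_ifs <;> norm_num
    · have hx' : x.1.1 ∈ puncturedBox n := mem_puncturedBox.mpr ⟨hx, hx0⟩
      rw [laplacian_add hfin, laplacian_comp (π := fun y : SigmaVertex => y.1.1)
          (h := fun q => dirichletGreen lattice 1 (box n) u.1.1 q) (sigmaGraph_bijOn hx0),
        laplacian_twist (π := fun y : SigmaVertex => y.1.1)
          (σ := fun y : SigmaVertex => sheetSign y.1.2) (s := zipperSign diagonalZipper)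
          (k := fun q => sheetSign u.1.2 *
            dirichletGreen lattice (zipperSign diagonalZipper) (puncturedBox n) u.1.1 q)
          (sigmaGraph_bijOn hx0) (fun y hy => ?_),
        laplacian_const_mul (neighborSet_lattice_finite _),
        (dirichletGreen_row isSign_one hnd hB hu).2 _ hx]
      · by_cases hu0 : u.1.1 = 0
        · have h1 : dirichletGreen lattice (zipperSign diagonalZipper) (puncturedBox n) u.1.1 =
              fun _ => 0 := funext fun q =>
            dirichletGreen_of_notMem fun h => (mem_puncturedBox.mp h.1).2 hu0
          have h2 : x ≠ u := fun e => hx0 (e ▸ hu0)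
          rw [h1, laplacian_lattice, if_neg (fun e => hx0 (e.trans hu0)), if_neg h2]
          simp
        · have hu' : u.1.1 ∈ puncturedBox n := mem_puncturedBox.mpr ⟨hu, hu0⟩
          rw [(dirichletGreen_row hsz hz hz0 hu').2 _ hx']
          obtain ⟨⟨p, b⟩, hu1⟩ := u
          obtain ⟨⟨q, c⟩, hx1⟩ := x
          by_cases hpq : q = p
          · subst hpq
            cases b <;> cases c <;> simp [sheetSign] <;> norm_num
          · simp [hpq]
      · by_cases hy0 : y.1.1 = 0
        · simp only [hy0, hzero, mul_zero]
        · have := sheetSign_of_adj ((hy.2.resolve_left hx0).resolve_left hy0)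
          rw [this]; ring

lemma tendsto_sigma (v w : SigmaVertex) :
    Tendsto (fun n => dirichletGreen sigmaGraph 1 (sigmaBox n) v w -
      dirichletGreen sigmaGraph 1 (sigmaBox n) v v)
      atTop (𝓝 ((-pot (w.1.1 - v.1.1) + (sheetSign v.1.2 * (sheetSign w.1.2 * GZ0 v.1.1 w.1.1) -
        GZ0 v.1.1 v.1.1)) / 2)) := by
  have hU : ∀ N, ∀ᶠ n in atTop, box N ⊆ box n := fun N => by
    filter_upwards [eventually_ge_atTop N] with n hn x hx
    exact mem_box.mpr ((mem_box.mp hx).trans hn)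
  have h1 := tendsto_dirichletGreen_sub hU v.1.1 w.1.1
  have hz : ∀ q, Tendsto (fun n => dirichletGreen lattice (zipperSign diagonalZipper)
      (puncturedBox n) v.1.1 q) atTop (𝓝 (GZ0 v.1.1 q)) := fun q => by
    have := (greenConverges (isSign_zipperSign diagonalZipper)
      (nondeg_zipper isZipper_diagonalZipper {0}) v.1.1 q).comp (tendsto_atTop_of_box hU)
    refine this.congr fun n => ?_
    simp only [Function.comp, puncturedBox]
    congr!
  refine ((h1.add ((((hz w.1.1).const_mul (sheetSign w.1.2)).const_mul (sheetSign v.1.2)).sub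
    (hz v.1.1))).div_const 2).congr' ?_
  filter_upwards [hU (supNorm v.1.1), hU (supNorm w.1.1)] with n hv hw
  have hv := mem_sigmaBox.mpr (hv (mem_box.mpr le_rfl))
  have hw := mem_sigmaBox.mpr (hw (mem_box.mpr le_rfl))
  rw [dirichletGreen_sigma hv hw, dirichletGreen_sigma hv hv,
    ← mul_assoc (sheetSign v.1.2) (sheetSign v.1.2), sheetSign_mul_self]
  ring

theorem potentialConverges_sigma (v w : SigmaVertex) :
    PotentialConverges sigmaGraph sigmaBox v w := by
  have h := tendsto_sigma v w
  rwa [← h.limUnder_eq] at h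

lemma GSigma_eq (v w : SigmaVertex) : GSigma v w = (-pot (w.1.1 - v.1.1) +
    (sheetSign v.1.2 * (sheetSign w.1.2 * GZ0 v.1.1 w.1.1) - GZ0 v.1.1 v.1.1)) / 2 :=
  (tendsto_sigma v w).limUnder_eq

lemma GZ0_zero (w : ℤ × ℤ) : GZ0 0 w = 0 :=
  greenFunction_of_mem (isSign_zipperSign diagonalZipper)
    (nondeg_zipper isZipper_diagonalZipper {0}) (Set.mem_singleton 0) w

theorem GSigmaA_eq (v w : SigmaVertex) :
    GSigmaA v w = sheetSign v.1.2 * sheetSign w.1.2 * GZ0 v.1.1 w.1.1 := by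
  rw [GSigmaA, GSigma_eq, GSigma_eq]
  simp only [sigmaSwap]
  split_ifs with h
  · rw [h, GZ0_zero, GZ0_zero]; simp
  · rw [sheetSign_not]; ring

/-- A multiple of the row at 0 is subtracted to enforce the zero at the origin; the factor 2 is the
inverse of `GZ 0 0 = 1 / 2`. -/
lemma GZ0_eq {u : ℤ × ℤ} (hu : u ≠ 0) (v : ℤ × ℤ) : GZ0 u v = GZ u v - 2 * GZ u 0 * GZ 0 v := by
  have hsz := isSign_zipperSign diagonalZipper
  obtain ⟨-, a1, C1, b1⟩ := isInverseRow_greenZipper isZipper_diagonalZipper u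
  obtain ⟨-, a2, C2, b2⟩ := isInverseRow_greenZipper isZipper_diagonalZipper 0
  refine (congrFun (IsInverseRow.eq_greenFunction hsz
    (nondeg_zipper isZipper_diagonalZipper {0}) (u := u) (by simpa using hu)
    (g := fun v => GZ u v - 2 * GZ u 0 * GZ 0 v) ⟨?_, ?_, C1 + |2 * GZ u 0| * C2, ?_⟩) v).symm
  · rintro v rfl
    dsimp only
    rw [GZ_zero_zero]; ring
  · intro v hv
    rw [laplacian_sub, laplacian_const_mul (neighborSet_lattice_finite _)]
    have e1 := a1 v (by simp)
    have e2 := a2 v (by simp)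
    rw [if_neg (by simpa using hv)] at e2
    change laplacian lattice (zipperSign diagonalZipper) (GZ u) v = _ at e1
    change laplacian lattice (zipperSign diagonalZipper) (GZ 0) v = _ at e2
    rw [e1, e2, mul_zero, sub_zero]
  · intro v
    refine (abs_sub _ _).trans (add_le_add (b1 v) ?_)
    rw [abs_mul]
    gcongr
    exact b2 v

theorem exists_rat_GSigmaA (v w : SigmaVertex) : ∃ a b : ℚ, GSigmaA v w = a + b * √2 := by
  obtain ⟨ε, hε⟩ : ∃ ε : ℚ, sheetSign v.1.2 * sheetSign w.1.2 = ε := by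
    cases v.1.2 <;> cases w.1.2
    exacts [⟨1, by simp [sheetSign]⟩, ⟨-1, by simp [sheetSign]⟩, ⟨-1, by simp [sheetSign]⟩,
      ⟨1, by simp [sheetSign]⟩]
  rw [GSigmaA_eq, hε]
  by_cases hv : v.1.1 = 0
  · exact ⟨0, 0, by rw [hv, GZ0_zero]; simp⟩
  obtain ⟨a1, b1, h1⟩ := exists_rat_GZ v.1.1 w.1.1
  obtain ⟨a2, b2, h2⟩ := exists_rat_GZ v.1.1 0
  obtain ⟨a3, b3, h3⟩ := exists_rat_GZ 0 w.1.1
  refine ⟨ε * (a1 - 2 * (a2 * a3 + 2 * b2 * b3)), ε * (b1 - 2 * (a2 * b3 + b2 * a3)), ?_⟩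
  rw [GZ0_eq hv, h1, h2, h3]
  have := Real.mul_self_sqrt (show (0 : ℝ) ≤ 2 by norm_num)
  push_cast
  linear_combination (-2 * ε * b2 * b3 : ℝ) * this

theorem exists_rat_GXiA (v w : XiVertex) : ∃ a b : ℚ, GXiA v w = a + b * √2 := by
  obtain ⟨a, b, h⟩ := exists_rat_GZ v.1 w.1
  rw [GXiA_eq, h]
  cases v.2 <;> cases w.2
  exacts [⟨a, b, by simp [sheetSign]⟩, ⟨-a, -b, by simp [sheetSign]; ring⟩,
    ⟨-a, -b, by simp [sheetSign]; ring⟩, ⟨a, b, by simp [sheetSign]⟩]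

end ZipperGreen

theorem mainTheorem5 :
    -- For every zipper the Green function exists, and it is the unique bounded inverse of the
    -- zipper Laplacian.
    (∀ (f : ℤ × ℤ) (Z : Set (Sym2 (ℤ × ℤ))), IsZipper f Z → ∀ u : ℤ × ℤ,
      (∀ v, GreenConverges lattice (zipperSign Z) ∅ u v) ∧
      IsInverseRow lattice (zipperSign Z) ∅ u (greenZipper Z u) ∧
      ∀ g, IsInverseRow lattice (zipperSign Z) ∅ u g → g = greenZipper Z u) ∧
    -- The same for the slit plane.
    (∀ u : ℤ × ℤ, (∀ v, GreenConverges lattice 1 slit u v) ∧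
      (u ∉ slit → IsInverseRow lattice 1 slit u (GD u) ∧
        ∀ g, IsInverseRow lattice 1 slit u g → g = GD u)) ∧
    IsZipper (-1, -1) diagonalZipper ∧
    -- There is an algorithm that computes `G_Z`, exactly, in `ℚ[√2]`.
    (∃ (a b : (ℤ × ℤ) × (ℤ × ℤ) → ℤ) (d : (ℤ × ℤ) × (ℤ × ℤ) → ℕ),
      Computable a ∧ Computable b ∧ Computable d ∧
      ∀ u v, 0 < d (u, v) ∧ GZ u v = (a (u, v) + b (u, v) * √2) / d (u, v)) ∧
    -- `G_Z(0, ·)` is given by `G_H`.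
    (∀ i j : ℤ, GZ 0 (i, j) = GH (i + j) |j - i| / 2) ∧
    -- The boundary values, the values on the vertical axis and the harmonicity that determine `G_H`.
    (∀ k : ℕ, GH (2 * k) 0 = (Nat.centralBinom k : ℝ) / 4 ^ k) ∧
    (∀ k : ℕ, 1 ≤ k → GH (-2 * k) 0 = 0) ∧
    (∀ k : ℕ, GH 0 (2 * k) + GH 0 (2 * k + 2) = √2 * GH (2 * k) 0) ∧
    (∀ k : ℕ, 1 ≤ k → GH 0 (2 * k) = GH (-1) (2 * k - 1)) ∧
    (∀ x y : ℤ, 1 ≤ y → Even (x + y) →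
      4 * GH x y = GH (x + 1) (y + 1) + GH (x - 1) (y + 1) +
        GH (x + 1) (y - 1) + GH (x - 1) (y - 1)) ∧
    (∀ x : ℤ, 0 ≤ x → Even x →
      2 * GH x 0 - GH (x + 1) 1 - GH (x - 1) 1 = if x = 0 then 1 else 0) ∧
    -- Moving the endpoint of a zipper across an edge `p q` of its end face: rank-two correction.
    (∀ (f f' : ℤ × ℤ) (Z : Set (Sym2 (ℤ × ℤ))) (p q : ℤ × ℤ),
      IsZipper f Z → f ≠ f' → s(p, q) ∈ faceEdges f → s(p, q) ∈ faceEdges f' → s(p, q) ∉ Z →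
      IsZipper f' (insert s(p, q) Z) ∧
      ∀ u v, greenZipper (insert s(p, q) Z) u v = greenZipper Z u v +
        (2 * greenZipper Z u p - 2 * √2 * greenZipper Z u q) * greenZipper Z p v +
        (2 * greenZipper Z u q - 2 * √2 * greenZipper Z u p) * greenZipper Z q v) ∧
    -- Deforming a zipper with its endpoint fixed, or moving it by a lattice symmetry, changes
    -- the Green function only by explicit signs.
    (∀ (f f' : ℤ × ℤ) (Z Z' : Set (Sym2 (ℤ × ℤ))) (φ : lattice ≃g lattice),
      IsZipper f Z → IsZipper f' Z' → φ '' faceCorners f = faceCorners f' →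
      ∃ ε : ℤ × ℤ → ℤˣ,
        (∀ u v, lattice.Adj u v → (ε u = ε v ↔ (s(φ u, φ v) ∈ Z' ↔ s(u, v) ∈ Z))) ∧
        ∀ u v, greenZipper Z' (φ u) (φ v) = ((ε u * ε v : ℤˣ) : ℤ) * greenZipper Z u v) ∧
    -- The antisymmetric Green functions on the branched covers take values in `ℚ[√2]`.
    (∀ v w : SigmaVertex, PotentialConverges sigmaGraph sigmaBox v w ∧
      ∃ a b : ℚ, GSigmaA v w = a + b * √2) ∧
    (∀ v w : XiVertex, PotentialConverges xiGraph xiBox v w ∧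
      ∃ a b : ℚ, GXiA v w = a + b * √2) ∧
    -- The values of `G_D`.
    (∀ v w : ℤ × ℤ, ∃ a b c : ℚ, GD v w = a + b * (1 / √2) + c * (1 / Real.pi)) := by
  
  refine ⟨fun f Z hZ u => ⟨fun v => greenConverges (isSign_zipperSign Z) (nondeg_zipper hZ ∅) u v,
      isInverseRow_greenZipper hZ u, fun g hg => hg.eq_greenFunction (isSign_zipperSign Z)
        (nondeg_zipper hZ ∅) (Set.notMem_empty u)⟩,
    fun u => ⟨fun v => greenConverges isSign_one nondeg_slit u v, fun hu => ⟨isInverseRow_GD hu,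
      fun g hg => hg.eq_greenFunction isSign_one nondeg_slit hu⟩⟩,
    isZipper_diagonalZipper, exists_computable_GZ, fun i j => ?_, fun k => ?_, fun k hk => ?_,
    fun k => ?_, fun k hk => ?_, fun x y hy hxy => ?_, fun x hx hx2 => ?_,
    fun f f' Z p q hZ hne hf hf' he => greenZipper_move hZ hne hf hf' he,
    fun f f' Z Z' φ hZ hZ' hφ => exists_sign_greenZipper hZ hZ' hφ,
    fun v w => ⟨potentialConverges_sigma v w, exists_rat_GSigmaA v w⟩,
    fun v w => ⟨potentialConverges_xi v w, exists_rat_GXiA v w⟩, exists_rat_GD⟩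
  · rw [GZ_zero, Int.abs_eq_natAbs, GH_eq (by rw [Int.even_iff]; omega), Int.natAbs_natCast]
  · rw [GH_eq (by simp), Int.natAbs_zero, halfGreen_even, axisVal]
  · rw [GH_eq (by simp), Int.natAbs_zero, halfGreen_neg k hk]
  · rw [GH_eq (by simp), GH_eq (by rw [Int.even_iff]; omega), GH_eq (by simp), Int.natAbs_zero,
      halfGreen_even, ← halfGreen_column]
    congr 2
  · obtain ⟨n, rfl⟩ := Nat.exists_eq_add_of_le' hk
    rw [GH_eq (by simp), GH_eq (by rw [Int.even_iff]; omega),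
      show (2 * ((n + 1 : ℕ) : ℤ)).natAbs = 2 * n + 2 by omega,
      show (2 * ((n + 1 : ℕ) : ℤ) - 1).natAbs = 2 * n + 1 by omega, halfGreen_neg_one]
  · obtain ⟨n, rfl⟩ : ∃ n : ℕ, y = n + 1 := ⟨(y - 1).toNat, by omega⟩
    rw [Int.even_iff] at hxy
    rw [GH_eq (by rw [Int.even_iff]; omega), GH_eq (by rw [Int.even_iff]; omega),
      GH_eq (by rw [Int.even_iff]; omega), GH_eq (by rw [Int.even_iff]; omega),
      GH_eq (by rw [Int.even_iff]; omega), show ((n : ℤ) + 1).natAbs = n + 1 by omega,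
      show ((n : ℤ) + 1 + 1).natAbs = n + 2 by omega, show ((n : ℤ) + 1 - 1).natAbs = n by omega]
    exact halfGreen_harmonic x n
  · obtain ⟨k, rfl⟩ : ∃ k : ℕ, x = 2 * k := ⟨(x / 2).toNat, by rw [Int.even_iff] at hx2; omega⟩
    rw [GH_eq (by simp), GH_eq (by rw [Int.even_iff]; omega), GH_eq (by rw [Int.even_iff]; omega)]
    have := halfGreen_flux_nonneg k
    simp only [Int.natAbs_zero, Int.natAbs_one, this]
    congr 1
    simp
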